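/- Let $k$ be a field of prime characteristic $p>2$, let $G=\langle g\rangle$ be a cyclic group of finite order $q\ge 1$ with $p\mid q$, and let $R=k\langle x,y\rangle/(x^p,\;y^p,\;yx-xy-\tfrac12x^2)$. The group $G$ acts on $R$ by algebra automorphisms with ${}^gx=x$, ${}^gy=x+y$, and $R\#kG$ denotes the bosonization (as an algebra, the skew group algebra with $gr=({}^gr)g$). The field $k$ is the trivial module over $R$ and $R\#kG$ via $\varepsilon(x)=\varepsilon(y)=0$, $\varepsilon(g)=1$. Put $A=k[x]/(x^p)$, $B=k[y]/(y^p)$ and $[\ell]^{[t]}=\ell(\ell+1)\cdots(\ell+t-1)$. (1) The elements $x^iy^j$ $(0\le i,j<p)$ form a basis of $R$, and $y^rx^\ell=\sum_{t=0}^r\binom rt 2^{-t}[\ell]^{[t]}x^{\ell+t}y^{r-t}$; that is, $R=A\otimes_\tau B$ with $\tau(y^r\otimes x^\ell)=\sum_{t}\binom rt2^{-t}[\ell]^{[t]}x^{\ell+t}\otimes y^{r-t}$. (2) Let $P_\bullet(A)$ be the complex with $P_i(A)=A$ for $i\ge0$ whose differential $P_i(A)\to P_{i-1}(A)$ is multiplication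 by $x$ for $i$ odd and by $x^{p-1}$ for $i$ even, and define $P_\bullet(B)$ likewise with $y$. There is an $R$-module structure on $P_i(A)\otimes P_j(B)=A\otimes B$ in which $x^\ell y^r$ sends $x^m\otimes y^s$ to $\sum_{t=0}^r\binom rt2^{-t}[m+e_i]^{[t]}x^{\ell+m+t}\otimes y^{r-t+s}$, where $e_i=0$ for $i$ even and $e_i=1$ for $i$ odd. With it, $K_\bullet=\mathrm{Tot}(P_\bullet(A)\otimes P_\bullet(B))$, with differential $\sum(d_i\otimes1+(-1)^i1\otimes d_j)$ and augmentation $\varepsilon\otimes\varepsilon$, is a free resolution of $k$ over $R$. The module $K_n$ is free on the elements $\phi_{i,j}=1\otimes1\in P_i(A)\otimes P_j(B)$, $i+j=n$, and (with $\phi_{i,j}=0$ if $i<0$ or $j<0$) \[d(\phi_{i,j})=\begin{cases}x^{p-1}\phi_{i-1,j}+y^{p-1}\phi_{i,j-1}& i,j\text{ even}\\ x^{p-1}\phi_{i-1,j}+y\,\phi_{i,j-1}& i\text{ even},\ j\text{ odd}\\ x\,\phi_{i-1,j}-(y^{p-1}+\frac12xy^{p-2})\phi_{i,j-1}& i\text{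 odd},\ j\text{ even}\\ x\,\phi_{i-1,j}-(y-\frac12x)\phi_{i,j-1}& i,j\text{ odd.}\end{cases}\] (3) Let $\alpha=-y^{p-2}+\sum_{i=1}^{p-2}(-1)^{i+1}\frac{(i+1)!}{2^{i+1}}x^iy^{p-2-i}\in R$. There is a $k$-linear action of $G$ on every $K_n$ with ${}^h(rz)=({}^hr)({}^hz)$ for $h\in G$, $r\in R$, $z\in K_n$, which commutes with the differentials (so that $K_\bullet$ is $G$-equivariant) and satisfies, for all $s\ge0$, \[{}^{g^s}\phi_{i,j}=\begin{cases}\phi_{i,j}\\ \phi_{i,j}+s\,\phi_{i+1,j-1}\\ \phi_{i,j}+\bigl(\sum_{t=0}^{s-1}{}^{g^t}\alpha\bigr)\phi_{i+1,j-1}\end{cases}\qquad {}^{g^{-s}}\phi_{i,j}=\begin{cases}\phi_{i,j}& i\text{ odd}\\ \phi_{i,j}-s\,\phi_{i+1,j-1}& i\text{ even},\ j\text{ odd}\\ \phi_{i,j}-\bigl(\sum_{t=1}^{s}{}^{g^{-t}}\alpha\bigr)\phi_{i+1,j-1}& i,j\text{ even.}\end{cases}\] (The same three cases apply to both formulas.)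 (4) Let $P_\bullet(kG)$ be the complex with $P_l(kG)=kG$ for $l\ge0$ whose differential $P_l(kG)\to P_{l-1}(kG)$ is multiplication by $g-1$ for $l$ odd and by $\sum_{s=0}^{q-1}g^s$ for $l$ even, and let $\phi_l=1\in P_l(kG)$. Let $R\#kG$ act on $K_a\otimes P_b(kG)$ by $(rh)(z\otimes v)=r({}^hz)\otimes hv$ for $r\in R$, $h\in G$. Then $Y_\bullet=\mathrm{Tot}(K_\bullet\otimes P_\bullet(kG))$, with differential $\sum(d_a\otimes1+(-1)^a1\otimes d_b)$ and augmentation $\varepsilon\otimes\varepsilon$, is a free resolution of $k$ over $R\#kG$. The module $Y_n$ is free on the elements $\phi_{i,j,l}=\phi_{i,j}\otimes\phi_l$, $i+j+l=n$, and (with $\phi_{i,j,l}=0$ if an index is negative) \[d(\phi_{i,j,l})=d(\phi_{i,j})\otimes\phi_l+(-1)^{i+j}\bigl(c_l\,\phi_{i,j,l-1}-c_{i,j,l}\,\phi_{i+1,j-1,l-1}\bigr),\] where $c_l=g-1$ for $l$ odd, $c_l=\sum_{s=0}^{q-1}g^s$ for $l$ even, and \[c_{i,j,l}=\begin{cases}0&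 i\text{ odd}\\ g& i\text{ even},\ j,l\text{ odd}\\ \alpha g& i,j\text{ even},\ l\text{ odd}\\ \sum_{s=0}^{q-1}s\,g^s& i,l\text{ even},\ j\text{ odd}\\ \sum_{s=1}^{q-1}\bigl(\sum_{t=0}^{s-1}{}^{g^t}\alpha\bigr)g^s& i,j,l\text{ even;}\end{cases}\] here $d(\phi_{i,j})\otimes\phi_l$ is the formula of (2) with every $\phi_{a,b}$ replaced by $\phi_{a,b,l}$. (5) For each $n$ the space $\mathrm{Hom}_{R\#kG}(Y_n,k)$ has a $k$-basis $\phi^*_{i,j,l}$, $i+j+l=n$, dual to the $\phi_{i,j,l}$. With $d^*(f)=f\circ d$, \[d^*(\phi^*_{i,j,l})=\begin{cases}\phi^*_{i-1,j+1,l+1}& i\text{ odd},\ j,l\text{ even}\\ 0&\text{otherwise.}\end{cases}\] For every $n\ge0$ the kernel of $d^*$ on $\mathrm{Hom}_{R\#kG}(Y_n,k)$ is spanned by the $\phi^*_{i,j,l}$ with $i+j+l=n$ for which it is not the case that $i$ is odd and $j,l$ are even, and the image of $d^*$ in $\mathrm{Hom}_{R\#kG}(Y_{n+1},k)$ is spanned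 by the $\phi^*_{i,j,l}$ with $i+j+l=n+1$, $i$ even and $j,l$ odd. Consequently, as a $k$-vector space, $H^n(R\#kG,k)=\mathrm{Ext}^n_{R\#kG}(k,k)$ is isomorphic to the span of all $\phi^*_{i,j,l}$ with $i+j+l=n$ except, for $n$ even, those with $i$ even and $j,l$ odd, and, for $n$ odd, those with $i$ odd and $j,l$ even. -/

import Mathlib

open scoped TensorProduct

universe u

noncomputable section

namespace JordanBosonization

/-! ### Generic homological notions -/

section Generic

/-- `⋯ → Y 1 → Y 0 → M → 0` is a free resolution of the `S`-module `M`. -/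
structure IsFreeResolution (S : Type*) [Ring S] {M : Type*} [AddCommGroup M] [Module S M]
    (Y : ℕ → Type*) [∀ n, AddCommGroup (Y n)] [∀ n, Module S (Y n)]
    (d : ∀ n, Y (n + 1) →ₗ[S] Y n) (ε : Y 0 →ₗ[S] M) : Prop where
  free : ∀ n, Module.Free S (Y n)
  exact_succ : ∀ n, Function.Exact (d (n + 1)) (d n)
  exact_zero : Function.Exact (d 0) ε
  surjective : Function.Surjective ε

variable (k : Type*) [Field k]

/-- The pairs `(i, j)` of natural numbers with `i + j = n`. -/
abbrev Pairs (n : ℕ) : Type := {ij : ℕ × ℕ // ij.1 + ij.2 = n}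

/-- The triples `(i, j, l)` of natural numbers with `i + j + l = n`. -/
abbrev Triples (n : ℕ) : Type := {t : ℕ × ℕ × ℕ // t.1 + t.2.1 + t.2.2 = n}

section Tot

variable (C D : ℕ → Type*) [∀ i, AddCommGroup (C i)] [∀ i, Module k (C i)]
  [∀ i, AddCommGroup (D i)] [∀ i, Module k (D i)]

/-- Degree `n` of the total complex: the (finite) direct sum of `C i ⊗ D j` over `i + j = n`. -/
abbrev Tot (n : ℕ) : Type _ :=
  (ij : Pairs n) → C ij.1.1 ⊗[k] D ij.1.2

variable {C D}

/-- The differential `∑ (d_i ⊗ 1 + (-1)^i 1 ⊗ d_j)` of the total complex, written through the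
component of the result in `C i ⊗ D j`. -/
def totD (dC : ∀ i, C (i + 1) →ₗ[k] C i) (dD : ∀ j, D (j + 1) →ₗ[k] D j) (n : ℕ) :
    Tot k C D (n + 1) →ₗ[k] Tot k C D n :=
  LinearMap.pi fun ij =>
    (dC ij.1.1).rTensor (D ij.1.2) ∘ₗ
        LinearMap.proj (R := k)
          (φ := fun ab : Pairs (n + 1) => C ab.1.1 ⊗[k] D ab.1.2)
          ⟨(ij.1.1 + 1, ij.1.2), by have := ij.2; dsimp only; omega⟩
      + (-1 : k) ^ ij.1.1 • ((dD ij.1.2).lTensor (C ij.1.1) ∘ₗ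
        LinearMap.proj (R := k)
          (φ := fun ab : Pairs (n + 1) => C ab.1.1 ⊗[k] D ab.1.2)
          ⟨(ij.1.1, ij.1.2 + 1), by have := ij.2; dsimp only; omega⟩)

/-- The augmentation `ε ⊗ ε` of the total complex. -/
def totAug (εC : C 0 →ₗ[k] k) (εD : D 0 →ₗ[k] k) : Tot k C D 0 →ₗ[k] k :=
  LinearMap.mul' k k ∘ₗ TensorProduct.map εC εD ∘ₗ
    LinearMap.proj (R := k)
      (φ := fun ab : Pairs 0 => C ab.1.1 ⊗[k] D ab.1.2) ⟨(0, 0), rfl⟩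

end Tot

/-- A `G`-equivariant structure on a complex `(C, d)` of modules over an algebra `R` on which the
group `G` acts: `k`-linear actions of `G` on all `C n` with `ᵍ(r z) = (ᵍr) (ᵍz)` that commute
with the differentials. -/
structure EquivariantAction (R : Type*) [Ring R] (G : Type*) [Group G] [MulSemiringAction G R]
    (C : ℕ → Type*) [∀ n, AddCommGroup (C n)] [∀ n, Module k (C n)] [∀ n, Module R (C n)]
    (d : ∀ n, C (n + 1) →ₗ[k] C n) where
  rho : ∀ n, Representation k G (C n)
  semilinear : ∀ n (h : G) (r : R) (z : C n), rho n h (r • z) = (h • r) • rho n h z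
  comm_d : ∀ n (h : G) (z : C (n + 1)), d n (rho (n + 1) h z) = rho n h (d n z)

/-- The map `f ↦ f ∘ d` on modules of homomorphisms into `T`. -/
def coboundary {S : Type*} [Ring S] {M N : Type*} (T : Type*) [AddCommGroup M] [Module S M]
    [AddCommGroup N] [Module S N] [AddCommGroup T] [Module S T] [Module k T] [SMulCommClass S k T]
    (d : M →ₗ[S] N) : (N →ₗ[S] T) →ₗ[k] (M →ₗ[S] T) where
  toFun f := f.comp d
  map_add' _ _ := rfl
  map_smul' _ _ := rfl

end Generic

variable (k : Type u) [Field k] (p q : ℕ)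

/-! ### The algebra `R`, the group `G` and the bosonization -/

open FreeAlgebra in
/-- The relations `x ^ p = 0`, `y ^ p = 0`, `y x = x y + x ^ 2 / 2` (here `x = ι 0`, `y = ι 1`). -/
inductive Rel : FreeAlgebra k (Fin 2) → FreeAlgebra k (Fin 2) → Prop
  | x_pow : Rel (ι k 0 ^ p) 0
  | y_pow : Rel (ι k 1 ^ p) 0
  | comm : Rel (ι k 1 * ι k 0) (ι k 0 * ι k 1 + (2⁻¹ : k) • ι k 0 ^ 2)

/-- `R = k⟨x, y⟩ / (x ^ p, y ^ p, y x - x y - x ^ 2 / 2)`. -/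
def R : Type u := RingQuot (Rel k p)

instance : Ring (R k p) := inferInstanceAs (Ring (RingQuot (Rel k p)))
instance : Algebra k (R k p) := inferInstanceAs (Algebra k (RingQuot (Rel k p)))

/-- The projection of the free algebra onto `R`. -/
def toR : FreeAlgebra k (Fin 2) →ₐ[k] R k p := RingQuot.mkAlgHom k (Rel k p)

variable {k p} in
theorem toR_rel {a b : FreeAlgebra k (Fin 2)} (h : Rel k p a b) : toR k p a = toR k p b :=
  RingQuot.mkAlgHom_rel k h

/-- The generator `x` of `R`. -/
def x : R k p := toR k p (FreeAlgebra.ι k 0)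

/-- The generator `y` of `R`. -/
def y : R k p := toR k p (FreeAlgebra.ι k 1)

theorem x_pow : x k p ^ p = 0 := by
  simpa [x] using toR_rel (Rel.x_pow (k := k) (p := p))

theorem y_pow : y k p ^ p = 0 := by
  simpa [y] using toR_rel (Rel.y_pow (k := k) (p := p))

theorem y_mul_x : y k p * x k p = x k p * y k p + (2⁻¹ : k) • x k p ^ 2 := by
  simpa [x, y] using toR_rel (Rel.comm (k := k) (p := p))

/-- The algebra homomorphism out of `R` with prescribed images of `x` and `y`. -/
def lift {E : Type*} [Ring E] [Algebra k E] (a b : E) (ha : a ^ p = 0) (hb : b ^ p = 0)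
    (hab : b * a = a * b + (2⁻¹ : k) • a ^ 2) : R k p →ₐ[k] E :=
  RingQuot.liftAlgHom k (s := Rel k p) ⟨FreeAlgebra.lift k ![a, b], by
    rintro _ _ (_ | _ | _) <;> simp [ha, hb, hab]⟩

section lift

variable {E : Type*} [Ring E] [Algebra k E] (a b : E) (ha : a ^ p = 0) (hb : b ^ p = 0)
    (hab : b * a = a * b + (2⁻¹ : k) • a ^ 2)

theorem lift_x : lift k p a b ha hb hab (x k p) = a :=
  (RingQuot.liftAlgHom_mkAlgHom_apply k _ _ _).trans (by simp)

theorem lift_y : lift k p a b ha hb hab (y k p) = b :=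
  (RingQuot.liftAlgHom_mkAlgHom_apply k _ _ _).trans (by simp)

variable {k p} in
theorem hom_ext {f f' : R k p →ₐ[k] E} (hx : f (x k p) = f' (x k p))
    (hy : f (y k p) = f' (y k p)) : f = f' := by
  refine RingQuot.ringQuot_ext' (S := k) (s := Rel k p) f f' ?_
  apply FreeAlgebra.hom_ext
  funext i
  fin_cases i
  · exact hx
  · exact hy

end lift

theorem add_pow_of_commute [Fact p.Prime] [CharP k p] {E : Type*} [Ring E] [Algebra k E]
    {a b : E} (h : Commute a b) : (a + b) ^ p = a ^ p + b ^ p := by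
  obtain ⟨r, hr⟩ := h.exists_add_pow_prime_eq (Fact.out : p.Prime)
  have : (p : E) = 0 := by
    rw [← map_natCast (algebraMap k E), CharP.cast_eq_zero, map_zero]
  rw [hr, this]; simp

theorem y_mul_x_pow (n : ℕ) :
    y k p * x k p ^ n = x k p ^ n * y k p + ((n : k) * 2⁻¹) • x k p ^ (n + 1) := by
  induction n with
  | zero => simp
  | succ n ih =>
    rw [pow_succ, ← mul_assoc, ih, add_mul, mul_assoc, y_mul_x, mul_add]
    simp only [smul_mul_assoc, mul_smul_comm, ← pow_succ, ← pow_add, Nat.cast_succ,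
      add_mul, add_smul, one_mul]
    rw [show x k p ^ n * (x k p * y k p) = x k p ^ (n + 1) * y k p by rw [pow_succ, mul_assoc]]
    abel

theorem add_smul_pow [Fact p.Prime] [CharP k p] (c : k) : (y k p + c • x k p) ^ p = 0 := by
  set r : Module.End k (R k p) := LinearMap.mulRight k (y k p) with hr
  set a : Module.End k (R k p) := LinearMap.mulLeft k (y k p + c • x k p) - r with hadef
  have hl : Commute (LinearMap.mulLeft k (y k p + c • x k p) : Module.End k (R k p)) r :=
    LinearMap.commute_mulLeft_right _ _
  have hc : Commute a r := by
    rw [hadef]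
    exact Commute.sub_left hl (Commute.refl r)
  have h1 : ∀ n : ℕ, ∃ γ : k, (a ^ n) 1 = γ • x k p ^ n := by
    intro n
    induction n with
    | zero => exact ⟨1, by simp⟩
    | succ n ih =>
      obtain ⟨γ, hγ⟩ := ih
      refine ⟨γ * (n * 2⁻¹ + c), ?_⟩
      rw [pow_succ', Module.End.mul_apply, hγ, map_smul, mul_smul]
      congr 1
      simp only [hadef, r, LinearMap.sub_apply, LinearMap.mulLeft_apply, LinearMap.mulRight_apply,
        add_mul, y_mul_x_pow, smul_mul_assoc, ← pow_succ', add_smul]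
      abel
  have h2 := congrArg (fun f => f 1) (add_pow_of_commute k p hc)
  obtain ⟨γ, hγ⟩ := h1 p
  have h3 : a + r = LinearMap.mulLeft k (y k p + c • x k p) := by simp [hadef]
  simp only [h3, LinearMap.add_apply, hγ, r, LinearMap.pow_mulLeft, LinearMap.pow_mulRight,
    LinearMap.mulLeft_apply, LinearMap.mulRight_apply, mul_one, one_mul, x_pow, y_pow,
    smul_zero, add_zero] at h2
  exact h2

/-- The endomorphism `x ↦ x`, `y ↦ y + c x` of `R`. -/
def sigma [Fact p.Prime] [CharP k p] (c : k) : R k p →ₐ[k] R k p :=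
  lift k p (x k p) (y k p + c • x k p) (x_pow k p) (add_smul_pow k p c) (by
    simp only [add_mul, mul_add, y_mul_x, smul_mul_assoc, mul_smul_comm]
    abel)

theorem sigma_zero [Fact p.Prime] [CharP k p] : sigma k p 0 = AlgHom.id k (R k p) := by
  apply hom_ext <;> simp [sigma, lift_x, lift_y]

theorem sigma_add [Fact p.Prime] [CharP k p] (c c' : k) :
    sigma k p (c + c') = (sigma k p c).comp (sigma k p c') := by
  apply hom_ext
  · simp [sigma, lift_x]
  · simp [sigma, lift_x, lift_y, add_smul]
    abel

/-- The cyclic group of order `q`. -/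
abbrev G : Type := Multiplicative (ZMod q)

/-- The generator `g` of `G`. -/
def g : G q := Multiplicative.ofAdd 1

/-- The action of `G` on `R` by algebra automorphisms with `ᵍx = x`, `ᵍy = x + y`; thus
`g ^ s` acts by `x ↦ x`, `y ↦ y + s x`, which only depends on `s` modulo `q` because the
characteristic `p` divides `q`. -/
instance [Fact p.Prime] [CharP k p] [Fact (p ∣ q)] : MulSemiringAction (G q) (R k p) where
  smul h r := sigma k p (ZMod.castHom (Fact.out : p ∣ q) k h.toAdd) r
  one_smul r := by
    change sigma k p (ZMod.castHom (Fact.out : p ∣ q) k 0) r = r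
    rw [map_zero, sigma_zero]; rfl
  mul_smul h h' r := by
    change sigma k p (ZMod.castHom (Fact.out : p ∣ q) k (h.toAdd + h'.toAdd)) r = _
    rw [map_add, sigma_add]; rfl
  smul_zero h := map_zero (sigma k p _)
  smul_add h := map_add (sigma k p _)
  smul_one h := map_one (sigma k p _)
  smul_mul h := map_mul (sigma k p _)

instance [Fact p.Prime] [CharP k p] [Fact (p ∣ q)] : SMulCommClass (G q) k (R k p) where
  smul_comm _ c r := map_smul (sigma k p _) c r

/-- The bosonization `R # kG`; as an algebra it is the skew group algebra of `G` over `R`, with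
`g r = (ᵍr) g`. -/
abbrev Bos [Fact p.Prime] [CharP k p] [Fact (p ∣ q)] : Type u := SkewMonoidAlgebra (R k p) (G q)

section elements

variable [Fact p.Prime] [CharP k p] [Fact (p ∣ q)]

/-- `r ∈ R` as an element of `R # kG`. -/
def ofR (r : R k p) : Bos k p q := SkewMonoidAlgebra.single 1 r

/-- `h ∈ G` as an element of `R # kG`. -/
def ofG (h : G q) : Bos k p q := SkewMonoidAlgebra.single h 1

end elements

/-! ### Trivial modules -/

/-- The augmentation `ε(x) = ε(y) = 0` of `R`. -/
def augR (hp : p ≠ 0) : R k p →ₐ[k] k := lift k p 0 0 (zero_pow hp) (zero_pow hp) (by simp)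

/-- The augmentation `ε(x) = ε(y) = 0`, `ε(g) = 1` of `R # kG`. -/
def augBos [Fact p.Prime] [CharP k p] [Fact (p ∣ q)] : Bos k p q →ₐ[k] k :=
  SkewMonoidAlgebra.liftNCAlgHom (augR k p (Fact.out : p.Prime).ne_zero) (1 : G q →* k) (by
    intro r h
    simp only [MonoidHom.one_apply, mul_one, one_mul]
    change (augR k p _).comp (sigma k p _) r = _
    congr 1
    apply hom_ext <;> simp [augR, sigma, lift_x, lift_y])

/-- The field `k`, as the trivial module over `R` and over `R # kG`. -/
def Triv : Type u := k

instance : AddCommGroup (Triv k) := inferInstanceAs (AddCommGroup k)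
instance : Module k (Triv k) := inferInstanceAs (Module k k)

/-- `k` as the underlying space of the trivial module. -/
def toTriv : k ≃ₗ[k] Triv k := LinearEquiv.refl k k

instance [Fact p.Prime] : Module (R k p) (Triv k) :=
  Module.compHom (Triv k) (augR k p (Fact.out : p.Prime).ne_zero).toRingHom

instance [Fact p.Prime] [CharP k p] [Fact (p ∣ q)] : Module (Bos k p q) (Triv k) :=
  Module.compHom (Triv k) (augBos k p q).toRingHom

instance [Fact p.Prime] [CharP k p] [Fact (p ∣ q)] : SMulCommClass (Bos k p q) k (Triv k) where
  smul_comm s c t := smul_comm (augBos k p q s) c t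

/-! ### The resolution `K = Tot(P(A) ⊗ P(B))` over `R` -/

/-- The truncated polynomial algebra `k[t]/(t ^ p)`; both `A = k[x]/(x ^ p)` and
`B = k[y]/(y ^ p)` are copies of it. -/
abbrev Trunc : Type u := AdjoinRoot (Polynomial.X ^ p : Polynomial k)

/-- The class `t` of the variable in `k[t]/(t ^ p)`. -/
abbrev root : Trunc k p := AdjoinRoot.root (Polynomial.X ^ p : Polynomial k)

/-- The augmentation `t ↦ 0` of `k[t]/(t ^ p)`. -/
def augTrunc [Fact p.Prime] : Trunc k p →ₐ[k] k :=
  AdjoinRoot.liftAlgHom _ (Algebra.ofId k k) 0 (by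
    simp [(Fact.out : p.Prime).ne_zero])

/-- The differential from degree `i + 1` to degree `i` of the periodic resolution of `k` over
`k[t]/(t ^ p)`: multiplication by `t` if `i + 1` is odd, by `t ^ (p - 1)` if `i + 1` is even. -/
def dTrunc (i : ℕ) : Trunc k p →ₗ[k] Trunc k p :=
  LinearMap.mulLeft k (if Odd (i + 1) then root k p else root k p ^ (p - 1))

/-- `P_i(A)`. -/
def PA (_i : ℕ) : Type u := Trunc k p

/-- `P_j(B)`. -/
def PB (_j : ℕ) : Type u := Trunc k p

instance (i : ℕ) : AddCommGroup (PA k p i) := inferInstanceAs (AddCommGroup (Trunc k p))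
instance (i : ℕ) : Module k (PA k p i) := inferInstanceAs (Module k (Trunc k p))
instance (j : ℕ) : AddCommGroup (PB k p j) := inferInstanceAs (AddCommGroup (Trunc k p))
instance (j : ℕ) : Module k (PB k p j) := inferInstanceAs (Module k (Trunc k p))

/-- The element `x ^ m` of `P_i(A) = A`. -/
def xPow (i m : ℕ) : PA k p i := root k p ^ m

/-- The element `y ^ m` of `P_j(B) = B`. -/
def yPow (j m : ℕ) : PB k p j := root k p ^ m

/-- The differential of `P(A)`. -/
def dA (i : ℕ) : PA k p (i + 1) →ₗ[k] PA k p i := dTrunc k p i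

/-- The differential of `P(B)`. -/
def dB (j : ℕ) : PB k p (j + 1) →ₗ[k] PB k p j := dTrunc k p j

/-- The operator `f ↦ (t ^ 2 f' + e t f) / 2` on polynomials; it maps `t ^ m` to
`((m + e) / 2) t ^ (m + 1)`. -/
def polyOp (e : ℕ) : Polynomial k →ₗ[k] Polynomial k :=
  (2⁻¹ : k) • (LinearMap.mulLeft k (Polynomial.X ^ 2) ∘ₗ Polynomial.derivative
    + (e : k) • LinearMap.mulLeft k Polynomial.X)

theorem polyOp_mul (e : ℕ) (f h : Polynomial k) :
    polyOp k e (f * h) = polyOp k 0 f * h + f * polyOp k e h := by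
  simp only [polyOp, LinearMap.smul_apply, LinearMap.add_apply, LinearMap.comp_apply,
    LinearMap.mulLeft_apply, Polynomial.derivative_mul, Nat.cast_zero, zero_smul, add_zero,
    Polynomial.smul_eq_C_mul]
  ring

theorem dvd_polyOp_zero_X_pow (n : ℕ) :
    (Polynomial.X : Polynomial k) ^ (n + 1) ∣ polyOp k 0 (Polynomial.X ^ n) := by
  cases n with
  | zero => simp [polyOp]
  | succ n =>
    refine ⟨Polynomial.C (2⁻¹ * ((n : k) + 1)), ?_⟩
    simp [polyOp, Polynomial.smul_eq_C_mul]
    ring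

theorem dvd_polyOp (e n : ℕ) (f : Polynomial k) (hf : Polynomial.X ^ n ∣ f) :
    Polynomial.X ^ n ∣ polyOp k e f := by
  obtain ⟨h, rfl⟩ := hf
  rw [polyOp_mul]
  exact dvd_add (((pow_dvd_pow _ n.le_succ).trans (dvd_polyOp_zero_X_pow k n)).mul_right _)
    (dvd_mul_right _ _)

/-- The operator on `k[t]/(t ^ p)` that maps `t ^ m` to `((m + e) / 2) t ^ (m + 1)`. -/
def shiftOp (e : ℕ) : Trunc k p →ₗ[k] Trunc k p where
  toFun := Quotient.lift (fun f => AdjoinRoot.mk _ (polyOp k e f)) (by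
    intro f h hfh
    rw [AdjoinRoot.mk_eq_mk, ← map_sub]
    apply dvd_polyOp
    have := (Submodule.quotientRel_def _).1 hfh
    exact Ideal.mem_span_singleton.1 this)
  map_add' a b := by
    obtain ⟨a, rfl⟩ := AdjoinRoot.mk_surjective a
    obtain ⟨b, rfl⟩ := AdjoinRoot.mk_surjective b
    change AdjoinRoot.mk _ (polyOp k e (a + b)) = _
    rw [map_add, map_add]; rfl
  map_smul' c a := by
    obtain ⟨a, rfl⟩ := AdjoinRoot.mk_surjective a
    change AdjoinRoot.mk _ (polyOp k e (c • a)) = _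
    rw [map_smul, ← AdjoinRoot.smul_mk]; rfl

theorem shiftOp_mk (e : ℕ) (f : Polynomial k) :
    shiftOp k p e (AdjoinRoot.mk _ f) = AdjoinRoot.mk _ (polyOp k e f) := rfl

theorem shiftOp_pow_eq_zero (e : ℕ) : shiftOp k p e ^ p = 0 := by
  have key : ∀ (n : ℕ) (f : Polynomial k), ∃ h : Polynomial k, Polynomial.X ^ n ∣ h ∧
      (shiftOp k p e ^ n) (AdjoinRoot.mk _ f) = AdjoinRoot.mk _ h := by
    intro n f
    induction n with
    | zero => exact ⟨f, by simp, rfl⟩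
    | succ n ih =>
      obtain ⟨_, ⟨h, rfl⟩, hh⟩ := ih
      refine ⟨_, ?_, by rw [pow_succ', Module.End.mul_apply, hh, shiftOp_mk]⟩
      rw [polyOp_mul]
      refine dvd_add ((dvd_polyOp_zero_X_pow k n).mul_right _) ?_
      rw [pow_succ]
      refine mul_dvd_mul_left _ ⟨Polynomial.C 2⁻¹ * (Polynomial.X * Polynomial.derivative h
        + (e : Polynomial k) * h), ?_⟩
      simp [polyOp, Polynomial.smul_eq_C_mul]
      ring
  ext a
  obtain ⟨f, rfl⟩ := AdjoinRoot.mk_surjective a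
  obtain ⟨h, hd, hh⟩ := key p f
  rw [hh, LinearMap.zero_apply, AdjoinRoot.mk_eq_zero]
  exact hd

theorem shiftOp_mul_root (e : ℕ) (a : Trunc k p) :
    shiftOp k p e (root k p * a) =
      root k p * shiftOp k p e a + (2⁻¹ : k) • (root k p * (root k p * a)) := by
  obtain ⟨f, rfl⟩ := AdjoinRoot.mk_surjective a
  rw [shiftOp_mk, root, AdjoinRoot.root, ← map_mul, shiftOp_mk, ← map_mul, ← map_mul,
    AdjoinRoot.smul_mk, ← map_add, polyOp_mul]
  congr 1
  simp [polyOp, Polynomial.smul_eq_C_mul]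
  ring

theorem root_pow : root k p ^ p = 0 := by
  rw [root, AdjoinRoot.root, ← map_pow, AdjoinRoot.mk_self]

/-- Multiplication by `x` on `P_i(A) = A`. -/
def xMul (i : ℕ) : Module.End k (PA k p i) := LinearMap.mulLeft k (root k p)

/-- Multiplication by `y` on `P_j(B) = B`. -/
def yMul (j : ℕ) : Module.End k (PB k p j) := LinearMap.mulLeft k (root k p)

/-- The operator on `P_i(A) = A` that maps `x ^ m` to `(m / 2) x ^ (m + 1)` if `i` is even, and to
`((m + 1) / 2) x ^ (m + 1)` if `i` is odd. -/
def delta (i : ℕ) : Module.End k (PA k p i) := shiftOp k p (i % 2)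

theorem xMul_pow (i : ℕ) : xMul k p i ^ p = 0 := by
  change (LinearMap.mulLeft k (root k p)) ^ p = 0
  rw [LinearMap.pow_mulLeft, root_pow, LinearMap.mulLeft_zero_eq_zero]

theorem yMul_pow (j : ℕ) : yMul k p j ^ p = 0 := by
  change (LinearMap.mulLeft k (root k p)) ^ p = 0
  rw [LinearMap.pow_mulLeft, root_pow, LinearMap.mulLeft_zero_eq_zero]

theorem delta_pow (i : ℕ) : delta k p i ^ p = 0 := shiftOp_pow_eq_zero k p (i % 2)

theorem delta_mul_xMul (i : ℕ) :
    delta k p i * xMul k p i = xMul k p i * delta k p i + (2⁻¹ : k) • xMul k p i ^ 2 := by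
  apply LinearMap.ext
  intro a
  have h := shiftOp_mul_root k p (i % 2) a
  rw [pow_two]
  exact h

/-- The action of `x` on `P_i(A) ⊗ P_j(B) = A ⊗ B`. -/
def xAct (i j : ℕ) : Module.End k (PA k p i ⊗[k] PB k p j) := (xMul k p i).rTensor (PB k p j)

/-- The action of `y` on `P_i(A) ⊗ P_j(B) = A ⊗ B`, that is `a ⊗ b ↦ τ_i(y ⊗ a) (1 ⊗ b)`, where
`τ_i(y ⊗ x ^ m) = x ^ m ⊗ y + (m / 2) x ^ (m + 1) ⊗ 1` if `i` is even and
`τ_i(y ⊗ x ^ m) = x ^ m ⊗ y + ((m + 1) / 2) x ^ (m + 1) ⊗ 1` if `i` is odd. -/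
def yAct (i j : ℕ) : Module.End k (PA k p i ⊗[k] PB k p j) :=
  (yMul k p j).lTensor (PA k p i) + (delta k p i).rTensor (PB k p j)

/-- The `R`-module structure of `P_i(A) ⊗ P_j(B)`, as a homomorphism of algebras. -/
def actHom [Fact p.Prime] [CharP k p] (i j : ℕ) :
    R k p →ₐ[k] Module.End k (PA k p i ⊗[k] PB k p j) :=
  lift k p (xAct k p i j) (yAct k p i j)
    (by rw [xAct, LinearMap.rTensor_pow, xMul_pow, LinearMap.rTensor_zero])
    (by
      have hc : Commute ((yMul k p j).lTensor (PA k p i)) ((delta k p i).rTensor (PB k p j)) := by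
        change LinearMap.comp _ _ = LinearMap.comp _ _
        rw [LinearMap.lTensor_comp_rTensor, LinearMap.rTensor_comp_lTensor]
      rw [yAct, add_pow_of_commute k p hc, LinearMap.rTensor_pow, LinearMap.lTensor_pow,
        yMul_pow, delta_pow, LinearMap.rTensor_zero, LinearMap.lTensor_zero, add_zero])
    (by
      have hc : Commute ((yMul k p j).lTensor (PA k p i)) ((xMul k p i).rTensor (PB k p j)) := by
        change LinearMap.comp _ _ = LinearMap.comp _ _
        rw [LinearMap.lTensor_comp_rTensor, LinearMap.rTensor_comp_lTensor]
      rw [yAct, xAct, add_mul, mul_add, hc.eq, ← LinearMap.rTensor_mul, delta_mul_xMul,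
        LinearMap.rTensor_add, LinearMap.rTensor_smul, LinearMap.rTensor_mul, LinearMap.rTensor_pow,
        add_assoc])

instance [Fact p.Prime] [CharP k p] (i j : ℕ) : Module (R k p) (PA k p i ⊗[k] PB k p j) :=
  Module.compHom _ (actHom k p i j).toRingHom

instance [Fact p.Prime] [CharP k p] (i j : ℕ) :
    IsScalarTower k (R k p) (PA k p i ⊗[k] PB k p j) where
  smul_assoc c r z := by
    change actHom k p i j (c • r) z = c • actHom k p i j r z
    rw [map_smul]; rfl

/-- `K_n = ⨁_{i + j = n} P_i(A) ⊗ P_j(B)`, a module over `R` through the `R`-module structures of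
the summands. -/
abbrev K (n : ℕ) : Type u := Tot k (PA k p) (PB k p) n

/-- The differential of `K`. -/
def dK (n : ℕ) : K k p (n + 1) →ₗ[k] K k p n := totD k (dA k p) (dB k p) n

/-- The augmentation of `K`. -/
def augK [Fact p.Prime] : K k p 0 →ₗ[k] k :=
  totAug k (C := PA k p) (D := PB k p) (augTrunc k p).toLinearMap (augTrunc k p).toLinearMap

/-- The generator `φ_{i,j} = 1 ⊗ 1` of `P_i(A) ⊗ P_j(B)`, as an element of `K_n` where `n = i + j`.
It is `0` if `i` or `j` is negative. -/
def phi (n : ℕ) (i j : ℤ) : K k p n := fun ab =>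
  if (ab.1.1 : ℤ) = i ∧ (ab.1.2 : ℤ) = j then xPow k p ab.1.1 0 ⊗ₜ yPow k p ab.1.2 0 else 0

/-- The coefficient of `φ_{i-1,j}` in `d(φ_{i,j})`. -/
def coeffX (i : ℕ) : R k p := if Even i then x k p ^ (p - 1) else x k p

/-- The coefficient of `φ_{i,j-1}` in `d(φ_{i,j})`. -/
def coeffY (i j : ℕ) : R k p :=
  if Even i then (if Even j then y k p ^ (p - 1) else y k p)
  else if Even j then -(y k p ^ (p - 1) + (2⁻¹ : k) • (x k p * y k p ^ (p - 2)))
  else -(y k p - (2⁻¹ : k) • x k p)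

/-- The element
`α = -y^{p-2} + ∑_{i=1}^{p-2} (-1)^{i+1} ((i+1)! / 2^{i+1}) x^i y^{p-2-i}` of `R`. -/
def alpha : R k p :=
  -y k p ^ (p - 2) + ∑ i ∈ Finset.Icc 1 (p - 2),
    ((-1 : k) ^ (i + 1) * ((i + 1).factorial : k) / 2 ^ (i + 1)) •
      (x k p ^ i * y k p ^ (p - 2 - i))

/-! ### The complex `Y = Tot(K ⊗ P(kG))` over `R # kG` -/

/-- `P_l(kG)`. -/
def PG (_l : ℕ) : Type u := MonoidAlgebra k (G q)

instance (l : ℕ) : AddCommGroup (PG k q l) := inferInstanceAs (AddCommGroup (MonoidAlgebra k (G q)))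
instance (l : ℕ) : Module k (PG k q l) := inferInstanceAs (Module k (MonoidAlgebra k (G q)))

/-- The free generator `φ_l = 1` of `P_l(kG) = kG`. -/
def genPG (l : ℕ) : PG k q l := (1 : MonoidAlgebra k (G q))

/-- The differential from degree `l + 1` to degree `l` of `P(kG)`: multiplication by `g - 1` if
`l + 1` is odd, by `∑_{s < q} g ^ s` if `l + 1` is even. -/
def dG (l : ℕ) : PG k q (l + 1) →ₗ[k] PG k q l :=
  LinearMap.mulLeft k (if Odd (l + 1) then MonoidAlgebra.of k (G q) (g q) - 1
    else ∑ s ∈ Finset.range q, MonoidAlgebra.of k (G q) (g q ^ s))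

/-- The augmentation `g ↦ 1` of `kG`. -/
def augG : PG k q 0 →ₗ[k] k := (MonoidAlgebra.lift k k (G q) (1 : G q →* k)).toLinearMap

/-- The left regular action of `G` on `P_l(kG) = kG`. -/
def regG (l : ℕ) : Representation k (G q) (PG k q l) :=
  MonoidHom.comp
    ((Algebra.lmul k (MonoidAlgebra k (G q))).toRingHom.toMonoidHom :
      MonoidAlgebra k (G q) →* Module.End k (MonoidAlgebra k (G q)))
    (MonoidAlgebra.of k (G q))

section Y

variable {k p q} [Fact p.Prime] [CharP k p] [Fact (p ∣ q)]

/-- The summand `K_a ⊗ P_b(kG)` of `Y`, with the `R # kG`-module structure that comes from the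
`G`-action `E` on `K`. -/
def YSummand (_E : EquivariantAction k (R k p) (G q) (K k p) (dK k p)) (a b : ℕ) : Type u :=
  K k p a ⊗[k] PG k q b

variable (E : EquivariantAction k (R k p) (G q) (K k p) (dK k p))

instance (a b : ℕ) : AddCommGroup (YSummand E a b) :=
  inferInstanceAs (AddCommGroup (K k p a ⊗[k] PG k q b))
instance (a b : ℕ) : Module k (YSummand E a b) :=
  inferInstanceAs (Module k (K k p a ⊗[k] PG k q b))

/-- The twisted action `(r h) (z ⊗ v) = r (ʰz) ⊗ h v` of `R # kG` on `K_a ⊗ P_b(kG)`. -/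
def smashHom (a b : ℕ) : Bos k p q →ₐ[k] Module.End k (K k p a ⊗[k] PG k q b) :=
  SkewMonoidAlgebra.liftNCAlgHom
    ((Module.End.rTensorAlgHom k (K k p a) (PG k q b)).comp (Algebra.lsmul k k (K k p a)))
    ((E.rho a).tprod (regG k q b)) (by
      intro r h
      apply TensorProduct.ext'
      intro z v
      change (((h • r) • E.rho a h z) ⊗ₜ[k] regG k q b h v) = E.rho a h (r • z) ⊗ₜ regG k q b h v
      rw [E.semilinear])

instance (a b : ℕ) : Module (Bos k p q) (YSummand E a b) :=
  (Module.compHom (K k p a ⊗[k] PG k q b) (smashHom E a b).toRingHom :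
    Module (Bos k p q) (K k p a ⊗[k] PG k q b))

/-- `Y_n = ⨁_{a + b = n} K_a ⊗ P_b(kG)`, as a module over `R # kG`; its underlying vector space is
degree `n` of the total complex of `K` and `P(kG)`. -/
abbrev Y (n : ℕ) : Type u := (ab : Pairs n) → YSummand E ab.1.1 ab.1.2

/-- The differential of the total complex `Y`. -/
def dY (n : ℕ) : Y E (n + 1) →ₗ[k] Y E n := totD k (dK k p) (dG k q) n

/-- The augmentation of `Y`. -/
def augY : Y E 0 →ₗ[k] k := totAug k (C := K k p) (D := PG k q) (augK k p) (augG k q)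

/-- The generator `φ_{i,j,l} = φ_{i,j} ⊗ φ_l` of `K_{i+j} ⊗ P_l(kG)`, as an element of `Y_n` where
`n = i + j + l`. It is `0` if one of `i`, `j`, `l` is negative. -/
def phi3 (n : ℕ) (i j l : ℤ) : Y E n := fun ab =>
  if (ab.1.2 : ℤ) = l then
    (phi k p ab.1.1 i j ⊗ₜ[k] genPG k q ab.1.2 : K k p ab.1.1 ⊗[k] PG k q ab.1.2)
  else 0

variable (k p q)

/-- The coefficient of `φ_{i,j,l-1}` in `(-1)^{i+j} d(φ_{i,j,l})`. -/
def coeffG (l : ℕ) : Bos k p q :=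
  if Odd l then ofG k p q (g q) - 1 else ∑ s ∈ Finset.range q, ofG k p q (g q ^ s)

/-- The coefficient of `-φ_{i+1,j-1,l-1}` in `(-1)^{i+j} d(φ_{i,j,l})`. -/
def coeffTwist (i j l : ℕ) : Bos k p q :=
  if Odd i then 0
  else if Odd l then
    (if Odd j then ofG k p q (g q) else ofR k p q (alpha k p) * ofG k p q (g q))
  else
    (if Odd j then ∑ s ∈ Finset.range q, (s : k) • ofG k p q (g q ^ s)
    else ∑ s ∈ Finset.Ico 1 q,
      ofR k p q (∑ t ∈ Finset.range s, g q ^ t • alpha k p) * ofG k p q (g q ^ s))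

end Y

/-- `H^n(R # kG, k) = Ext^n_{R # kG}(k, k)`. -/
abbrev H [Fact p.Prime] [CharP k p] [Fact (p ∣ q)] (n : ℕ) : ModuleCat k :=
  ((Ext k (ModuleCat.{u} (Bos k p q)) n).obj
    (Opposite.op (ModuleCat.of (Bos k p q) (Triv k)))).obj (ModuleCat.of (Bos k p q) (Triv k))

end JordanBosonization

end

open JordanBosonization

/-!
Over `k`, the periodic complexes `P(A)`, `P(B)` and `P(kG)` are resolutions of `k`. A resolution of
`k` over `k` is contractible and contractions tensor together, so `K` and `Y` are exact.

In `P_i(A) ⊗ P_j(B)` a suitable shift of `y` by a multiple of `x` acts on `1 ⊗ B` as multiplication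
by `y`, hence `1 ⊗ 1` generates, and it generates freely since both sides have dimension `p²`. That
`Y` is free over `R # kG` follows by untwisting, `z ⊗ h = h (h⁻¹ z ⊗ 1)`.

On `K` the generator `g` acts semilinearly by `φ_{i,j} ↦ φ_{i,j} + a φ_{i+1,j-1}` with `a` equal to
`0`, `1` or `α`. This commutes with `d` because `-2α = (y + x/2)^{p-2} + y^{p-2}`, and because in
characteristic `p` the factors of `(y + c x)^{p-1}` can be shifted past each other. It has order
dividing `q` because `∑_{s<q} s^m = 0` in `k` for `m < p - 1`.

Of all coefficients of the differential of `Y` only the `g` occurring for `i` even and `j`, `l` odd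
survives the augmentation, so `d*` sends each dual basis vector to a dual basis vector or to zero.
-/

noncomputable section

namespace JordanBosonization

/-! ### Linear algebra -/

section BasisToBasis

variable {k V W ι κ : Type*} [Field k] [AddCommGroup V] [Module k V] [AddCommGroup W] [Module k W]
  (v : Module.Basis ι k V) (w : Module.Basis κ k W) {f : V →ₗ[k] W} {e : ι → κ} {S T : Set ι}

theorem ker_eq_span_of_basis_map (he : Set.InjOn e S) (hS : ∀ t ∈ S, f (v t) = w (e t))
    (hS' : ∀ t ∉ S, f (v t) = 0) : LinearMap.ker f = Submodule.span k (v '' Sᶜ) := by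
  classical
  apply le_antisymm
  · intro a ha
    rw [v.mem_span_image]
    intro t ht htS
    have hcoord : w.coord (e t) ∘ₗ f = v.coord t := by
      refine v.ext fun t' => ?_
      rw [LinearMap.comp_apply, Module.Basis.coord_apply, Module.Basis.coord_apply, v.repr_self,
        Finsupp.single_apply]
      by_cases ht' : t' ∈ S
      · simp only [hS t' ht', w.repr_self, Finsupp.single_apply, he.eq_iff ht' htS]
      · rw [hS' t' ht', map_zero, if_neg (by rintro rfl; exact ht' htS), Finsupp.zero_apply]
    have hat : v.coord t a = 0 := by
      rw [← hcoord, LinearMap.comp_apply, LinearMap.mem_ker.1 ha, map_zero]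
    exact Finsupp.mem_support_iff.1 ht hat
  · rw [Submodule.span_le]
    rintro _ ⟨t, ht, rfl⟩
    exact hS' t ht

theorem range_eq_span_of_basis_map (hS : ∀ t ∈ S, f (v t) = w (e t))
    (hS' : ∀ t ∉ S, f (v t) = 0) : LinearMap.range f = Submodule.span k (w '' (e '' S)) := by
  apply le_antisymm
  · rw [LinearMap.range_eq_map, ← v.span_eq, Submodule.map_span, Submodule.span_le]
    rintro _ ⟨_, ⟨t, rfl⟩, rfl⟩
    by_cases ht : t ∈ S
    · exact hS t ht ▸ Submodule.subset_span ⟨_, ⟨t, ht, rfl⟩, rfl⟩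
    · exact hS' t ht ▸ Submodule.zero_mem _
  · rw [Submodule.span_le]
    rintro _ ⟨_, ⟨t, ht, rfl⟩, rfl⟩
    exact ⟨v t, hS t ht⟩

theorem nonempty_span_quotient_span_equiv (hTS : T ⊆ S) :
    Nonempty ((Submodule.span k (v '' S) ⧸
      (Submodule.span k (v '' T)).submoduleOf (Submodule.span k (v '' S))) ≃ₗ[k]
        Submodule.span k (v '' (S \ T))) := by
  have hle : Submodule.span k (v '' (S \ T)) ≤ Submodule.span k (v '' S) :=
    Submodule.span_mono (Set.image_mono Set.sdiff_subset)
  have hdisjoint : Disjoint (Submodule.span k (v '' T)) (Submodule.span k (v '' (S \ T))) :=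
    v.linearIndependent.disjoint_span_image Set.disjoint_sdiff_right
  have hsup : Submodule.span k (v '' T) ⊔ Submodule.span k (v '' (S \ T)) =
      Submodule.span k (v '' S) := by
    rw [← Submodule.span_union, ← Set.image_union, Set.union_sdiff_cancel hTS]
  have hcompl : IsCompl ((Submodule.span k (v '' T)).submoduleOf (Submodule.span k (v '' S)))
      ((Submodule.span k (v '' (S \ T))).submoduleOf (Submodule.span k (v '' S))) := by
    constructor
    · rw [Submodule.disjoint_def] at hdisjoint ⊢
      exact fun a ha ha' => Subtype.ext (hdisjoint a ha ha')
    · rw [codisjoint_iff, eq_top_iff]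
      rintro ⟨a, ha⟩ -
      obtain ⟨b, hb, c, hc, rfl⟩ := Submodule.mem_sup.1 (hsup ▸ ha)
      exact Submodule.mem_sup.2 ⟨⟨b, hsup ▸ Submodule.mem_sup_left hb⟩, hb, ⟨c, hle hc⟩, hc, rfl⟩
  exact ⟨Submodule.quotientEquivOfIsCompl _ _ hcompl ≪≫ₗ Submodule.submoduleOfEquivOfLe hle⟩

end BasisToBasis

section Semilinear

variable {k : Type*} [CommSemiring k] {S : Type*} [Semiring S] [Algebra k S] {ι M : Type*}
  [Fintype ι] [AddCommMonoid M] [Module k M] [Module S M] [IsScalarTower k S M]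

/-- The extension of prescribed values on a basis to a map that is semilinear with respect to an
endomorphism `σ` of the algebra `S`. -/
def semilinearExt (b : Module.Basis ι S M) (σ : S →ₐ[k] S) (v : ι → M) : M →ₗ[k] M where
  toFun z := ∑ i, σ (b.repr z i) • v i
  map_add' z w := by simp [add_smul, Finset.sum_add_distrib]
  map_smul' c z := by
    have hrepr : b.repr (c • z) = c • b.repr z := (b.repr.restrictScalars k).map_smul c z
    simp only [hrepr, Finsupp.smul_apply, map_smul, smul_assoc, Finset.smul_sum, RingHom.id_apply]

theorem semilinearExt_smul (b : Module.Basis ι S M) (σ : S →ₐ[k] S) (v : ι → M) (r : S) (z : M) :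
    semilinearExt b σ v (r • z) = σ r • semilinearExt b σ v z := by
  simp [semilinearExt, mul_smul, Finset.smul_sum]

theorem semilinearExt_basis (b : Module.Basis ι S M) (σ : S →ₐ[k] S) (v : ι → M) (i : ι) :
    semilinearExt b σ v (b i) = v i := by
  classical
  simp [semilinearExt, Finsupp.single_apply, apply_ite, ite_smul]

omit [Algebra k S] [Fintype ι] [IsScalarTower k S M] in
theorem eq_of_semilinear_of_basis {N : Type*} [AddCommMonoid N] [Module k N] [Module S N]
    (b : Module.Basis ι S M) {σ : S → S} {f f' : M →ₗ[k] N} (hf : ∀ r z, f (r • z) = σ r • f z)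
    (hf' : ∀ r z, f' (r • z) = σ r • f' z) (h : ∀ i, f (b i) = f' (b i)) : f = f' := by
  ext z
  induction b.mem_span z using Submodule.span_induction with
  | zero => rw [map_zero, map_zero]
  | mem _ hz => obtain ⟨i, rfl⟩ := hz; exact h i
  | add a c _ _ ha hc => rw [map_add, map_add, ha, hc]
  | smul r a _ ha => rw [hf, hf', ha]

end Semilinear

/-! ### Contractions and the Künneth theorem -/

section Contraction

variable {S M : Type*} [Ring S] [AddCommGroup M] [Module S M]
  {C : ℕ → Type*} [∀ i, AddCommGroup (C i)] [∀ i, Module S (C i)]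

/-- A contracting homotopy of the augmented complex `⋯ → C 1 → C 0 → M → 0`, in which
`unit : M → C 0` plays the role of the homotopy in degree `-1`. -/
structure Contraction (d : ∀ i, C (i + 1) →ₗ[S] C i) (ε : C 0 →ₗ[S] M) where
  s : ∀ i, C i →ₗ[S] C (i + 1)
  unit : M →ₗ[S] C 0
  d_comp_d : ∀ i, d i ∘ₗ d (i + 1) = 0
  aug_comp_d : ε ∘ₗ d 0 = 0
  aug_comp_unit : ε ∘ₗ unit = LinearMap.id
  d_comp_s_zero : d 0 ∘ₗ s 0 + unit ∘ₗ ε = LinearMap.id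
  d_comp_s_succ : ∀ i, d (i + 1) ∘ₗ s (i + 1) + s i ∘ₗ d i = LinearMap.id

variable {d : ∀ i, C (i + 1) →ₗ[S] C i} {ε : C 0 →ₗ[S] M}

theorem Contraction.isFreeResolution [∀ i, Module.Free S (C i)] (c : Contraction d ε) :
    IsFreeResolution S C d ε where
  free := inferInstance
  exact_succ i := by
    refine Function.Exact.of_comp_of_mem_range
      (funext fun z => LinearMap.congr_fun (c.d_comp_d i) z) fun z hz => ⟨c.s (i + 1) z, ?_⟩
    simpa [hz] using LinearMap.congr_fun (c.d_comp_s_succ i) z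
  exact_zero := by
    refine Function.Exact.of_comp_of_mem_range
      (funext fun z => LinearMap.congr_fun c.aug_comp_d z) fun z hz => ⟨c.s 0 z, ?_⟩
    simpa [hz] using LinearMap.congr_fun c.d_comp_s_zero z
  surjective m := ⟨c.unit m, LinearMap.congr_fun c.aug_comp_unit m⟩

theorem exists_comp_eq_of_range_le {P N N' : Type*} [AddCommGroup P] [Module S P]
    [Module.Projective S P] [AddCommGroup N] [Module S N] [AddCommGroup N'] [Module S N']
    (f : N →ₗ[S] N') (h : P →ₗ[S] N') (hle : LinearMap.range h ≤ LinearMap.range f) :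
    ∃ g : P →ₗ[S] N, f ∘ₗ g = h := by
  obtain ⟨g, hg⟩ := Module.projective_lifting_property f.rangeRestrict
    (h.codRestrict (LinearMap.range f) fun z => hle ⟨z, rfl⟩) f.surjective_rangeRestrict
  exact ⟨g, LinearMap.ext fun z => congrArg Subtype.val (LinearMap.congr_fun hg z)⟩

theorem IsFreeResolution.nonempty_contraction [Module.Projective S M]
    (h : IsFreeResolution S C d ε) : Nonempty (Contraction d ε) := by
  have := h.free
  obtain ⟨unit, h_unit⟩ := ε.exists_rightInverse_of_surjective
    (LinearMap.range_eq_top.2 h.surjective)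
  obtain ⟨s₀, hs₀⟩ := exists_comp_eq_of_range_le (d 0) (LinearMap.id - unit ∘ₗ ε) <| by
    rintro _ ⟨z, rfl⟩
    refine (h.exact_zero _).1 ?_
    simpa [sub_eq_zero] using (LinearMap.congr_fun h_unit (ε z)).symm
  have next (i : ℕ) (s : {s : C i →ₗ[S] C (i + 1) // d i ∘ₗ s ∘ₗ d i = d i}) :
      ∃ s' : {s' : C (i + 1) →ₗ[S] C (i + 2) // d (i + 1) ∘ₗ s' ∘ₗ d (i + 1) = d (i + 1)},
        d (i + 1) ∘ₗ s'.1 = LinearMap.id - s.1 ∘ₗ d i := by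
    obtain ⟨s', hs'⟩ := exists_comp_eq_of_range_le (d (i + 1)) (LinearMap.id - s.1 ∘ₗ d i) <| by
      rintro _ ⟨z, rfl⟩
      refine (h.exact_succ i _).1 ?_
      simpa [sub_eq_zero] using (LinearMap.congr_fun s.2 z).symm
    refine ⟨⟨s', ?_⟩, hs'⟩
    rw [← LinearMap.comp_assoc, hs', LinearMap.sub_comp, LinearMap.comp_assoc,
      (h.exact_succ i).linearMap_comp_eq_zero, LinearMap.comp_zero, sub_zero, LinearMap.id_comp]
  choose next h_next using next
  let s (i : ℕ) : {s : C i →ₗ[S] C (i + 1) // d i ∘ₗ s ∘ₗ d i = d i} :=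
    Nat.rec ⟨s₀, by
      rw [← LinearMap.comp_assoc, hs₀, LinearMap.sub_comp, LinearMap.comp_assoc,
        h.exact_zero.linearMap_comp_eq_zero, LinearMap.comp_zero, sub_zero,
        LinearMap.id_comp]⟩ (fun i => next i) i
  exact ⟨{
    s := fun i => (s i).1
    unit := unit
    d_comp_d := fun i => (h.exact_succ i).linearMap_comp_eq_zero
    aug_comp_d := h.exact_zero.linearMap_comp_eq_zero
    aug_comp_unit := h_unit
    d_comp_s_zero := eq_sub_iff_add_eq.1 hs₀
    d_comp_s_succ := fun i => eq_sub_iff_add_eq.1 (h_next i (s i)) }⟩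

end Contraction

section Kunneth

variable {k : Type*} [Field k] {C D : ℕ → Type*} [∀ i, AddCommGroup (C i)] [∀ i, Module k (C i)]
  [∀ j, AddCommGroup (D j)] [∀ j, Module k (D j)]
  {dC : ∀ i, C (i + 1) →ₗ[k] C i} {dD : ∀ j, D (j + 1) →ₗ[k] D j}
  {εC : C 0 →ₗ[k] k} {εD : D 0 →ₗ[k] k}

theorem totD_apply (n : ℕ) (z : Tot k C D (n + 1)) (i j : ℕ) (h : i + j = n) :
    totD k dC dD n z ⟨(i, j), h⟩ =
      (dC i).rTensor (D j) (z ⟨(i + 1, j), by dsimp only; omega⟩) +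
      (-1 : k) ^ i • (dD j).lTensor (C i) (z ⟨(i, j + 1), by dsimp only; omega⟩) := rfl

theorem totD_comp_totD (hC : ∀ i, dC i ∘ₗ dC (i + 1) = 0) (hD : ∀ j, dD j ∘ₗ dD (j + 1) = 0)
    (n : ℕ) : totD k dC dD n ∘ₗ totD k dC dD (n + 1) = 0 := by
  refine LinearMap.ext fun z => funext fun ⟨⟨i, j⟩, h⟩ => ?_
  rw [LinearMap.comp_apply, totD_apply, totD_apply, totD_apply]
  simp only [map_add, map_smul, pow_succ, mul_neg, mul_one, neg_smul, map_neg,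
    ← LinearMap.comp_apply, ← LinearMap.rTensor_comp, ← LinearMap.lTensor_comp, hC, hD,
    LinearMap.rTensor_comp_lTensor, LinearMap.lTensor_comp_rTensor, LinearMap.rTensor_zero,
    LinearMap.lTensor_zero, LinearMap.zero_apply, smul_zero, add_zero, zero_add, neg_add_cancel,
    Pi.zero_apply]

theorem totAug_comp_totD (hC : εC ∘ₗ dC 0 = 0) (hD : εD ∘ₗ dD 0 = 0) :
    totAug k εC εD ∘ₗ totD k dC dD 0 = 0 := by
  ext z
  change LinearMap.mul' k k (TensorProduct.map εC εD (totD k dC dD 0 z ⟨(0, 0), rfl⟩)) = 0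
  rw [totD_apply, pow_zero, one_smul, map_add, ← LinearMap.comp_apply, ← LinearMap.comp_apply,
    LinearMap.map_comp_rTensor, LinearMap.map_comp_lTensor, hC, hD, TensorProduct.map_zero_left,
    TensorProduct.map_zero_right, LinearMap.zero_apply, LinearMap.zero_apply, add_zero, map_zero]

namespace Contraction

/-- The contracting homotopy `c ⊗ d ↦ s c ⊗ d + η (ε c) ⊗ t d` of the tensor product of two
complexes with contractions `s` and `t`, where `η` is the unit of `s` and `ε` vanishes in positive
degrees. -/
def totS (s : Contraction dC εC) (t : Contraction dD εD) (n : ℕ) :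
    Tot k C D n →ₗ[k] Tot k C D (n + 1) :=
  LinearMap.pi fun
    | ⟨(0, 0), h⟩ => absurd h n.succ_ne_zero.symm
    | ⟨(0, j + 1), h⟩ => TensorProduct.map (s.unit ∘ₗ εC) (t.s j) ∘ₗ
        LinearMap.proj (R := k) (φ := fun ab : Pairs n => C ab.1.1 ⊗[k] D ab.1.2)
          ⟨(0, j), by dsimp only at h ⊢; omega⟩
    | ⟨(i + 1, j), h⟩ => (s.s i).rTensor (D j) ∘ₗ
        LinearMap.proj (R := k) (φ := fun ab : Pairs n => C ab.1.1 ⊗[k] D ab.1.2)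
          ⟨(i, j), by dsimp only at h ⊢; omega⟩

variable (s : Contraction dC εC) (t : Contraction dD εD)

theorem totS_apply_succ (n : ℕ) (z : Tot k C D n) (i j : ℕ) (h : i + 1 + j = n + 1) :
    totS s t n z ⟨(i + 1, j), h⟩ = (s.s i).rTensor (D j) (z ⟨(i, j), by dsimp only; omega⟩) :=
  rfl

theorem totS_apply_zero_succ (n : ℕ) (z : Tot k C D n) (j : ℕ) (h : 0 + (j + 1) = n + 1) :
    totS s t n z ⟨(0, j + 1), h⟩ =
      TensorProduct.map (s.unit ∘ₗ εC) (t.s j) (z ⟨(0, j), by dsimp only; omega⟩) := rfl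

theorem map_unit_aug_comp_totD (n j : ℕ) {W : Type*} [AddCommGroup W] [Module k W]
    (f : D j →ₗ[k] W) (z : Tot k C D (n + 1)) (h : 0 + j = n) :
    TensorProduct.map (s.unit ∘ₗ εC) f (totD k dC dD n z ⟨(0, j), h⟩) =
      TensorProduct.map (s.unit ∘ₗ εC) (f ∘ₗ dD j)
        (z ⟨(0, j + 1), by dsimp only; omega⟩) := by
  rw [totD_apply, pow_zero, one_smul, map_add, ← LinearMap.comp_apply, ← LinearMap.comp_apply,
    LinearMap.map_comp_rTensor, LinearMap.map_comp_lTensor, LinearMap.comp_assoc, s.aug_comp_d,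
    LinearMap.comp_zero, TensorProduct.map_zero_left, LinearMap.zero_apply, zero_add]

theorem totD_totS_apply_zero (n j : ℕ) (z : Tot k C D n) (h : 0 + j = n) :
    totD k dC dD n (totS s t n z) ⟨(0, j), h⟩ =
      (dC 0 ∘ₗ s.s 0).rTensor (D j) (z ⟨(0, j), h⟩) +
        TensorProduct.map (s.unit ∘ₗ εC) (dD j ∘ₗ t.s j) (z ⟨(0, j), h⟩) := by
  rw [totD_apply, totS_apply_succ, totS_apply_zero_succ, pow_zero, one_smul,
    ← LinearMap.comp_apply, ← LinearMap.comp_apply, ← LinearMap.rTensor_comp,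
    LinearMap.lTensor_comp_map]

theorem totD_comp_totS_succ (n : ℕ) :
    totD k dC dD (n + 1) ∘ₗ totS s t (n + 1) + totS s t n ∘ₗ totD k dC dD n = LinearMap.id := by
  refine LinearMap.ext fun z => funext fun ⟨⟨i, j⟩, h⟩ => ?_
  rw [LinearMap.add_apply, LinearMap.comp_apply, LinearMap.comp_apply, Pi.add_apply,
    LinearMap.id_apply]
  rcases i with _ | i
  · obtain ⟨j, rfl⟩ : ∃ j', j = j' + 1 := ⟨j - 1, by dsimp only at h; omega⟩
    rw [totD_totS_apply_zero, totS_apply_zero_succ, map_unit_aug_comp_totD, add_assoc,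
      ← LinearMap.add_apply, ← TensorProduct.map_add_right, t.d_comp_s_succ, ← LinearMap.rTensor,
      ← LinearMap.add_apply, ← LinearMap.rTensor_add, s.d_comp_s_zero, LinearMap.rTensor_id,
      LinearMap.id_apply]
  · have hs : (dC (i + 1) ∘ₗ s.s (i + 1)).rTensor (D j) (z ⟨(i + 1, j), h⟩) +
        (s.s i ∘ₗ dC i).rTensor (D j) (z ⟨(i + 1, j), h⟩) = z ⟨(i + 1, j), h⟩ := by
      rw [← LinearMap.add_apply, ← LinearMap.rTensor_add, s.d_comp_s_succ, LinearMap.rTensor_id,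
        LinearMap.id_apply]
    rw [totD_apply, totS_apply_succ, totS_apply_succ, totS_apply_succ, totD_apply]
    simp only [map_add, map_smul, pow_succ, mul_neg, mul_one, neg_smul, ← LinearMap.comp_apply,
      ← LinearMap.rTensor_comp, LinearMap.rTensor_comp_lTensor, LinearMap.lTensor_comp_rTensor]
    rw [add_add_add_comm, hs, neg_add_cancel, add_zero]

theorem unit_tmul_unit_mul_aug (w : C 0 ⊗[k] D 0) :
    s.unit 1 ⊗ₜ t.unit (LinearMap.mul' k k (TensorProduct.map εC εD w)) =
      TensorProduct.map (s.unit ∘ₗ εC) (t.unit ∘ₗ εD) w := by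
  induction w with
  | zero => simp
  | tmul a b =>
    have ha : s.unit (εC a) = εC a • s.unit 1 := by rw [← map_smul, smul_eq_mul, mul_one]
    have hb : t.unit (εC a * εD b) = εC a • t.unit (εD b) := by rw [← map_smul, smul_eq_mul]
    simp only [TensorProduct.map_tmul, LinearMap.mul'_apply, LinearMap.comp_apply, ha, hb,
      TensorProduct.tmul_smul, TensorProduct.smul_tmul']
  | add v w hv hw => simp only [map_add, TensorProduct.tmul_add, hv, hw]

/-- The tensor product of two contractions onto the ground field. -/
def tot : Contraction (totD k dC dD) (totAug k εC εD) where
  s := totS s t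
  unit := LinearMap.pi fun
    | ⟨(0, 0), _⟩ => TensorProduct.mk k (C 0) (D 0) (s.unit 1) ∘ₗ t.unit
    | _ => 0
  d_comp_d := totD_comp_totD s.d_comp_d t.d_comp_d
  aug_comp_d := totAug_comp_totD s.aug_comp_d t.aug_comp_d
  aug_comp_unit := by
    ext
    change εC (s.unit 1) * εD (t.unit 1) = 1
    simpa using congrArg₂ (· * ·) (LinearMap.congr_fun s.aug_comp_unit 1)
      (LinearMap.congr_fun t.aug_comp_unit 1)
  d_comp_s_zero := by
    refine LinearMap.ext fun z => funext fun ⟨⟨i, j⟩, h⟩ => ?_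
    obtain ⟨rfl, rfl⟩ := Nat.add_eq_zero_iff.1 h
    change totD k dC dD 0 (totS s t 0 z) ⟨(0, 0), h⟩ +
      s.unit 1 ⊗ₜ t.unit (LinearMap.mul' k k (TensorProduct.map εC εD (z ⟨(0, 0), h⟩))) =
        z ⟨(0, 0), h⟩
    rw [totD_totS_apply_zero, unit_tmul_unit_mul_aug, add_assoc, ← LinearMap.add_apply,
      ← TensorProduct.map_add_right, t.d_comp_s_zero, ← LinearMap.rTensor,
      ← LinearMap.add_apply, ← LinearMap.rTensor_add, s.d_comp_s_zero, LinearMap.rTensor_id,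
      LinearMap.id_apply]
  d_comp_s_succ := totD_comp_totS_succ s t

end Contraction

theorem IsFreeResolution.tot (hC : IsFreeResolution k C dC εC) (hD : IsFreeResolution k D dD εD) :
    IsFreeResolution k (Tot k C D) (totD k dC dD) (totAug k εC εD) := by
  obtain ⟨s⟩ := hC.nonempty_contraction
  obtain ⟨t⟩ := hD.nonempty_contraction
  exact (s.tot t).isFreeResolution

end Kunneth

/-! ### Ext from a free resolution -/

section ExtOfFreeResolution

open CategoryTheory

theorem nonempty_homology_equiv {k : Type u} [Ring k] (X : ShortComplex (ModuleCat.{u} k))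
    {V : Type*} [AddCommGroup V] [Module k V] (e : X.X₂ ≃ₗ[k] V) {Z B : Submodule k V}
    (hZ : ∀ v, X.g v = 0 ↔ e v ∈ Z) (hB : ∀ v, (∃ w, X.f w = v) ↔ e v ∈ B) :
    Nonempty (X.homology ≃ₗ[k] Z ⧸ B.submoduleOf Z) := by
  have hker : (LinearMap.ker X.g.hom).map e.toLinearMap = Z := by
    ext v
    rw [Submodule.mem_map_equiv, LinearMap.mem_ker]
    simpa using hZ (e.symm v)
  let cycles : LinearMap.ker X.g.hom ≃ₗ[k] Z := e.ofSubmodules _ _ hker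
  refine ⟨X.moduleCatHomologyIso.toLinearEquiv ≪≫ₗ Submodule.Quotient.equiv _ _ cycles ?_⟩
  ext v
  have hv : e (cycles.symm v) = v := congrArg Subtype.val (cycles.apply_symm_apply v)
  rw [Submodule.mem_map_equiv, Submodule.submoduleOf, Submodule.mem_comap, Submodule.subtype_apply,
    ← hv, ← hB]
  exact exists_congr fun _ => Subtype.ext_iff

namespace IsFreeResolution

section Complex

variable {S : Type u} [Ring S] {M : Type u} [AddCommGroup M] [Module S M] {Y : ℕ → Type u}
  [∀ n, AddCommGroup (Y n)] [∀ n, Module S (Y n)] {d : ∀ n, Y (n + 1) →ₗ[S] Y n} {ε : Y 0 →ₗ[S] M}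
  (h : IsFreeResolution S Y d ε)

/-- The chain complex of a free resolution. -/
def chainComplex : ChainComplex (ModuleCat.{u} S) ℕ :=
  ChainComplex.of (fun n => ModuleCat.of S (Y n)) (fun n => ModuleCat.ofHom (d n)) fun n => by
    rw [← ModuleCat.ofHom_comp, (h.exact_succ n).linearMap_comp_eq_zero]
    rfl

theorem chainComplex_d (n : ℕ) : h.chainComplex.d (n + 1) n = ModuleCat.ofHom (d n) :=
  ChainComplex.of_d (fun n => ModuleCat.of S (Y n)) (fun n => ModuleCat.ofHom (d n)) n

theorem chainComplex_d_apply (n : ℕ) (v : Y (n + 1)) : h.chainComplex.d (n + 1) n v = d n v :=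
  congrArg (fun f => f.hom v) (h.chainComplex_d n)

/-- The augmentation of a free resolution as a map of chain complexes. -/
def π : h.chainComplex ⟶ (ChainComplex.single₀ (ModuleCat.{u} S)).obj (ModuleCat.of S M) :=
  (h.chainComplex.toSingle₀Equiv _).symm ⟨ModuleCat.ofHom ε, by
    ext v
    exact (congrArg ε (h.chainComplex_d_apply 0 v)).trans (h.exact_zero.apply_apply_eq_zero v)⟩

theorem π_f_zero_apply (v : Y 0) : h.π.f 0 v = ε v :=
  congrArg (fun f : h.chainComplex.X 0 ⟶ ModuleCat.of S M => f.hom v)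
    (ChainComplex.toSingle₀Equiv_symm_apply_f_zero _ _)

theorem quasiIsoAt_zero_π : QuasiIsoAt h.π 0 := by
  rw [ChainComplex.quasiIsoAt₀_iff, ShortComplex.quasiIso_iff_of_zeros' _
    (h.chainComplex.shape _ _ (by simp)) rfl rfl, ShortComplex.moduleCat_exact_iff,
    ModuleCat.epi_iff_surjective]
  constructor
  · intro (v : Y 0) hv
    obtain ⟨w, hw⟩ := (h.exact_zero v).1 ((h.π_f_zero_apply v).symm.trans hv)
    exact ⟨w, (h.chainComplex_d_apply 0 w).trans hw⟩
  · intro m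
    obtain ⟨v, hv⟩ := h.surjective m
    exact ⟨v, (h.π_f_zero_apply v).trans hv⟩

theorem exactAt_succ_chainComplex (n : ℕ) : h.chainComplex.ExactAt (n + 1) := by
  rw [HomologicalComplex.exactAt_iff' _ (n + 2) (n + 1) n (by simp) (by simp),
    ShortComplex.moduleCat_exact_iff]
  intro (v : Y (n + 1)) hv
  obtain ⟨w, hw⟩ := (h.exact_succ n v).1 ((h.chainComplex_d_apply n v).symm.trans hv)
  exact ⟨w, (h.chainComplex_d_apply (n + 1) w).trans hw⟩

theorem quasiIso_π : QuasiIso h.π where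
  quasiIsoAt
    | 0 => h.quasiIsoAt_zero_π
    | n + 1 => (quasiIsoAt_iff_exactAt' _ _ (ChainComplex.exactAt_succ_single_obj ..)).2
        (h.exactAt_succ_chainComplex n)

/-- A free resolution as a projective resolution. -/
def projectiveResolution : ProjectiveResolution (ModuleCat.of S M) where
  complex := h.chainComplex
  projective n :=
    have := h.free n
    ModuleCat.projective_of_free (Module.Free.chooseBasis S (Y n))
  π := h.π
  quasiIso := h.quasiIso_π

end Complex

section Ext

variable {k : Type u} [Field k] {S : Type u} [Ring S] [Algebra k S] {M : Type u}
  [AddCommGroup M] [Module S M] {T : Type u} [AddCommGroup T] [Module S T] [Module k T]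
  [SMulCommClass S k T] [IsScalarTower k S T] {Y : ℕ → Type u} [∀ n, AddCommGroup (Y n)]
  [∀ n, Module S (Y n)] {d : ∀ n, Y (n + 1) →ₗ[S] Y n} {ε : Y 0 →ₗ[S] M}
  (h : IsFreeResolution S Y d ε)

/-- The cochains of `Hom(Y, T)` as linear maps. -/
def homEquiv (n : ℕ) :
    (h.chainComplex.linearYonedaObj k (ModuleCat.of S T)).X n ≃ₗ[k] (Y n →ₗ[S] T) where
  toFun f := ModuleCat.Hom.hom (A := ModuleCat.of S (Y n)) (B := ModuleCat.of S T) f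
  invFun f := ModuleCat.ofHom f
  left_inv _ := rfl
  right_inv _ := rfl
  map_add' _ _ := rfl
  map_smul' c f := by
    ext v
    exact algebraMap_smul S c (ModuleCat.Hom.hom (A := ModuleCat.of S (Y n))
      (B := ModuleCat.of S T) f v)

theorem homEquiv_d (n : ℕ) (f : (h.chainComplex.linearYonedaObj k (ModuleCat.of S T)).X n) :
    h.homEquiv (n + 1) ((h.chainComplex.linearYonedaObj k (ModuleCat.of S T)).d n (n + 1) f) =
      coboundary k T (d n) (h.homEquiv n f) :=
  congrArg (fun g : ModuleCat.of S (Y (n + 1)) ⟶ ModuleCat.of S (Y n) =>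
    ModuleCat.Hom.hom (A := ModuleCat.of S (Y (n + 1)))
      (B := ModuleCat.of S T) (g ≫ (f : ModuleCat.of S (Y n) ⟶ ModuleCat.of S T)))
    (h.chainComplex_d n)

theorem d_eq_zero_iff (n : ℕ) (f : (h.chainComplex.linearYonedaObj k (ModuleCat.of S T)).X n) :
    (h.chainComplex.linearYonedaObj k (ModuleCat.of S T)).d n (n + 1) f = 0 ↔
      h.homEquiv n f ∈ LinearMap.ker (coboundary k T (d n)) := by
  rw [LinearMap.mem_ker, ← h.homEquiv_d n, LinearEquiv.map_eq_zero_iff]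

theorem exists_d_eq_iff (n : ℕ)
    (f : (h.chainComplex.linearYonedaObj k (ModuleCat.of S T)).X (n + 1)) :
    (∃ f', (h.chainComplex.linearYonedaObj k (ModuleCat.of S T)).d n (n + 1) f' = f) ↔
      h.homEquiv (n + 1) f ∈ LinearMap.range (coboundary k T (d n)) := by
  constructor
  · rintro ⟨w, rfl⟩
    exact ⟨h.homEquiv n w, (h.homEquiv_d n w).symm⟩
  · rintro ⟨w, hw⟩
    refine ⟨(h.homEquiv n).symm w, (h.homEquiv (n + 1)).injective ?_⟩
    rw [← hw, h.homEquiv_d, LinearEquiv.apply_symm_apply]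

theorem nonempty_ext_zero_equiv (h : IsFreeResolution S Y d ε) :
    Nonempty (((Ext k (ModuleCat.{u} S) 0).obj (Opposite.op (ModuleCat.of S M))).obj
      (ModuleCat.of S T) ≃ₗ[k] LinearMap.ker (coboundary k T (d 0))) := by
  let C := h.chainComplex.linearYonedaObj k (ModuleCat.of S T)
  have hbot (f : C.X 0) : (∃ f', C.d 0 0 f' = f) ↔ h.homEquiv 0 f ∈ (⊥ : Submodule k _) := by
    rw [Submodule.mem_bot, LinearEquiv.map_eq_zero_iff, C.shape 0 0 (by simp)]
    exact ⟨fun ⟨_, hf⟩ => hf.symm, fun hf => ⟨0, hf.symm⟩⟩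
  obtain ⟨e⟩ := nonempty_homology_equiv (C.sc' 0 0 1) (h.homEquiv 0) (h.d_eq_zero_iff 0) hbot
  exact ⟨(h.projectiveResolution.isoExt 0 (ModuleCat.of S T)).toLinearEquiv ≪≫ₗ
    (ShortComplex.homologyMapIso (C.isoSc' 0 0 1 (by simp) (by simp))).toLinearEquiv ≪≫ₗ e ≪≫ₗ
      Submodule.quotEquivOfEqBot _ (by simp [Submodule.submoduleOf])⟩

theorem nonempty_ext_succ_equiv (h : IsFreeResolution S Y d ε) (n : ℕ) :
    Nonempty (((Ext k (ModuleCat.{u} S) (n + 1)).obj (Opposite.op (ModuleCat.of S M))).obj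
      (ModuleCat.of S T) ≃ₗ[k] LinearMap.ker (coboundary k T (d (n + 1))) ⧸
        (LinearMap.range (coboundary k T (d n))).submoduleOf
          (LinearMap.ker (coboundary k T (d (n + 1))))) := by
  let C := h.chainComplex.linearYonedaObj k (ModuleCat.of S T)
  obtain ⟨e⟩ := nonempty_homology_equiv (C.sc' n (n + 1) (n + 2)) (h.homEquiv (n + 1))
    (h.d_eq_zero_iff (n + 1)) (h.exists_d_eq_iff n)
  exact ⟨(h.projectiveResolution.isoExt (n + 1) (ModuleCat.of S T)).toLinearEquiv ≪≫ₗ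
    (ShortComplex.homologyMapIso (C.isoSc' n (n + 1) (n + 2) (by simp) (by simp))).toLinearEquiv
      ≪≫ₗ e⟩

end Ext

end IsFreeResolution
end ExtOfFreeResolution

/-! ### The algebra `R` -/

section JordanRel

variable {k E : Type*} [CommRing k] [Ring E] [Algebra k E] {h : k} {a b : E}

/-- The relation of the Jordan plane, rescaled by `h`; the generators `x` and `y` of `R` satisfy it
with `h = 1/2`. -/
def JordanRel (h : k) (a b : E) : Prop := b * a = a * b + h • a ^ 2

namespace JordanRel

theorem mul_pow (hab : JordanRel h a b) (n : ℕ) :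
    b * a ^ n = a ^ n * b + ((n : k) * h) • a ^ (n + 1) := by
  induction n with
  | zero => simp
  | succ n ih =>
    rw [pow_succ, ← mul_assoc, ih, add_mul, mul_assoc, hab, mul_add, mul_smul_comm, ← pow_add,
      smul_mul_assoc, ← pow_succ, ← mul_assoc, ← pow_succ, add_assoc, ← add_smul]
    congr 2
    push_cast
    ring

theorem mulLeft_sub_mulRight_pow_apply (hab : JordanRel h a b) (c : k) (l t : ℕ) :
    ((LinearMap.mulLeft k (b + c • a) - LinearMap.mulRight k b) ^ t) (a ^ l) =
      (∏ s ∈ Finset.range t, (c + ((l + s : ℕ) : k) * h)) • a ^ (l + t) := by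
  induction t with
  | zero => simp
  | succ t ih =>
    rw [pow_succ', Module.End.mul_apply, ih, map_smul, Finset.prod_range_succ, mul_smul]
    simp only [LinearMap.sub_apply, LinearMap.mulLeft_apply, LinearMap.mulRight_apply, add_mul,
      hab.mul_pow, smul_mul_assoc, ← pow_succ', add_smul, ← add_assoc]
    congr 1
    abel

theorem add_smul_pow_mul_pow (hab : JordanRel h a b) (c : k) (m l : ℕ) :
    (b + c • a) ^ m * a ^ l = ∑ t ∈ Finset.range (m + 1),
      ((m.choose t : k) * ∏ s ∈ Finset.range t, (c + ((l + s : ℕ) : k) * h)) •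
        (a ^ (l + t) * b ^ (m - t)) := by
  have hc : Commute (LinearMap.mulLeft k (b + c • a) - LinearMap.mulRight k b)
      (LinearMap.mulRight k b) :=
    (LinearMap.commute_mulLeft_right _ _).sub_left (Commute.refl _)
  have hexp := congrArg (fun f : Module.End k E => f (a ^ l)) (hc.add_pow m)
  simp only [sub_add_cancel, LinearMap.pow_mulLeft, LinearMap.mulLeft_apply] at hexp
  rw [hexp, LinearMap.sum_apply]
  refine Finset.sum_congr rfl fun t _ => ?_
  rw [(hc.pow_pow _ _).eq, Module.End.mul_apply, Module.End.natCast_apply, map_nsmul,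
    Module.End.mul_apply, hab.mulLeft_sub_mulRight_pow_apply, map_smul, LinearMap.pow_mulRight,
    LinearMap.mulRight_apply, ← Nat.cast_smul_eq_nsmul k, smul_smul]

theorem pow_mul_pow (hab : JordanRel h a b) (m l : ℕ) :
    b ^ m * a ^ l = ∑ t ∈ Finset.range (m + 1),
      ((m.choose t : k) * h ^ t * (l.ascFactorial t : k)) • (a ^ (l + t) * b ^ (m - t)) := by
  have hexp := hab.add_smul_pow_mul_pow 0 m l
  rw [zero_smul, add_zero] at hexp
  simp only [hexp, zero_add, Finset.prod_mul_distrib, Finset.prod_const, Finset.card_range,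
    Nat.ascFactorial_eq_prod_range, Nat.cast_prod, mul_assoc, mul_comm, mul_left_comm]

theorem add_smul_mul_add_smul (hab : JordanRel h a b) (c d : k) :
    (b + c • a) * (b + d • a) = (b + (d - h) • a) * (b + (c + h) • a) := by
  have hba : b * a = a * b + h • (a * a) := by rw [hab, pow_two]
  simp only [add_mul, mul_add, smul_mul_assoc, mul_smul_comm, hba]
  module

theorem add_smul_mul_add_smul_pow (hab : JordanRel h a b) (c d : k) (m : ℕ) :
    (b + c • a) * (b + d • a) ^ m = (b + (d - h) • a) ^ m * (b + (c + m * h) • a) := by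
  induction m with
  | zero => simp
  | succ m ih =>
    rw [pow_succ, ← mul_assoc, ih, mul_assoc, hab.add_smul_mul_add_smul, ← mul_assoc, ← pow_succ,
      Nat.cast_succ, add_mul, one_mul, add_assoc]

theorem add_smul_pow_mul (hab : JordanRel h a b) (c : k) (m : ℕ) :
    (b + c • a) ^ m * a = a * (b + (c + h) • a) ^ m := by
  have hmul : SemiconjBy a (b + (c + h) • a) (b + c • a) := by
    have hba : b * a = a * b + h • (a * a) := by rw [hab, pow_two]
    simp only [SemiconjBy, add_mul, mul_add, smul_mul_assoc, mul_smul_comm, hba]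
    module
  exact (hmul.pow_right m).eq.symm

variable {p : ℕ} [CharP k p]

theorem add_smul_mul_add_smul_pow_sub_two (hp : 2 ≤ p) (hab : JordanRel h a b) (c : k) :
    (b + (c + h) • a) * (b + c • a) ^ (p - 2) = (b + (c - h) • a) ^ (p - 1) := by
  rw [hab.add_smul_mul_add_smul_pow, show p - 1 = p - 2 + 1 by omega, pow_succ, Nat.cast_sub hp,
    CharP.cast_eq_zero]
  congr 4
  push_cast
  ring

theorem smul_mul_add_smul_pow_sub_two (hp : 2 ≤ p) (hab : JordanRel h a b) (c : k) :
    h • (a * (b + c • a) ^ (p - 2)) = (b + (c - h) • a) ^ (p - 1) - (b + c • a) ^ (p - 1) := by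
  rw [← hab.add_smul_mul_add_smul_pow_sub_two hp, show p - 1 = p - 2 + 1 by omega, pow_succ',
    ← sub_mul, add_smul, ← add_assoc, add_sub_cancel_left, smul_mul_assoc]

theorem add_smul_pow_sub_two_mul_add_smul (hp : 2 ≤ p) (hab : JordanRel h a b) (c d : k) :
    (b + c • a) ^ (p - 2) * (b + d • a) =
      (b + (d + 2 * h) • a) * (b + (c + h) • a) ^ (p - 2) := by
  rw [hab.add_smul_mul_add_smul_pow, Nat.cast_sub hp, CharP.cast_eq_zero, add_sub_cancel_right]
  congr 3
  push_cast
  ring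

end JordanRel

end JordanRel

section PowerSums

variable {k : Type*} [CommRing k]

theorem exists_add_smul_pow_eq_sum {E : Type*} [Ring E] [Algebra k E] (a b : E) (m : ℕ) :
    ∃ e : ℕ → E, ∀ c : k, (b + c • a) ^ m = ∑ j ∈ Finset.range (m + 1), c ^ j • e j := by
  induction m with
  | zero => exact ⟨1, by simp⟩
  | succ m ih =>
    obtain ⟨e, he⟩ := ih
    refine ⟨fun j => (if j = m + 1 then 0 else b * e j) + if j = 0 then 0 else a * e (j - 1),
      fun c => ?_⟩
    simp only [smul_add, Finset.sum_add_distrib]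
    rw [pow_succ', he, add_mul, Finset.mul_sum, Finset.mul_sum, Finset.sum_range_succ _ (m + 1),
      Finset.sum_range_succ' (fun j => c ^ j • if j = 0 then 0 else a * e (j - 1))]
    simp only [if_true, smul_zero, add_zero, Nat.succ_ne_zero, if_false, Nat.add_sub_cancel]
    congr 1
    · refine Finset.sum_congr rfl fun j hj => ?_
      rw [if_neg (Finset.mem_range.1 hj).ne, mul_smul_comm]
    · refine Finset.sum_congr rfl fun j _ => ?_
      rw [smul_mul_smul_comm, pow_succ']

variable {p q : ℕ} [Fact p.Prime] [CharP k p]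

theorem sum_range_natCast_pow_eq_zero (hq : p ∣ q) {m : ℕ} (hm : m < p - 1) :
    ∑ s ∈ Finset.range q, (s : k) ^ m = 0 := by
  have hp : ∑ s ∈ Finset.range p, (s : k) ^ m = 0 := by
    have h := congrArg (ZMod.castHom dvd_rfl k)
      (FiniteField.sum_pow_lt_card_sub_one (ZMod p) m (by rwa [ZMod.card]))
    rw [map_sum, map_zero] at h
    rw [← h]
    refine Finset.sum_nbij' (fun s => (s : ZMod p)) ZMod.val (by simp) ?_ ?_ (by simp) (by simp)
    · exact fun s _ => Finset.mem_range.2 (ZMod.val_lt s)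
    · exact fun s hs => ZMod.val_cast_of_lt (Finset.mem_range.1 hs)
  obtain ⟨n, rfl⟩ := hq
  induction n with
  | zero => simp
  | succ n ih =>
    rw [Nat.mul_succ, Finset.sum_range_add, ih, zero_add, ← hp]
    exact Finset.sum_congr rfl fun s _ => by simp

theorem sum_range_add_natCast_smul_pow_eq_zero {E : Type*} [Ring E] [Algebra k E] (hq : p ∣ q)
    {m : ℕ} (hm : m < p - 1) (a b : E) :
    ∑ s ∈ Finset.range q, (b + (s : k) • a) ^ m = 0 := by
  obtain ⟨e, he⟩ := exists_add_smul_pow_eq_sum (k := k) a b m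
  simp_rw [he]
  rw [Finset.sum_comm]
  refine Finset.sum_eq_zero fun j hj => ?_
  rw [Finset.mem_range] at hj
  rw [← Finset.sum_smul, sum_range_natCast_pow_eq_zero hq (by omega), zero_smul]

theorem cast_descFactorial_sub_two {p : ℕ} [CharP k p] {t : ℕ} (ht : t + 2 ≤ p) :
    ((p - 2).descFactorial t : k) = (-1) ^ t * (t + 1).factorial := by
  induction t with
  | zero => simp
  | succ t ih =>
    rw [Nat.descFactorial_succ, Nat.cast_mul, ih (by omega), Nat.factorial_succ (t + 1),
      Nat.sub_sub, Nat.cast_sub (by omega), CharP.cast_eq_zero]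
    push_cast
    ring

end PowerSums

variable (k : Type u) [Field k] (p : ℕ)

theorem jordanRel_x_y : JordanRel (2⁻¹ : k) (x k p) (y k p) := y_mul_x k p

section Sigma

variable [Fact p.Prime] [CharP k p]

theorem sigma_x (c : k) : sigma k p c (x k p) = x k p := lift_x ..

theorem sigma_y (c : k) : sigma k p c (y k p) = y k p + c • x k p := lift_y ..

theorem sigma_add_smul (c d : k) :
    sigma k p c (y k p + d • x k p) = y k p + (d + c) • x k p := by
  rw [map_add, map_smul, sigma_x, sigma_y, add_smul, add_right_comm, add_assoc]

end Sigma

section Alpha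

variable {p}

theorem two_ne_zero_of_lt [CharP k p] (hp : 2 < p) : (2 : k) ≠ 0 := fun h =>
  (Nat.le_of_dvd two_pos ((CharP.cast_eq_zero_iff k p 2).1 h)).not_gt hp

theorem y_add_half_pow_sub_two [CharP k p] (hp : 2 < p) :
    (y k p + (2⁻¹ : k) • x k p) ^ (p - 2) = ∑ t ∈ Finset.range (p - 1),
      ((-1 : k) ^ t * (t + 1).factorial / 2 ^ t) • (x k p ^ t * y k p ^ (p - 2 - t)) := by
  have h := (jordanRel_x_y k p).add_smul_pow_mul_pow 2⁻¹ (p - 2) 0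
  rw [pow_zero, mul_one, show p - 2 + 1 = p - 1 by omega] at h
  rw [h]
  refine Finset.sum_congr rfl fun t ht => ?_
  rw [Finset.mem_range] at ht
  have hprod : ∏ s ∈ Finset.range t, ((2⁻¹ : k) + ((0 + s : ℕ) : k) * 2⁻¹) =
      t.factorial / 2 ^ t := by
    rw [← Finset.prod_range_add_one_eq_factorial, div_eq_mul_inv, ← inv_pow,
      Finset.prod_congr rfl fun s _ => show _ = ((s + 1 : ℕ) : k) * 2⁻¹ by push_cast; ring,
      Finset.prod_mul_distrib, Finset.prod_const, Finset.card_range, Nat.cast_prod]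
  rw [hprod, zero_add, ← cast_descFactorial_sub_two (k := k) (p := p) (by omega),
    Nat.descFactorial_eq_factorial_mul_choose, Nat.cast_mul]
  congr 1
  ring

theorem two_smul_alpha [CharP k p] (hp : 2 < p) : (2 : k) • alpha k p =
    -((y k p + (2⁻¹ : k) • x k p) ^ (p - 2) + y k p ^ (p - 2)) := by
  have h2 := two_ne_zero_of_lt k hp
  have hIcc : Finset.Icc 1 (p - 2) = Finset.Ico 1 (p - 1) := by
    ext
    simp only [Finset.mem_Icc, Finset.mem_Ico]
    omega
  have hsum : ∀ t ∈ Finset.Ico 1 (p - 1), (2 : k) • ((-1 : k) ^ (t + 1) * (t + 1).factorial /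
      2 ^ (t + 1)) • (x k p ^ t * y k p ^ (p - 2 - t)) =
      -(((-1 : k) ^ t * (t + 1).factorial / 2 ^ t) • (x k p ^ t * y k p ^ (p - 2 - t))) :=
    fun t _ => by
      rw [smul_smul, ← neg_smul]
      congr 1
      field_simp
      ring
  rw [y_add_half_pow_sub_two k hp, alpha, hIcc, Finset.sum_range_eq_add_Ico _ (by omega), smul_add,
    Finset.smul_sum, Finset.sum_congr rfl hsum, Finset.sum_neg_distrib, two_smul]
  simp only [pow_zero, zero_add, Nat.factorial_one, Nat.cast_one, mul_one, div_one, one_smul,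
    one_mul, tsub_zero]
  abel

theorem y_sub_half_pow [CharP k p] (hp : 2 < p) : (y k p + (-2⁻¹ : k) • x k p) ^ (p - 1) =
    y k p ^ (p - 1) + (2⁻¹ : k) • (x k p * y k p ^ (p - 2)) := by
  have h := (jordanRel_x_y k p).smul_mul_add_smul_pow_sub_two hp.le 0
  rw [zero_smul, add_zero, zero_sub] at h
  rw [h, add_sub_cancel]

theorem x_mul_alpha [CharP k p] (hp : 2 < p) : x k p * alpha k p =
    (y k p + (2⁻¹ : k) • x k p) ^ (p - 1) - (y k p + (-2⁻¹ : k) • x k p) ^ (p - 1) := by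
  have h2 := two_ne_zero_of_lt k hp
  have hxy := jordanRel_x_y k p
  have h₁ := hxy.smul_mul_add_smul_pow_sub_two hp.le 2⁻¹
  have h₀ := hxy.smul_mul_add_smul_pow_sub_two hp.le 0
  rw [sub_self, zero_smul, add_zero] at h₁
  rw [zero_smul, add_zero, zero_sub] at h₀
  have hα : x k p * alpha k p = (2⁻¹ : k) • (x k p * (2 : k) • alpha k p) := by
    rw [mul_smul_comm, inv_smul_smul₀ h2]
  rw [hα, two_smul_alpha k hp, mul_neg, mul_add, smul_neg, smul_add, h₁, h₀]
  abel

theorem alpha_mul_x [CharP k p] (hp : 2 < p) : alpha k p * x k p =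
    (y k p + x k p) ^ (p - 1) - y k p ^ (p - 1) := by
  have h2 := two_ne_zero_of_lt k hp
  have hxy := jordanRel_x_y k p
  have hx₁ := hxy.add_smul_pow_mul 2⁻¹ (p - 2)
  have hx₀ := hxy.add_smul_pow_mul 0 (p - 2)
  have h₁ := hxy.smul_mul_add_smul_pow_sub_two hp.le 1
  have h₀ := hxy.smul_mul_add_smul_pow_sub_two hp.le 2⁻¹
  have hhalf : (2⁻¹ : k) + 2⁻¹ = 1 := by rw [← two_mul, mul_inv_cancel₀ h2]
  rw [← hhalf, add_sub_cancel_right, hhalf, one_smul] at h₁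
  rw [sub_self, zero_smul, add_zero] at h₀
  rw [hhalf, one_smul] at hx₁
  rw [zero_smul, add_zero, zero_add] at hx₀
  have hα : alpha k p * x k p = (2⁻¹ : k) • ((2 : k) • alpha k p * x k p) := by
    rw [smul_mul_assoc, inv_smul_smul₀ h2]
  rw [hα, two_smul_alpha k hp, neg_mul, add_mul, smul_neg, smul_add, hx₁, hx₀, h₁, h₀]
  abel

theorem y_add_x_mul_alpha [CharP k p] (hp : 2 < p) : (y k p + x k p) * alpha k p =
    -(y k p + (-2⁻¹ : k) • x k p) ^ (p - 1) := by
  have h2 := two_ne_zero_of_lt k hp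
  have hhalf : (2⁻¹ : k) + 2⁻¹ = 1 := by rw [← two_mul, mul_inv_cancel₀ h2]
  have h₁ := (jordanRel_x_y k p).add_smul_mul_add_smul_pow_sub_two hp.le 2⁻¹
  rw [hhalf, one_smul, sub_self, zero_smul, add_zero] at h₁
  have h₀ : (y k p + x k p) * y k p ^ (p - 2) =
      (2 : k) • (y k p + (-2⁻¹ : k) • x k p) ^ (p - 1) - y k p ^ (p - 1) := by
    rw [y_sub_half_pow k hp, smul_add, smul_inv_smul₀ h2, add_mul, ← pow_succ',
      show p - 2 + 1 = p - 1 by omega, two_smul]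
    abel
  refine smul_right_injective _ h2 ?_
  simp only
  rw [← mul_smul_comm, two_smul_alpha k hp, mul_neg, mul_add, h₁, h₀, smul_neg]
  abel

theorem alpha_mul_y_sub_half_x [CharP k p] (hp : 2 < p) :
    alpha k p * (y k p + (-2⁻¹ : k) • x k p) = -(y k p + x k p) ^ (p - 1) := by
  have h2 := two_ne_zero_of_lt k hp
  have hhalf : (2⁻¹ : k) + 2⁻¹ = 1 := by rw [← two_mul, mul_inv_cancel₀ h2]
  have hxy := jordanRel_x_y k p
  have hx₁ := hxy.smul_mul_add_smul_pow_sub_two hp.le 1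
  have h₁ := hxy.add_smul_pow_sub_two_mul_add_smul hp.le 2⁻¹ (-2⁻¹)
  have h₀ := hxy.add_smul_pow_sub_two_mul_add_smul hp.le 0 (-2⁻¹)
  have hneg : (-2⁻¹ : k) + 2 * 2⁻¹ = 2⁻¹ := by rw [two_mul, neg_add_cancel_left]
  rw [← hhalf, add_sub_cancel_right, hhalf, one_smul] at hx₁
  rw [hneg, hhalf, one_smul] at h₁
  rw [hneg, zero_add, zero_smul, add_zero, ← pow_succ', show p - 2 + 1 = p - 1 by omega] at h₀
  have hsplit : y k p + (2⁻¹ : k) • x k p = (y k p + x k p) - (2⁻¹ : k) • x k p := by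
    nth_rewrite 2 [← one_smul k (x k p)]
    rw [← hhalf]
    module
  nth_rewrite 2 [hsplit] at h₁
  rw [sub_mul, ← pow_succ', show p - 2 + 1 = p - 1 by omega, smul_mul_assoc, hx₁] at h₁
  refine smul_right_injective _ h2 ?_
  simp only
  rw [← smul_mul_assoc, two_smul_alpha k hp, neg_mul, add_mul, h₁, h₀, smul_neg, two_smul]
  abel

theorem sum_sigma_alpha [Fact p.Prime] [CharP k p] {q : ℕ} (hq : p ∣ q) (hp : 2 < p) :
    ∑ s ∈ Finset.range q, sigma k p (s : k) (alpha k p) = 0 := by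
  have h2 := two_ne_zero_of_lt k hp
  refine (smul_eq_zero_iff_right h2).1 ?_
  simp_rw [Finset.smul_sum, ← map_smul, two_smul_alpha k hp, map_neg, map_add, map_pow,
    sigma_add_smul, sigma_y, add_smul, ← add_assoc]
  rw [Finset.sum_neg_distrib, Finset.sum_add_distrib,
    sum_range_add_natCast_smul_pow_eq_zero hq (by omega),
    sum_range_add_natCast_smul_pow_eq_zero hq (by omega), add_zero, neg_zero]

end Alpha

/-! ### The periodic resolutions -/

section CyclicGroup

variable {k : Type*} [CommRing k] {Γ : Type*} [Group Γ]

theorem leftRegular_apply_eq_mulLeft (h : Γ) :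
    Representation.leftRegular k Γ h = LinearMap.mulLeft k (MonoidAlgebra.of k Γ h) := by
  ext
  simp

theorem norm_leftRegular_eq_mulLeft [Fintype Γ] : (Representation.leftRegular k Γ).norm =
    LinearMap.mulLeft k (∑ h : Γ, MonoidAlgebra.of k Γ h) := by
  rw [Representation.norm, Finset.sum_congr rfl fun h _ => leftRegular_apply_eq_mulLeft h]
  exact (map_sum (LinearMap.mul k (MonoidAlgebra k Γ)) _ _).symm

theorem range_mulLeft_of_sub_one [Finite Γ] {γ : Γ} (hγ : ∀ h, h ∈ Subgroup.zpowers γ) :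
    LinearMap.range (LinearMap.mulLeft k (MonoidAlgebra.of k Γ γ - 1)) =
      LinearMap.ker (Finsupp.linearCombination k (fun _ : Γ => (1 : k)) ∘ₗ
        (MonoidAlgebra.coeffLinearEquiv k).toLinearMap) := by
  rw [← Representation.FiniteCyclicGroup.coinvariantsKer_leftRegular_eq_ker,
    Representation.FiniteCyclicGroup.coinvariantsKer_eq_range _ γ hγ, leftRegular_apply_eq_mulLeft,
    ← LinearMap.mulLeft_one k (MonoidAlgebra k Γ)]
  exact congrArg LinearMap.range (map_sub (LinearMap.mul k (MonoidAlgebra k Γ)) _ _)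

theorem exact_mulLeft_of_sub_one_lift [Finite Γ] {γ : Γ} (hγ : ∀ h, h ∈ Subgroup.zpowers γ) :
    Function.Exact (LinearMap.mulLeft k (MonoidAlgebra.of k Γ γ - 1))
      (MonoidAlgebra.lift k k Γ 1).toLinearMap := by
  rw [LinearMap.exact_iff, range_mulLeft_of_sub_one hγ]
  congr 1

variable [Fintype Γ]

theorem exact_mulLeft_of_sub_one_sum {γ : Γ} (hγ : ∀ h, h ∈ Subgroup.zpowers γ) :
    Function.Exact (LinearMap.mulLeft k (MonoidAlgebra.of k Γ γ - 1))
      (LinearMap.mulLeft k (∑ h : Γ, MonoidAlgebra.of k Γ h)) := by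
  rw [LinearMap.exact_iff, range_mulLeft_of_sub_one hγ, ← norm_leftRegular_eq_mulLeft,
    Representation.ker_leftRegular_norm_eq]

theorem exact_mulLeft_sum_of_sub_one {γ : Γ} (hγ : ∀ h, h ∈ Subgroup.zpowers γ) :
    Function.Exact (LinearMap.mulLeft k (∑ h : Γ, MonoidAlgebra.of k Γ h))
      (LinearMap.mulLeft k (MonoidAlgebra.of k Γ γ - 1)) := by
  intro z
  refine ⟨fun hz => ⟨algebraMap k _ (z.coeff γ), ?_⟩, ?_⟩
  · have hfix : Representation.leftRegular k Γ γ z = z := by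
      rw [leftRegular_apply_eq_mulLeft]
      rwa [LinearMap.mulLeft_apply, sub_mul, one_mul, sub_eq_zero] at hz
    rw [LinearMap.mulLeft_apply, ← Algebra.commutes, ← Algebra.smul_def]
    ext h
    rw [Representation.coeff_of_leftRegular_of_generator γ hγ z hfix h]
    simp
  · rintro ⟨w, rfl⟩
    have hsum : MonoidAlgebra.of k Γ γ * ∑ h : Γ, MonoidAlgebra.of k Γ h =
        ∑ h : Γ, MonoidAlgebra.of k Γ h := by
      simp only [Finset.mul_sum, ← map_mul]
      exact Equiv.sum_comp (Equiv.mulLeft γ) fun h => MonoidAlgebra.of k Γ h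
    rw [LinearMap.mulLeft_apply, LinearMap.mulLeft_apply, ← mul_assoc, sub_mul, one_mul, hsum,
      sub_self, zero_mul]

omit [CommRing k] in
theorem sum_range_orderOf_pow {γ : Γ} (hγ : ∀ h, h ∈ Subgroup.zpowers γ) {M : Type*}
    [AddCommMonoid M] (f : Γ → M) :
    ∑ s ∈ Finset.range (orderOf γ), f (γ ^ s) = ∑ h : Γ, f h := by
  classical
  rw [← IsCyclic.image_range_orderOf hγ, Finset.sum_image]
  simpa using pow_injOn_Iio_orderOf (x := γ)

end CyclicGroup

section Group

variable (q : ℕ)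

theorem orderOf_g : orderOf (g q) = q := by
  rw [g, orderOf_ofAdd_eq_addOrderOf, ZMod.addOrderOf_one]

theorem mem_zpowers_g (h : G q) : h ∈ Subgroup.zpowers (g q) := by
  obtain ⟨n, hn⟩ := ZMod.intCast_surjective h.toAdd
  refine ⟨n, ?_⟩
  change g q ^ n = h
  rw [g, ← ofAdd_zsmul, zsmul_one, hn]
  rfl

variable (k : Type u) [Field k]

theorem isFreeResolution_PG [NeZero q] : IsFreeResolution k (PG k q) (dG k q) (augG k q) where
  free _ := .of_divisionRing k _
  exact_succ n := by
    have hsum := sum_range_orderOf_pow (mem_zpowers_g q) (MonoidAlgebra.of k (G q))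
    rw [orderOf_g] at hsum
    rw [dG, dG, hsum]
    rcases Nat.even_or_odd (n + 1) with h | h
    · rw [if_pos h.add_one, if_neg (Nat.not_odd_iff_even.2 h)]
      exact exact_mulLeft_of_sub_one_sum (mem_zpowers_g q)
    · rw [if_neg (Nat.not_odd_iff_even.2 h.add_one), if_pos h]
      exact exact_mulLeft_sum_of_sub_one (mem_zpowers_g q)
  exact_zero := by
    rw [dG, if_pos (by simp)]
    exact exact_mulLeft_of_sub_one_lift (mem_zpowers_g q)
  surjective c := ⟨algebraMap k (MonoidAlgebra k (G q)) c, (MonoidAlgebra.lift k k _ 1).commutes c⟩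

end Group

section Trunc

variable (k : Type u) [Field k] (p : ℕ)

theorem exact_mulLeft_root_pow {a b : ℕ} (h : a + b = p) :
    Function.Exact (LinearMap.mulLeft k (root k p ^ a)) (LinearMap.mulLeft k (root k p ^ b)) := by
  intro z
  refine ⟨fun hz => ?_, ?_⟩
  · obtain ⟨f, rfl⟩ := AdjoinRoot.mk_surjective z
    rw [LinearMap.mulLeft_apply, root, AdjoinRoot.root, ← map_pow, ← map_mul,
      AdjoinRoot.mk_eq_zero, ← h, add_comm, pow_add,
      mul_dvd_mul_iff_left (pow_ne_zero _ Polynomial.X_ne_zero)] at hz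
    obtain ⟨f, rfl⟩ := hz
    exact ⟨AdjoinRoot.mk _ f, by rw [map_mul, map_pow]; rfl⟩
  · rintro ⟨w, rfl⟩
    rw [LinearMap.mulLeft_apply, LinearMap.mulLeft_apply, ← mul_assoc, ← pow_add, add_comm, h,
      root_pow, zero_mul]

theorem dTrunc_eq (i : ℕ) :
    dTrunc k p i = LinearMap.mulLeft k (root k p ^ (if Odd (i + 1) then 1 else p - 1)) := by
  rw [dTrunc]
  split_ifs <;> simp

variable [Fact p.Prime]

theorem exact_dTrunc (n : ℕ) : Function.Exact (dTrunc k p (n + 1)) (dTrunc k p n) := by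
  rw [dTrunc_eq, dTrunc_eq]
  apply exact_mulLeft_root_pow
  have hp := (Fact.out : p.Prime).pos
  simp only [Nat.odd_add_one (n := n + 1)]
  split_ifs <;> omega

theorem exact_dTrunc_augTrunc : Function.Exact (dTrunc k p 0) (augTrunc k p).toLinearMap := by
  rw [dTrunc, if_pos (by simp)]
  intro z
  refine ⟨fun hz => ?_, ?_⟩
  · obtain ⟨f, rfl⟩ := AdjoinRoot.mk_surjective z
    rw [AlgHom.toLinearMap_apply, augTrunc, AdjoinRoot.liftAlgHom_mk] at hz
    obtain ⟨f, rfl⟩ : Polynomial.X ∣ f := by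
      rw [Polynomial.X_dvd_iff, Polynomial.coeff_zero_eq_eval_zero]
      exact hz
    exact ⟨AdjoinRoot.mk _ f, (map_mul (AdjoinRoot.mk _) _ _).symm⟩
  · rintro ⟨w, rfl⟩
    rw [AlgHom.toLinearMap_apply, LinearMap.mulLeft_apply, map_mul, augTrunc,
      AdjoinRoot.liftAlgHom_root, zero_mul]

theorem augTrunc_surjective : Function.Surjective (augTrunc k p).toLinearMap :=
  fun c => ⟨algebraMap k _ c, (augTrunc k p).commutes c⟩

/-- The augmentation of `P(A)`. -/
def augPA : PA k p 0 →ₗ[k] k := (augTrunc k p).toLinearMap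

/-- The augmentation of `P(B)`. -/
def augPB : PB k p 0 →ₗ[k] k := (augTrunc k p).toLinearMap

theorem isFreeResolution_PA : IsFreeResolution k (PA k p) (dA k p) (augPA k p) where
  free _ := .of_divisionRing k _
  exact_succ := exact_dTrunc k p
  exact_zero := exact_dTrunc_augTrunc k p
  surjective := augTrunc_surjective k p

theorem isFreeResolution_PB : IsFreeResolution k (PB k p) (dB k p) (augPB k p) where
  free _ := .of_divisionRing k _
  exact_succ := exact_dTrunc k p
  exact_zero := exact_dTrunc_augTrunc k p
  surjective := augTrunc_surjective k p

theorem isFreeResolution_tot_PA_PB : IsFreeResolution k (K k p) (dK k p) (augK k p) :=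
  (isFreeResolution_PA k p).tot (isFreeResolution_PB k p)

end Trunc

/-! ### The resolution `K` -/

instance (n : ℕ) : Finite (Pairs n) :=
  .of_equiv (Finset.HasAntidiagonal.antidiagonal n)
    (Equiv.subtypeEquivRight fun _ => Finset.HasAntidiagonal.mem_antidiagonal)

variable (k : Type u) [Field k] (p : ℕ)

section Generators

theorem adjoin_x_y : Algebra.adjoin k {x k p, y k p} = ⊤ := by
  have hrange : Set.range (toR k p ∘ FreeAlgebra.ι k) = {x k p, y k p} := by
    ext r
    simp [Fin.exists_fin_two, x, y, eq_comm]
  rw [← hrange, Set.range_comp, ← AlgHom.map_adjoin, FreeAlgebra.adjoin_range_ι, Algebra.map_top,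
    AlgHom.range_eq_top]
  exact RingQuot.mkAlgHom_surjective k _

variable {k p}

@[elab_as_elim]
theorem induction_x_y {motive : R k p → Prop} (r : R k p)
    (algebraMap : ∀ c : k, motive (algebraMap k (R k p) c)) (x : motive (x k p))
    (y : motive (y k p)) (add : ∀ a b, motive a → motive b → motive (a + b))
    (mul : ∀ a b, motive a → motive b → motive (a * b)) : motive r := by
  have hr : r ∈ Algebra.adjoin k {JordanBosonization.x k p, JordanBosonization.y k p} :=
    adjoin_x_y k p ▸ Algebra.mem_top
  induction hr using Algebra.adjoin_induction with
  | mem a ha => rcases ha with rfl | rfl <;> assumption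
  | algebraMap c => exact algebraMap c
  | add a b _ _ ha hb => exact add a b ha hb
  | mul a b _ _ ha hb => exact mul a b ha hb

theorem map_smul_of_map_x_smul_of_map_y_smul {M N : Type*}
    [AddCommGroup M] [Module k M] [Module (R k p) M] [IsScalarTower k (R k p) M]
    [AddCommGroup N] [Module k N] [Module (R k p) N] [IsScalarTower k (R k p) N] {f : M →ₗ[k] N}
    (hx : ∀ z, f (x k p • z) = x k p • f z) (hy : ∀ z, f (y k p • z) = y k p • f z)
    (r : R k p) (z : M) : f (r • z) = r • f z := by
  induction r using induction_x_y generalizing z with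
  | algebraMap c => rw [algebraMap_smul, algebraMap_smul, map_smul]
  | x => exact hx z
  | y => exact hy z
  | add a b ha hb => rw [add_smul, map_add, ha, hb, add_smul]
  | mul a b ha hb => rw [mul_smul, ha, hb, mul_smul]

theorem smul_mem_of_x_smul_mem_of_y_smul_mem {M : Type*} [AddCommGroup M] [Module k M]
    [Module (R k p) M] [IsScalarTower k (R k p) M] {S : Submodule k M}
    (hx : ∀ z ∈ S, x k p • z ∈ S) (hy : ∀ z ∈ S, y k p • z ∈ S) (r : R k p) {z : M} (hz : z ∈ S) :
    r • z ∈ S := by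
  induction r using induction_x_y generalizing z with
  | algebraMap c => rw [algebraMap_smul]; exact S.smul_mem c hz
  | x => exact hx z hz
  | y => exact hy z hz
  | add a b ha hb => rw [add_smul]; exact S.add_mem (ha hz) (hb hz)
  | mul a b ha hb => rw [mul_smul]; exact ha (hb hz)

end Generators

section Operators

theorem xMul_xPow (i m : ℕ) : xMul k p i (xPow k p i m) = xPow k p i (m + 1) :=
  (pow_succ' (root k p) m).symm

theorem yMul_pow_yPow (j r m : ℕ) : (yMul k p j ^ r) (yPow k p j m) = yPow k p j (r + m) := by
  change (LinearMap.mulLeft k (root k p) ^ r) (root k p ^ m) = root k p ^ (r + m)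
  rw [LinearMap.pow_mulLeft, LinearMap.mulLeft_apply, pow_add]

theorem yMul_yPow (j m : ℕ) : yMul k p j (yPow k p j m) = yPow k p j (m + 1) :=
  (pow_succ' (root k p) m).symm

theorem shiftOp_root_pow (e m : ℕ) :
    shiftOp k p e (root k p ^ m) = (2⁻¹ * ((m + e : ℕ) : k)) • root k p ^ (m + 1) := by
  rw [root, AdjoinRoot.root, ← map_pow, shiftOp_mk, ← map_pow, AdjoinRoot.smul_mk]
  congr 1
  cases m with
  | zero => simp [polyOp, Polynomial.smul_eq_C_mul, mul_assoc]
  | succ m =>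
    simp [polyOp, Polynomial.smul_eq_C_mul]
    ring

theorem delta_xPow (i m : ℕ) :
    delta k p i (xPow k p i m) = (2⁻¹ * ((m + i % 2 : ℕ) : k)) • xPow k p i (m + 1) :=
  shiftOp_root_pow k p (i % 2) m

theorem delta_pow_xPow (i m t : ℕ) : (delta k p i ^ t) (xPow k p i m) =
    ((2⁻¹ : k) ^ t * ((m + i % 2).ascFactorial t : k)) • xPow k p i (m + t) := by
  induction t with
  | zero => simp
  | succ t ih =>
    rw [pow_succ', Module.End.mul_apply, ih, map_smul, delta_xPow, smul_smul,
      Nat.ascFactorial_succ, ← add_assoc]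
    congr 1
    push_cast
    ring

/-- The basis `1, t, …, t ^ (p - 1)` of `k[t]/(t ^ p)`. -/
def truncBasis : Module.Basis (Fin p) k (Trunc k p) :=
  (AdjoinRoot.powerBasisAux' (Polynomial.monic_X_pow p)).reindex
    (finCongr (Polynomial.natDegree_X_pow p))

theorem truncBasis_apply (i : Fin p) : truncBasis k p i = root k p ^ (i : ℕ) := by
  rw [truncBasis, Module.Basis.reindex_apply]
  exact (AdjoinRoot.powerBasis' (Polynomial.monic_X_pow p)).basis_eq_pow _

/-- The basis `1, x, …, x ^ (p - 1)` of `P_i(A)`. -/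
def basisPA (i : ℕ) : Module.Basis (Fin p) k (PA k p i) := truncBasis k p

/-- The basis `1, y, …, y ^ (p - 1)` of `P_j(B)`. -/
def basisPB (j : ℕ) : Module.Basis (Fin p) k (PB k p j) := truncBasis k p

/-- The basis `x ^ l ⊗ y ^ r` of `P_i(A) ⊗ P_j(B)`. -/
def tensorBasis (i j : ℕ) : Module.Basis (Fin p × Fin p) k (PA k p i ⊗[k] PB k p j) :=
  (basisPA k p i).tensorProduct (basisPB k p j)

theorem tensorBasis_apply (i j : ℕ) (lr : Fin p × Fin p) :
    tensorBasis k p i j lr = xPow k p i lr.1 ⊗ₜ yPow k p j lr.2 := by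
  rw [tensorBasis, Module.Basis.tensorProduct_apply']
  exact congrArg₂ (· ⊗ₜ[k] ·) (truncBasis_apply k p lr.1) (truncBasis_apply k p lr.2)

variable [Fact p.Prime] [CharP k p]

theorem x_smul (i j : ℕ) (z : PA k p i ⊗[k] PB k p j) : x k p • z = xAct k p i j z := by
  change actHom k p i j (x k p) z = _
  rw [actHom, lift_x]

theorem y_smul (i j : ℕ) (z : PA k p i ⊗[k] PB k p j) : y k p • z = yAct k p i j z := by
  change actHom k p i j (y k p) z = _
  rw [actHom, lift_y]

theorem x_smul_tmul (i j : ℕ) (a : PA k p i) (b : PB k p j) :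
    x k p • (a ⊗ₜ[k] b) = xMul k p i a ⊗ₜ b := by
  rw [x_smul]
  rfl

theorem y_smul_tmul (i j : ℕ) (a : PA k p i) (b : PB k p j) :
    y k p • (a ⊗ₜ[k] b) = a ⊗ₜ yMul k p j b + delta k p i a ⊗ₜ b := by
  rw [y_smul]
  rfl

theorem x_pow_smul_tmul (i j l m : ℕ) (b : PB k p j) :
    x k p ^ l • (xPow k p i m ⊗ₜ[k] b) = xPow k p i (l + m) ⊗ₜ b := by
  induction l with
  | zero => simp
  | succ l ih => rw [pow_succ', mul_smul, ih, x_smul_tmul, xMul_xPow, add_right_comm]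

theorem x_pow_mul_y_pow_smul (i j l r m s : ℕ) :
    (x k p ^ l * y k p ^ r) • (xPow k p i m ⊗ₜ[k] yPow k p j s) =
      ∑ t ∈ Finset.range (r + 1),
        ((r.choose t : k) * (2⁻¹ : k) ^ t * ((m + i % 2).ascFactorial t : k)) •
          (xPow k p i (l + (m + t)) ⊗ₜ[k] yPow k p j (r - t + s)) := by
  have hc : Commute ((delta k p i).rTensor (PB k p j)) ((yMul k p j).lTensor (PA k p i)) := by
    change LinearMap.comp _ _ = LinearMap.comp _ _
    rw [LinearMap.lTensor_comp_rTensor, LinearMap.rTensor_comp_lTensor]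
  have hy (z : PA k p i ⊗[k] PB k p j) : y k p ^ r • z = (yAct k p i j ^ r) z := by
    change actHom k p i j (y k p ^ r) z = _
    rw [map_pow, actHom, lift_y]
  rw [mul_smul, hy, yAct, add_comm, hc.add_pow, LinearMap.sum_apply, Finset.smul_sum]
  refine Finset.sum_congr rfl fun t _ => ?_
  rw [Module.End.mul_apply, Module.End.natCast_apply, map_nsmul, Module.End.mul_apply,
    LinearMap.lTensor_pow, LinearMap.rTensor_pow, LinearMap.lTensor_tmul, LinearMap.rTensor_tmul,
    yMul_pow_yPow, delta_pow_xPow, ← TensorProduct.smul_tmul', ← Nat.cast_smul_eq_nsmul k,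
    smul_smul, smul_comm, x_pow_smul_tmul, mul_assoc]

end Operators

section Bases

theorem x_pow_mul_y_pow_mem_span (i j : ℕ) : x k p ^ i * y k p ^ j ∈ Submodule.span k
    (Set.range fun ij : Fin p × Fin p => x k p ^ (ij.1 : ℕ) * y k p ^ (ij.2 : ℕ)) := by
  rcases le_or_gt p i with hi | hi
  · rw [pow_eq_zero_of_le hi (x_pow k p), zero_mul]
    exact Submodule.zero_mem _
  rcases le_or_gt p j with hj | hj
  · rw [pow_eq_zero_of_le hj (y_pow k p), mul_zero]
    exact Submodule.zero_mem _
  exact Submodule.subset_span ⟨(⟨i, hi⟩, ⟨j, hj⟩), rfl⟩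

theorem span_monomials : Submodule.span k (Set.range fun ij : Fin p × Fin p =>
    x k p ^ (ij.1 : ℕ) * y k p ^ (ij.2 : ℕ)) = ⊤ := by
  set S := Submodule.span k (Set.range fun ij : Fin p × Fin p =>
    x k p ^ (ij.1 : ℕ) * y k p ^ (ij.2 : ℕ)) with hS
  have smul_mem (a : R k p) (ha : ∀ i j : ℕ, a * (x k p ^ i * y k p ^ j) ∈ S) :
      ∀ z ∈ S, a • z ∈ S := by
    suffices S ≤ S.comap (LinearMap.mulLeft k a) from fun z hz => this hz
    rw [hS, Submodule.span_le]
    rintro _ ⟨ij, rfl⟩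
    exact ha ij.1 ij.2
  have hx := smul_mem (x k p) fun i j => by
    rw [← mul_assoc, ← pow_succ']
    exact x_pow_mul_y_pow_mem_span k p _ _
  have hy := smul_mem (y k p) fun i j => by
    rw [← mul_assoc, y_mul_x_pow, add_mul, mul_assoc, ← pow_succ', smul_mul_assoc]
    exact S.add_mem (x_pow_mul_y_pow_mem_span k p _ _)
      (S.smul_mem _ (x_pow_mul_y_pow_mem_span k p _ _))
  have one_mem : (1 : R k p) ∈ S := by simpa using x_pow_mul_y_pow_mem_span k p 0 0
  exact eq_top_iff.2 fun r _ => by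
    simpa using smul_mem_of_x_smul_mem_of_y_smul_mem hx hy r one_mem

/-- The generator `1 ⊗ 1` of `P_i(A) ⊗ P_j(B)`. -/
abbrev gen (i j : ℕ) : PA k p i ⊗[k] PB k p j := xPow k p i 0 ⊗ₜ yPow k p j 0

/-- The element of `R` that acts on `1 ⊗ B ⊆ P_i(A) ⊗ P_j(B)` as multiplication by `y` on `B`:
it is `y` for `i` even and `y - x / 2` for `i` odd. -/
def yShift (i : ℕ) : R k p := y k p + (-2⁻¹ * (i % 2 : ℕ) : k) • x k p

theorem yShift_of_even {i : ℕ} (hi : Even i) : yShift k p i = y k p := by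
  simp [yShift, Nat.even_iff.1 hi]

theorem yShift_of_odd {i : ℕ} (hi : Odd i) : yShift k p i = y k p + (-2⁻¹ : k) • x k p := by
  simp [yShift, Nat.odd_iff.1 hi]

theorem phi_apply (n : ℕ) (i j : ℤ) (ab : Pairs n) : phi k p n i j ab =
    if (ab.1.1 : ℤ) = i ∧ (ab.1.2 : ℤ) = j then gen k p ab.1.1 ab.1.2 else 0 := rfl

variable [Fact p.Prime] [CharP k p]

theorem yShift_pow_smul_gen (i j s : ℕ) :
    yShift k p i ^ s • gen k p i j = xPow k p i 0 ⊗ₜ yPow k p j s := by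
  induction s with
  | zero => simp
  | succ s ih =>
    rw [pow_succ', mul_smul, ih, yShift, add_smul, y_smul_tmul, yMul_yPow, delta_xPow, smul_assoc,
      x_smul_tmul, xMul_xPow, ← TensorProduct.smul_tmul', zero_add, zero_add, neg_mul, neg_smul,
      add_neg_cancel_right]

theorem x_pow_mul_yShift_pow_smul_gen (i j l s : ℕ) :
    (x k p ^ l * yShift k p i ^ s) • gen k p i j = xPow k p i l ⊗ₜ yPow k p j s := by
  rw [mul_smul, yShift_pow_smul_gen, x_pow_smul_tmul, add_zero]

theorem linearIndependent_monomials : LinearIndependent k fun ij : Fin p × Fin p =>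
    x k p ^ (ij.1 : ℕ) * y k p ^ (ij.2 : ℕ) := by
  refine .of_comp ((LinearMap.toSpanSingleton (R k p) _ (gen k p 0 0)).restrictScalars k) ?_
  convert (tensorBasis k p 0 0).linearIndependent
  funext ij
  rw [tensorBasis_apply, ← x_pow_mul_yShift_pow_smul_gen, yShift_of_even k p Even.zero]
  rfl

/-- The basis `x ^ i * y ^ j` of `R`. -/
def monomialBasis : Module.Basis (Fin p × Fin p) k (R k p) :=
  .mk (linearIndependent_monomials k p) (span_monomials k p).ge

theorem monomialBasis_apply (ij : Fin p × Fin p) :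
    monomialBasis k p ij = x k p ^ (ij.1 : ℕ) * y k p ^ (ij.2 : ℕ) :=
  Module.Basis.mk_apply ..

theorem toSpanSingleton_gen_surjective (i j : ℕ) :
    Function.Surjective (LinearMap.toSpanSingleton (R k p) _ (gen k p i j)) := by
  refine (LinearMap.range_eq_top
    (f := (LinearMap.toSpanSingleton (R k p) _ (gen k p i j)).restrictScalars k)).1 ?_
  rw [eq_top_iff, ← (tensorBasis k p i j).span_eq, Submodule.span_le]
  rintro _ ⟨lr, rfl⟩
  rw [tensorBasis_apply]
  exact ⟨_, x_pow_mul_yShift_pow_smul_gen k p i j lr.1 lr.2⟩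

theorem toSpanSingleton_gen_bijective (i j : ℕ) :
    Function.Bijective (LinearMap.toSpanSingleton (R k p) _ (gen k p i j)) := by
  have hs := toSpanSingleton_gen_surjective k p i j
  have := (monomialBasis k p).finiteDimensional_of_finite
  have := (tensorBasis k p i j).finiteDimensional_of_finite
  refine ⟨(LinearMap.injective_iff_surjective_of_finrank_eq_finrank
    (f := (LinearMap.toSpanSingleton (R k p) _ (gen k p i j)).restrictScalars k) ?_).2 hs, hs⟩
  rw [Module.finrank_eq_card_basis (monomialBasis k p),
    Module.finrank_eq_card_basis (tensorBasis k p i j)]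

/-- The isomorphism `r ↦ r (1 ⊗ 1)` of `R` with `P_i(A) ⊗ P_j(B)`. -/
def genEquiv (i j : ℕ) : R k p ≃ₗ[R k p] PA k p i ⊗[k] PB k p j :=
  .ofBijective _ (toSpanSingleton_gen_bijective k p i j)

/-- The basis `φ_{i,j}` of `K_n` over `R`. -/
def basisK (n : ℕ) : Module.Basis (Pairs n) (R k p) (K k p n) :=
  .ofEquivFun (.piCongrRight fun ij => (genEquiv k p ij.1.1 ij.1.2).symm)

theorem basisK_apply (n : ℕ) (ij : Pairs n) : basisK k p n ij = phi k p n ij.1.1 ij.1.2 := by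
  classical
  rw [basisK, Module.Basis.coe_ofEquivFun]
  funext ab
  change (Pi.single ij 1 : Pairs n → R k p) ab • gen k p _ _ = _
  rw [phi_apply, Pi.single_apply]
  simp only [Nat.cast_inj, ← Prod.ext_iff, Subtype.ext_iff]
  split_ifs <;> simp

end Bases

section Differential

variable (k : Type u) [Field k] (p : ℕ)

theorem dTrunc_apply_root_mul (i : ℕ) (a : Trunc k p) :
    dTrunc k p i (root k p * a) = root k p * dTrunc k p i a :=
  mul_left_comm _ _ _

theorem dTrunc_shiftOp [Fact p.Prime] [CharP k p] (i : ℕ) (a : Trunc k p) :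
    dTrunc k p i (shiftOp k p ((i + 1) % 2) a) = shiftOp k p (i % 2) (dTrunc k p i a) := by
  suffices dTrunc k p i ∘ₗ shiftOp k p ((i + 1) % 2) = shiftOp k p (i % 2) ∘ₗ dTrunc k p i from
    LinearMap.congr_fun this a
  refine (truncBasis k p).ext fun m => ?_
  have hp := (Fact.out : p.Prime).pos
  rw [truncBasis_apply, LinearMap.comp_apply, LinearMap.comp_apply, shiftOp_root_pow, map_smul,
    dTrunc_eq, LinearMap.mulLeft_apply, LinearMap.mulLeft_apply, ← pow_add, ← pow_add,
    shiftOp_root_pow, add_assoc _ (m : ℕ) 1]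
  congr 2
  split_ifs with h
  · rw [show i % 2 = 0 by grind, show (i + 1) % 2 = 1 by grind, add_comm 1, add_zero]
  · rw [show i % 2 = 1 by grind, show (i + 1) % 2 = 0 by grind,
      show p - 1 + (m : ℕ) + 1 = p + m by omega, Nat.cast_add p m,
      CharP.cast_eq_zero k p, zero_add, add_zero]

variable [Fact p.Prime] [CharP k p]

variable {k p} in
theorem map_smul_of_commute {i i' j j' : ℕ} {f : PA k p i →ₗ[k] PA k p i'}
    {h : PB k p j →ₗ[k] PB k p j'} (hx : ∀ a, f (xMul k p i a) = xMul k p i' (f a))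
    (hδ : ∀ a, f (delta k p i a) = delta k p i' (f a))
    (hy : ∀ b, h (yMul k p j b) = yMul k p j' (h b)) (r : R k p) (z : PA k p i ⊗[k] PB k p j) :
    TensorProduct.map f h (r • z) = r • TensorProduct.map f h z := by
  refine map_smul_of_map_x_smul_of_map_y_smul (fun z => ?_) (fun z => ?_) r z
  all_goals induction z with
    | zero => simp only [smul_zero, map_zero]
    | add a b ha hb => simp only [smul_add, map_add, ha, hb]
    | tmul a b =>
      simp only [x_smul_tmul, y_smul_tmul, map_add, TensorProduct.map_tmul, hx, hδ, hy]

theorem rTensor_dA_smul (i j : ℕ) (r : R k p) (z : PA k p (i + 1) ⊗[k] PB k p j) :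
    (dA k p i).rTensor (PB k p j) (r • z) = r • (dA k p i).rTensor (PB k p j) z :=
  map_smul_of_commute (f := dA k p i) (h := .id) (dTrunc_apply_root_mul k p i)
    (dTrunc_shiftOp k p i) (fun _ => rfl) r z

theorem lTensor_dB_smul (i j : ℕ) (r : R k p) (z : PA k p i ⊗[k] PB k p (j + 1)) :
    (dB k p j).lTensor (PA k p i) (r • z) = r • (dB k p j).lTensor (PA k p i) z :=
  map_smul_of_commute (f := .id) (h := dB k p j) (fun _ => rfl) (fun _ => rfl)
    (dTrunc_apply_root_mul k p j) r z

omit [Fact p.Prime] [CharP k p] in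
theorem dK_apply (n : ℕ) (z : K k p (n + 1)) (ij : Pairs n) : dK k p n z ij =
    (dA k p ij.1.1).rTensor (PB k p ij.1.2)
        (z ⟨(ij.1.1 + 1, ij.1.2), by have := ij.2; dsimp only; omega⟩) +
      (-1 : k) ^ ij.1.1 • (dB k p ij.1.2).lTensor (PA k p ij.1.1)
        (z ⟨(ij.1.1, ij.1.2 + 1), by have := ij.2; dsimp only; omega⟩) := rfl

/-- The differential of `K` as an `R`-linear map. -/
def dKR (n : ℕ) : K k p (n + 1) →ₗ[R k p] K k p n where
  __ := dK k p n
  map_smul' r z := by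
    change dK k p n (r • z) = r • dK k p n z
    funext ij
    rw [dK_apply, Pi.smul_apply, Pi.smul_apply, Pi.smul_apply, dK_apply, rTensor_dA_smul,
      lTensor_dB_smul, smul_add, smul_comm r]

end Differential

section Augmentation

variable (k : Type u) [Field k] (p : ℕ) [Fact p.Prime]

theorem augTrunc_root_mul (a : Trunc k p) : augTrunc k p (root k p * a) = 0 := by
  rw [map_mul, augTrunc, AdjoinRoot.liftAlgHom_root, zero_mul]

theorem augTrunc_shiftOp (e : ℕ) (a : Trunc k p) : augTrunc k p (shiftOp k p e a) = 0 := by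
  suffices (augTrunc k p).toLinearMap ∘ₗ shiftOp k p e = 0 from LinearMap.congr_fun this a
  refine (truncBasis k p).ext fun m => ?_
  rw [truncBasis_apply, LinearMap.comp_apply, shiftOp_root_pow, map_smul,
    AlgHom.toLinearMap_apply, pow_succ', augTrunc_root_mul, smul_zero, LinearMap.zero_apply]

theorem R_smul_triv (r : R k p) (c : k) :
    r • toTriv k c = toTriv k (augR k p (Fact.out : p.Prime).ne_zero r * c) := rfl

instance : IsScalarTower k (R k p) (Triv k) where
  smul_assoc c r t := by
    obtain ⟨t, rfl⟩ := (toTriv k).surjective t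
    rw [R_smul_triv, R_smul_triv, map_smul, smul_mul_assoc, map_smul]

variable [CharP k p]

theorem map_aug_x_smul (z : PA k p 0 ⊗[k] PB k p 0) :
    TensorProduct.map (augPA k p) (augPB k p) (x k p • z) = 0 := by
  have h : augPA k p ∘ₗ xMul k p 0 = 0 := LinearMap.ext (augTrunc_root_mul k p)
  rw [x_smul, xAct, ← LinearMap.comp_apply, LinearMap.map_comp_rTensor, h,
    TensorProduct.map_zero_left, LinearMap.zero_apply]

theorem map_aug_y_smul (z : PA k p 0 ⊗[k] PB k p 0) :
    TensorProduct.map (augPA k p) (augPB k p) (y k p • z) = 0 := by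
  have hy : augPB k p ∘ₗ yMul k p 0 = 0 := LinearMap.ext (augTrunc_root_mul k p)
  have hδ : augPA k p ∘ₗ delta k p 0 = 0 := LinearMap.ext (augTrunc_shiftOp k p 0)
  rw [y_smul, yAct, LinearMap.add_apply, map_add, ← LinearMap.comp_apply,
    LinearMap.map_comp_lTensor, hy, ← LinearMap.comp_apply, LinearMap.map_comp_rTensor, hδ,
    TensorProduct.map_zero_right, TensorProduct.map_zero_left, LinearMap.zero_apply, add_zero]

/-- The augmentation of `K` as an `R`-linear map. -/
def augKR : K k p 0 →ₗ[R k p] Triv k where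
  __ := (toTriv k).toLinearMap ∘ₗ augK k p
  map_smul' r z := by
    refine map_smul_of_map_x_smul_of_map_y_smul (f := (toTriv k).toLinearMap ∘ₗ augK k p)
      (fun z => ?_) (fun z => ?_) r z
    · have h : augK k p (x k p • z) = 0 := by
        change LinearMap.mul' k k (TensorProduct.map (augPA k p) (augPB k p) (x k p • z _)) = 0
        rw [map_aug_x_smul, map_zero]
      rw [LinearMap.comp_apply, h, map_zero, LinearMap.comp_apply, LinearEquiv.coe_coe, R_smul_triv,
        augR, lift_x, zero_mul, map_zero]
    · have h : augK k p (y k p • z) = 0 := by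
        change LinearMap.mul' k k (TensorProduct.map (augPA k p) (augPB k p) (y k p • z _)) = 0
        rw [map_aug_y_smul, map_zero]
      rw [LinearMap.comp_apply, h, map_zero, LinearMap.comp_apply, LinearEquiv.coe_coe, R_smul_triv,
        augR, lift_y, zero_mul, map_zero]

theorem augK_smul (r : R k p) (z : K k p 0) :
    augK k p (r • z) = augR k p (Fact.out : p.Prime).ne_zero r * augK k p z :=
  (augKR k p).map_smul r z

end Augmentation

section Resolution

variable (k : Type u) [Field k] (p : ℕ)

theorem dA_xPow_zero (i : ℕ) :
    dA k p i (xPow k p (i + 1) 0) = xPow k p i (if Odd (i + 1) then 1 else p - 1) := by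
  change dTrunc k p i 1 = _
  rw [dTrunc_eq, LinearMap.mulLeft_apply, mul_one]
  rfl

theorem dB_yPow_zero (j : ℕ) :
    dB k p j (yPow k p (j + 1) 0) = yPow k p j (if Odd (j + 1) then 1 else p - 1) :=
  dA_xPow_zero k p j

theorem coeffY_eq [CharP k p] (hp : 2 < p) (i j : ℕ) :
    coeffY k p i j = (-1 : k) ^ i • yShift k p i ^ (if Odd j then 1 else p - 1) := by
  have hj : (if Odd j then 1 else p - 1) = if Even j then p - 1 else 1 := by grind
  rw [coeffY, hj]
  rcases Nat.even_or_odd i with hi | hi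
  · rw [if_pos hi, hi.neg_one_pow, one_smul, yShift_of_even k p hi]
    split_ifs <;> simp only [pow_one]
  · rw [if_neg (Nat.not_even_iff_odd.2 hi), hi.neg_one_pow, yShift_of_odd k p hi, neg_one_smul]
    split_ifs
    · rw [y_sub_half_pow k hp]
    · rw [pow_one, neg_smul, sub_eq_add_neg]

variable [Fact p.Prime] [CharP k p]

theorem isFreeResolution_K : IsFreeResolution (R k p) (K k p) (dKR k p) (augKR k p) where
  free n := .of_basis (basisK k p n)
  exact_succ := (isFreeResolution_tot_PA_PB k p).exact_succ
  exact_zero := (isFreeResolution_tot_PA_PB k p).exact_zero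
  surjective := (isFreeResolution_tot_PA_PB k p).surjective

theorem dA_tmul_gen (i j : ℕ) :
    dA k p i (xPow k p (i + 1) 0) ⊗ₜ yPow k p j 0 = coeffX k p (i + 1) • gen k p i j := by
  have hx (m : ℕ) : xPow k p i m ⊗ₜ[k] yPow k p j 0 = x k p ^ m • gen k p i j := by
    rw [x_pow_smul_tmul, add_zero]
  rw [dA_xPow_zero, hx, coeffX]
  rcases Nat.even_or_odd (i + 1) with hi | hi
  · rw [if_neg (Nat.not_odd_iff_even.2 hi), if_pos hi]
  · rw [if_pos hi, if_neg (Nat.not_even_iff_odd.2 hi), pow_one]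

theorem tmul_dB_gen (hp : 2 < p) (i j : ℕ) :
    (-1 : k) ^ i • (xPow k p i 0 ⊗ₜ[k] dB k p j (yPow k p (j + 1) 0)) =
      coeffY k p i (j + 1) • gen k p i j := by
  rw [dB_yPow_zero, coeffY_eq k p hp, smul_assoc, yShift_pow_smul_gen]

theorem dK_phi (hp : 2 < p) (n i j : ℕ) (h : i + j = n + 1) :
    dK k p n (phi k p (n + 1) i j) =
      coeffX k p i • phi k p n (i - 1) j + coeffY k p i j • phi k p n i (j - 1) := by
  funext ab
  have := ab.2
  rw [dK_apply, Pi.add_apply, Pi.smul_apply, Pi.smul_apply, phi_apply, phi_apply, phi_apply,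
    phi_apply]
  congr 1
  · by_cases hij : ab.1.1 + 1 = i ∧ ab.1.2 = j
    · obtain ⟨rfl, rfl⟩ := hij
      rw [if_pos (by simp), if_pos (by simp), LinearMap.rTensor_tmul, dA_tmul_gen]
    · rw [if_neg (by dsimp only; omega), if_neg (by omega), map_zero, smul_zero]
  · by_cases hij : ab.1.1 = i ∧ ab.1.2 + 1 = j
    · obtain ⟨rfl, rfl⟩ := hij
      rw [if_pos (by simp), if_pos (by simp), LinearMap.lTensor_tmul, tmul_dB_gen k p hp]
    · rw [if_neg (by dsimp only; omega), if_neg (by omega), map_zero, smul_zero, smul_zero]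

end Resolution

/-! ### The action of `G` on `K` -/

theorem sum_Icc_inv_pow_smul {Γ M : Type*} [Group Γ] [AddCommMonoid M] [DistribMulAction Γ M]
    (γ : Γ) (s : ℕ) (a : M) :
    ∑ t ∈ Finset.Icc 1 s, (γ ^ t)⁻¹ • a = (γ ^ s)⁻¹ • ∑ t ∈ Finset.range s, γ ^ t • a := by
  induction s with
  | zero => simp
  | succ s ih =>
    have hshift : ∑ t ∈ Finset.range s, γ ^ (t + 1) • a =
        γ • ∑ t ∈ Finset.range s, γ ^ t • a := by
      simp only [Finset.smul_sum, ← mul_smul, pow_succ']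
    rw [Finset.sum_Icc_succ_top (Nat.le_add_left 1 s), ih, Finset.sum_range_succ', hshift, pow_zero,
      one_smul, smul_add, smul_smul, pow_succ' γ s, mul_inv_rev, inv_mul_cancel_right]

section PowHom

variable (q : ℕ)

theorem g_pow_q : g q ^ q = 1 := orderOf_dvd_iff_pow_eq_one.1 (orderOf_g q).dvd

variable [NeZero q]

theorem exists_g_pow_eq (h : G q) : ∃ s : ℕ, g q ^ s = h :=
  (Submonoid.mem_powers_iff _ _).1 <| mem_powers_iff_mem_zpowers.2 (mem_zpowers_g q h)

variable {M : Type*} [Monoid M] {a : M}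

/-- The homomorphism from `G` that sends `g` to an element `a` with `a ^ q = 1`. -/
def powHom (ha : a ^ q = 1) : G q →* M where
  toFun h := a ^ h.toAdd.val
  map_one' := by rw [toAdd_one, ZMod.val_zero, pow_zero]
  map_mul' h h' := by rw [toAdd_mul, ZMod.val_add, ← pow_eq_pow_mod _ ha, pow_add]

theorem powHom_g_pow (ha : a ^ q = 1) (s : ℕ) : powHom q ha (g q ^ s) = a ^ s := by
  change a ^ (g q ^ s).toAdd.val = _
  rw [g, toAdd_pow, toAdd_ofAdd, nsmul_one, ZMod.val_natCast, ← pow_eq_pow_mod _ ha]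

end PowHom

section Twist

variable (k : Type u) [Field k] (p : ℕ)

/-- The coefficient of `φ_{i+1,j-1}` in `ᵍφ_{i,j}`. -/
def twist (i j : ℤ) : R k p := if Odd i then 0 else if Odd j then 1 else alpha k p

theorem twist_of_odd {i : ℤ} (hi : Odd i) (j : ℤ) : twist k p i j = 0 := if_pos hi

theorem twist_of_even_of_odd {i j : ℤ} (hi : Even i) (hj : Odd j) : twist k p i j = 1 := by
  rw [twist, if_neg (Int.not_odd_iff_even.2 hi), if_pos hj]

theorem twist_of_even_of_even {i j : ℤ} (hi : Even i) (hj : Even j) :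
    twist k p i j = alpha k p := by
  rw [twist, if_neg (Int.not_odd_iff_even.2 hi), if_neg (Int.not_odd_iff_even.2 hj)]

theorem coeffX_of_even {i : ℕ} (hi : Even i) : coeffX k p i = x k p ^ (p - 1) := if_pos hi

theorem coeffX_of_odd {i : ℕ} (hi : Odd i) : coeffX k p i = x k p :=
  if_neg (Nat.not_even_iff_odd.2 hi)

variable [CharP k p]

theorem twist_mul_x (hp : 2 < p) {i : ℕ} (hi : Even i) (j : ℕ) :
    twist k p i j * x k p = (y k p + x k p) ^ (if Odd j then 1 else p - 1) -
      y k p ^ (if Odd j then 1 else p - 1) := by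
  rcases Nat.even_or_odd j with hj | hj
  · rw [twist_of_even_of_even k p (mod_cast hi) (mod_cast hj), alpha_mul_x k hp,
      if_neg (Nat.not_odd_iff_even.2 hj)]
  · rw [twist_of_even_of_odd k p (mod_cast hi) (mod_cast hj), if_pos hj, pow_one, pow_one, one_mul,
      add_sub_cancel_left]

theorem x_mul_twist (hp : 2 < p) {i : ℕ} (hi : Even i) (j : ℕ) :
    x k p * twist k p i j =
      (y k p + (2⁻¹ : k) • x k p) ^ (if Odd j then 1 else p - 1) -
        (y k p + (-2⁻¹ : k) • x k p) ^ (if Odd j then 1 else p - 1) := by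
  have h2 := two_ne_zero_of_lt k hp
  rcases Nat.even_or_odd j with hj | hj
  · rw [twist_of_even_of_even k p (mod_cast hi) (mod_cast hj), x_mul_alpha k hp,
      if_neg (Nat.not_odd_iff_even.2 hj)]
  · rw [twist_of_even_of_odd k p (mod_cast hi) (mod_cast hj), if_pos hj, pow_one, pow_one, mul_one,
      add_sub_add_left_eq_sub, ← sub_smul, show (2⁻¹ : k) - -2⁻¹ = 1 by field_simp; norm_num,
      one_smul]

variable [Fact p.Prime]

theorem sigma_coeffX (c : k) (i : ℕ) : sigma k p c (coeffX k p i) = coeffX k p i := by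
  rcases Nat.even_or_odd i with hi | hi
  · rw [coeffX_of_even k p hi, map_pow, sigma_x]
  · rw [coeffX_of_odd k p hi, sigma_x]

theorem sigma_yShift_of_even {i : ℕ} (hi : Even i) :
    sigma k p 1 (yShift k p i) = y k p + x k p := by
  rw [yShift_of_even k p hi, sigma_y, one_smul]

theorem sigma_yShift_of_odd (hp : 2 < p) {i : ℕ} (hi : Odd i) :
    sigma k p 1 (yShift k p i) = y k p + (2⁻¹ : k) • x k p := by
  have h2 := two_ne_zero_of_lt k hp
  rw [yShift_of_odd k p hi, sigma_add_smul, show (-2⁻¹ : k) + 1 = 2⁻¹ by field_simp; norm_num]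

theorem sigma_coeffY (hp : 2 < p) (i j : ℕ) :
    sigma k p 1 (coeffY k p i j) = coeffY k p i j + twist k p i j * coeffX k p (i + 1) -
      coeffX k p i * twist k p (i - 1) j := by
  rw [coeffY_eq k p hp, map_smul, map_pow]
  rcases Nat.even_or_odd i with hi | hi
  · have hi' : Odd ((i : ℤ) - 1) := Even.sub_odd (mod_cast hi) odd_one
    rw [twist_of_odd k p hi', mul_zero, sub_zero, coeffX_of_odd k p hi.add_one,
      twist_mul_x k p hp hi, sigma_yShift_of_even k p hi, yShift_of_even k p hi, hi.neg_one_pow,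
      one_smul, one_smul, add_sub_cancel]
  · obtain ⟨m, rfl⟩ : ∃ m, i = m + 1 := ⟨i - 1, by grind⟩
    have hm : Even m := by grind
    rw [twist_of_odd k p (mod_cast hi), zero_mul, add_zero, coeffX_of_odd k p hi,
      Nat.cast_add_one, add_sub_cancel_right, x_mul_twist k p hp hm,
      sigma_yShift_of_odd k p hp hi, yShift_of_odd k p hi, hi.neg_one_pow]
    simp only [neg_one_smul]
    abel

theorem twist_mul_coeffY (hp : 2 < p) (i j : ℕ) :
    twist k p i (j + 1) * coeffY k p (i + 1) j =
      sigma k p 1 (coeffY k p i (j + 1)) * twist k p i j := by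
  rcases Nat.even_or_odd i with hi | hi
  · have hi' : Even (i : ℤ) := mod_cast hi
    rw [coeffY_eq k p hp, coeffY_eq k p hp, map_smul, map_pow, sigma_yShift_of_even k p hi,
      yShift_of_odd k p hi.add_one, hi.neg_one_pow, hi.add_one.neg_one_pow, one_smul, neg_one_smul]
    rcases Nat.even_or_odd j with hj | hj
    · rw [twist_of_even_of_odd k p hi' (mod_cast hj.add_one),
        twist_of_even_of_even k p hi' (mod_cast hj), if_pos hj.add_one,
        if_neg (Nat.not_odd_iff_even.2 hj), pow_one, one_mul, y_add_x_mul_alpha k hp]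
    · rw [twist_of_even_of_even k p hi' (mod_cast hj.add_one),
        twist_of_even_of_odd k p hi' (mod_cast hj), if_pos hj,
        if_neg (Nat.not_odd_iff_even.2 hj.add_one), pow_one, mul_one, mul_neg,
        alpha_mul_y_sub_half_x k hp, neg_neg]
  · rw [twist_of_odd k p (mod_cast hi), twist_of_odd k p (mod_cast hi), zero_mul, mul_zero]

end Twist

section GeneratorAction

variable (k : Type u) [Field k] (p : ℕ)

theorem phi_eq_zero (n : ℕ) {i j : ℤ} (h : i < 0 ∨ j < 0 ∨ i + j ≠ n) : phi k p n i j = 0 := by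
  funext ab
  have := ab.2
  rw [phi_apply, if_neg (by omega), Pi.zero_apply]

variable [Fact p.Prime] [CharP k p]

theorem phi_eq_basisK (n : ℕ) (ij : Pairs n) : phi k p n ij.1.1 ij.1.2 = basisK k p n ij :=
  (basisK_apply k p n ij).symm

instance (n : ℕ) : Fintype (Pairs n) := Fintype.ofFinite _

/-- The action of the generator `g` on `K_n`. -/
def gAct (n : ℕ) : Module.End k (K k p n) :=
  semilinearExt (basisK k p n) (sigma k p 1) fun ij =>
    phi k p n ij.1.1 ij.1.2 + twist k p ij.1.1 ij.1.2 • phi k p n (ij.1.1 + 1) (ij.1.2 - 1)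

theorem gAct_smul (n : ℕ) (r : R k p) (z : K k p n) :
    gAct k p n (r • z) = sigma k p 1 r • gAct k p n z :=
  semilinearExt_smul ..

theorem gAct_phi (n : ℕ) (i j : ℤ) : gAct k p n (phi k p n i j) =
    phi k p n i j + twist k p i j • phi k p n (i + 1) (j - 1) := by
  by_cases h : i < 0 ∨ j < 0 ∨ i + j ≠ n
  · rw [phi_eq_zero k p n h, map_zero, zero_add]
    by_cases hi : i = -1
    · rw [twist_of_odd k p (hi ▸ odd_neg_one), zero_smul]
    · rw [phi_eq_zero k p n (by omega), smul_zero]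
  · lift i to ℕ using by omega
    lift j to ℕ using by omega
    have hij := phi_eq_basisK k p n ⟨(i, j), by omega⟩
    rw [hij, gAct, semilinearExt_basis, ← hij]

theorem dK_smul (n : ℕ) (r : R k p) (z : K k p (n + 1)) : dK k p n (r • z) = r • dK k p n z :=
  (dKR k p n).map_smul r z

theorem dK_gAct_phi (hp : 2 < p) (n i j : ℕ) (h : i + j = n + 1) :
    dK k p n (gAct k p (n + 1) (phi k p (n + 1) i j)) =
      gAct k p n (dK k p n (phi k p (n + 1) i j)) := by
  rw [gAct_phi, map_add, dK_smul, dK_phi k p hp n i j h, map_add, gAct_smul, gAct_smul, gAct_phi,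
    gAct_phi, sigma_coeffX, sub_add_cancel]
  rcases j with - | j
  · rw [phi_eq_zero k p (n + 1) (j := (0 : ℕ) - 1) (by omega),
      phi_eq_zero k p n (j := (0 : ℕ) - 1) (by omega),
      phi_eq_zero k p n (i := i + 1) (by omega)]
    simp only [map_zero, smul_zero, add_zero]
  · have hd := dK_phi k p hp n (i + 1) j (by omega)
    have htwist := twist_mul_coeffY k p hp i j
    have hcoeff := sigma_coeffY k p hp i (j + 1)
    push_cast at hd htwist hcoeff ⊢
    rw [add_sub_cancel_right] at hd ⊢
    rw [hd]
    simp only [smul_add, ← mul_smul, htwist]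
    rw [hcoeff]
    simp only [sub_smul, add_smul, mul_smul]
    abel

theorem dK_comp_gAct (hp : 2 < p) (n : ℕ) :
    dK k p n ∘ₗ gAct k p (n + 1) = gAct k p n ∘ₗ dK k p n :=
  eq_of_semilinear_of_basis (basisK k p (n + 1)) (σ := sigma k p 1)
    (fun r z => by simp only [LinearMap.comp_apply, gAct_smul, dK_smul])
    (fun r z => by simp only [LinearMap.comp_apply, gAct_smul, dK_smul])
    fun ij => by
      rw [LinearMap.comp_apply, LinearMap.comp_apply, basisK_apply, dK_gAct_phi k p hp n _ _ ij.2]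

theorem dK_gAct_pow (hp : 2 < p) (n s : ℕ) (z : K k p (n + 1)) :
    dK k p n ((gAct k p (n + 1) ^ s) z) = (gAct k p n ^ s) (dK k p n z) := by
  induction s with
  | zero => rfl
  | succ s ih =>
    rw [pow_succ', pow_succ', Module.End.mul_apply, Module.End.mul_apply, ← ih]
    exact LinearMap.congr_fun (dK_comp_gAct k p hp n) _

end GeneratorAction

section Equivariance

variable (k : Type u) [Field k] (p q : ℕ) [Fact p.Prime] [CharP k p] [Fact (p ∣ q)]

theorem g_pow_smul (s : ℕ) (r : R k p) : g q ^ s • r = sigma k p (s : k) r := by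
  change sigma k p (ZMod.castHom (Fact.out : p ∣ q) k (g q ^ s).toAdd) r = _
  rw [g, toAdd_pow, toAdd_ofAdd, nsmul_one, map_natCast]

theorem g_smul (r : R k p) : g q • r = sigma k p 1 r := by
  rw [← pow_one (g q), g_pow_smul, Nat.cast_one]

theorem gAct_pow_smul (n s : ℕ) (r : R k p) (z : K k p n) :
    (gAct k p n ^ s) (r • z) = (g q ^ s • r) • (gAct k p n ^ s) z := by
  induction s with
  | zero => simp
  | succ s ih =>
    rw [pow_succ', Module.End.mul_apply, ih, gAct_smul, ← Module.End.mul_apply, ← g_smul k p q,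
      ← mul_smul, ← pow_succ']

theorem gAct_pow_phi (n s : ℕ) (i j : ℤ) : (gAct k p n ^ s) (phi k p n i j) =
    phi k p n i j +
      (∑ t ∈ Finset.range s, g q ^ t • twist k p i j) • phi k p n (i + 1) (j - 1) := by
  induction s with
  | zero => simp
  | succ s ih =>
    rw [pow_succ', Module.End.mul_apply, ih, map_add, gAct_smul, gAct_phi, Finset.sum_range_succ',
      pow_zero, one_smul, ← g_smul k p q, Finset.smul_sum]
    simp_rw [← mul_smul, ← pow_succ']
    by_cases hi : Odd i
    · simp only [twist_of_odd k p hi, smul_zero, Finset.sum_const_zero, zero_smul, add_zero]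
    · rw [gAct_phi, twist_of_odd k p (Int.not_odd_iff_even.1 hi).add_one, zero_smul, add_zero,
        add_smul]
      abel

theorem sum_range_g_pow_smul_one (s : ℕ) :
    ∑ t ∈ Finset.range s, g q ^ t • (1 : R k p) = (s : k) • 1 := by
  simp only [smul_one, Finset.sum_const, Finset.card_range, Nat.cast_smul_eq_nsmul]

theorem sum_range_q_g_pow_smul_twist (hp : 2 < p) (i j : ℤ) :
    ∑ t ∈ Finset.range q, g q ^ t • twist k p i j = 0 := by
  rw [twist]
  split_ifs
  · simp only [smul_zero, Finset.sum_const_zero]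
  · rw [sum_range_g_pow_smul_one, (CharP.cast_eq_zero_iff k p q).2 Fact.out, zero_smul]
  · simp_rw [g_pow_smul]
    exact sum_sigma_alpha k Fact.out hp

theorem gAct_pow_q (hp : 2 < p) (n : ℕ) : gAct k p n ^ q = 1 :=
  eq_of_semilinear_of_basis (basisK k p n) (σ := (g q ^ q • ·)) (gAct_pow_smul k p q n q)
    (fun r z => by rw [g_pow_q, one_smul, Module.End.one_apply, Module.End.one_apply])
    fun ij => by
      rw [basisK_apply, gAct_pow_phi k p q, sum_range_q_g_pow_smul_twist k p q hp, zero_smul,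
        add_zero, Module.End.one_apply]

variable [NeZero q]

/-- The `G`-equivariant structure of `K` in which `g` acts by `gAct`. -/
def equivariantK (hp : 2 < p) : EquivariantAction k (R k p) (G q) (K k p) (dK k p) where
  rho n := powHom q (gAct_pow_q k p q hp n)
  semilinear n h r z := by
    obtain ⟨s, rfl⟩ := exists_g_pow_eq q h
    rw [powHom_g_pow, gAct_pow_smul k p q]
  comm_d n h z := by
    obtain ⟨s, rfl⟩ := exists_g_pow_eq q h
    rw [powHom_g_pow, powHom_g_pow, dK_gAct_pow k p hp]

theorem equivariantK_phi (hp : 2 < p) (n s : ℕ) (i j : ℤ) :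
    (equivariantK k p q hp).rho n (g q ^ s) (phi k p n i j) = phi k p n i j +
      (∑ t ∈ Finset.range s, g q ^ t • twist k p i j) • phi k p n (i + 1) (j - 1) := by
  rw [← gAct_pow_phi k p q, ← powHom_g_pow q (gAct_pow_q k p q hp n)]
  rfl

theorem equivariantK_phi_of_odd (hp : 2 < p) (n : ℕ) (h : G q) {i : ℤ} (hi : Odd i) (j : ℤ) :
    (equivariantK k p q hp).rho n h (phi k p n i j) = phi k p n i j := by
  obtain ⟨s, rfl⟩ := exists_g_pow_eq q h
  simp only [equivariantK_phi, twist_of_odd k p hi, smul_zero, Finset.sum_const_zero, zero_smul,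
    add_zero]

theorem equivariantK_inv_phi (hp : 2 < p) (n s : ℕ) (i j : ℤ) :
    (equivariantK k p q hp).rho n (g q ^ s)⁻¹ (phi k p n i j) = phi k p n i j -
      (∑ t ∈ Finset.Icc 1 s, (g q ^ t)⁻¹ • twist k p i j) • phi k p n (i + 1) (j - 1) := by
  by_cases hi : Odd i
  · simp only [equivariantK_phi_of_odd k p q hp n _ hi, twist_of_odd k p hi, smul_zero,
      Finset.sum_const_zero, zero_smul, sub_zero]
  · have hi' := (Int.not_odd_iff_even.1 hi).add_one
    rw [eq_sub_iff_add_eq, sum_Icc_inv_pow_smul,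
      ← equivariantK_phi_of_odd k p q hp n (g q ^ s)⁻¹ hi' (j - 1),
      ← (equivariantK k p q hp).semilinear, ← map_add,
      ← equivariantK_phi k p q hp, ← Module.End.mul_apply,
      ← map_mul, inv_mul_cancel, map_one, Module.End.one_apply]

theorem equivariantK_phi_of_even_of_odd (hp : 2 < p) (n s : ℕ) {i j : ℤ} (hi : Even i)
    (hj : Odd j) : (equivariantK k p q hp).rho n (g q ^ s) (phi k p n i j) =
      phi k p n i j + (s : k) • phi k p n (i + 1) (j - 1) := by
  rw [equivariantK_phi, twist_of_even_of_odd k p hi hj, sum_range_g_pow_smul_one, smul_assoc,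
    one_smul]

theorem equivariantK_phi_of_even_of_even (hp : 2 < p) (n s : ℕ) {i j : ℤ} (hi : Even i)
    (hj : Even j) : (equivariantK k p q hp).rho n (g q ^ s) (phi k p n i j) =
      phi k p n i j +
        (∑ t ∈ Finset.range s, g q ^ t • alpha k p) • phi k p n (i + 1) (j - 1) := by
  rw [equivariantK_phi, twist_of_even_of_even k p hi hj]

theorem equivariantK_inv_phi_of_even_of_odd (hp : 2 < p) (n s : ℕ) {i j : ℤ} (hi : Even i)
    (hj : Odd j) : (equivariantK k p q hp).rho n (g q ^ s)⁻¹ (phi k p n i j) =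
      phi k p n i j - (s : k) • phi k p n (i + 1) (j - 1) := by
  rw [equivariantK_inv_phi, twist_of_even_of_odd k p hi hj, sum_Icc_inv_pow_smul,
    sum_range_g_pow_smul_one, smul_comm, smul_one, smul_assoc, one_smul]

theorem equivariantK_inv_phi_of_even_of_even (hp : 2 < p) (n s : ℕ) {i j : ℤ} (hi : Even i)
    (hj : Even j) : (equivariantK k p q hp).rho n (g q ^ s)⁻¹ (phi k p n i j) =
      phi k p n i j -
        (∑ t ∈ Finset.Icc 1 s, (g q ^ t)⁻¹ • alpha k p) • phi k p n (i + 1) (j - 1) := by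
  rw [equivariantK_inv_phi, twist_of_even_of_even k p hi hj]

end Equivariance

/-! ### The resolution `Y` -/

theorem map_smul_of_map_single_smul {S Γ M N : Type*} [Semiring S] [Monoid Γ]
    [MulSemiringAction Γ S] [AddCommMonoid M] [Module (SkewMonoidAlgebra S Γ) M] [AddCommMonoid N]
    [Module (SkewMonoidAlgebra S Γ) N] (f : M →+ N)
    (hf : ∀ (h : Γ) (r : S) (z : M), f (SkewMonoidAlgebra.single h r • z) =
      SkewMonoidAlgebra.single h r • f z) (s : SkewMonoidAlgebra S Γ) (z : M) :
    f (s • z) = s • f z := by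
  induction s using SkewMonoidAlgebra.induction_on with
  | zero => rw [zero_smul, zero_smul, map_zero]
  | single h r => exact hf h r z
  | add a b ha hb => rw [add_smul, map_add, ha, hb, add_smul]

section GroupAlgebra

variable (k : Type u) [Field k] (q : ℕ)

/-- The basis of `P_b(kG) = kG` that consists of the group elements. -/
def basisPG (b : ℕ) : Module.Basis (G q) k (PG k q b) := MonoidAlgebra.basis ..

theorem regG_genPG (b : ℕ) (h : G q) : regG k q b h (genPG k q b) = basisPG k q b h :=
  mul_one (MonoidAlgebra.of k (G q) h)

theorem dG_regG (b : ℕ) (h : G q) (v : PG k q (b + 1)) :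
    dG k q b (regG k q (b + 1) h v) = regG k q b h (dG k q b v) :=
  mul_left_comm (G := MonoidAlgebra k (G q)) _ _ _

theorem augG_regG (h : G q) (v : PG k q 0) : augG k q (regG k q 0 h v) = augG k q v := by
  have hof : MonoidAlgebra.lift k k (G q) (1 : G q →* k) (MonoidAlgebra.of k (G q) h) = 1 := by
    rw [MonoidAlgebra.lift_of, MonoidHom.one_apply]
  exact (map_mul (MonoidAlgebra.lift k k (G q) (1 : G q →* k)) _ _).trans
    (by rw [hof, one_mul]; rfl)

theorem dG_genPG_of_odd {b : ℕ} (hb : Odd (b + 1)) :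
    dG k q b (genPG k q (b + 1)) = basisPG k q b (g q) - genPG k q b := by
  rw [dG, if_pos hb]
  exact mul_one (M := MonoidAlgebra k (G q)) _

theorem dG_genPG_of_even {b : ℕ} (hb : Even (b + 1)) :
    dG k q b (genPG k q (b + 1)) = ∑ s ∈ Finset.range q, basisPG k q b (g q ^ s) := by
  rw [dG, if_neg (Nat.not_odd_iff_even.2 hb)]
  exact mul_one (M := MonoidAlgebra k (G q)) _

end GroupAlgebra

section Smash

variable {k : Type u} [Field k] {p q : ℕ} [Fact p.Prime] [CharP k p] [Fact (p ∣ q)]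
  (E : EquivariantAction k (R k p) (G q) (K k p) (dK k p))

/-- The element `z ⊗ v` of `K_a ⊗ P_b(kG)`. -/
def ytmul (a b : ℕ) : K k p a →ₗ[k] PG k q b →ₗ[k] YSummand E a b :=
  TensorProduct.mk k (K k p a) (PG k q b)

@[elab_as_elim]
theorem YSummand.induction {a b : ℕ} {motive : YSummand E a b → Prop} (w : YSummand E a b)
    (tmul : ∀ z v, motive (ytmul E a b z v))
    (add : ∀ w w', motive w → motive w' → motive (w + w')) : motive w :=
  TensorProduct.induction_on w (by
    have h := tmul 0 0
    rwa [map_zero] at h) tmul add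

theorem single_smul_ytmul (a b : ℕ) (h : G q) (r : R k p) (z : K k p a) (v : PG k q b) :
    (SkewMonoidAlgebra.single h r : Bos k p q) • ytmul E a b z v =
      ytmul E a b (r • E.rho a h z) (regG k q b h v) := by
  change smashHom E a b (SkewMonoidAlgebra.single h r) (z ⊗ₜ v) = _
  rw [smashHom]
  exact LinearMap.congr_fun (SkewMonoidAlgebra.liftNC_single ..) (z ⊗ₜ[k] v)

theorem ofR_smul_ytmul (a b : ℕ) (r : R k p) (z : K k p a) (v : PG k q b) :
    ofR k p q r • ytmul E a b z v = ytmul E a b (r • z) v := by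
  rw [ofR, single_smul_ytmul, map_one, map_one, Module.End.one_apply, Module.End.one_apply]

theorem ofG_smul_ytmul (a b : ℕ) (h : G q) (z : K k p a) (v : PG k q b) :
    ofG k p q h • ytmul E a b z v = ytmul E a b (E.rho a h z) (regG k q b h v) := by
  rw [ofG, single_smul_ytmul, one_smul]

theorem ofG_smul_ytmul_inv_genPG (a b : ℕ) (h : G q) (z : K k p a) :
    ofG k p q h • ytmul E a b (E.rho a h⁻¹ z) (genPG k q b) = ytmul E a b z (basisPG k q b h) := by
  rw [ofG_smul_ytmul, ← Module.End.mul_apply, ← map_mul, mul_inv_cancel, map_one,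
    Module.End.one_apply, regG_genPG]

instance (a b : ℕ) : IsScalarTower k (Bos k p q) (YSummand E a b) where
  smul_assoc c s w := by
    change smashHom E a b (c • s) w = c • smashHom E a b s w
    rw [map_smul]
    rfl

/-- The differential `d ⊗ 1` on the summands of `Y`. -/
def dKY (a b : ℕ) : YSummand E (a + 1) b →ₗ[k] YSummand E a b :=
  (dK k p a).rTensor (PG k q b)

/-- The differential `1 ⊗ d` on the summands of `Y`. -/
def dGY (a b : ℕ) : YSummand E a (b + 1) →ₗ[k] YSummand E a b :=
  (dG k q b).lTensor (K k p a)

theorem dKY_ytmul (a b : ℕ) (z : K k p (a + 1)) (v : PG k q b) :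
    dKY E a b (ytmul E (a + 1) b z v) = ytmul E a b (dK k p a z) v := rfl

theorem dGY_ytmul (a b : ℕ) (z : K k p a) (v : PG k q (b + 1)) :
    dGY E a b (ytmul E a (b + 1) z v) = ytmul E a b z (dG k q b v) := rfl

theorem dKY_smul (a b : ℕ) (s : Bos k p q) (w : YSummand E (a + 1) b) :
    dKY E a b (s • w) = s • dKY E a b w := by
  refine map_smul_of_map_single_smul (dKY E a b).toAddMonoidHom (fun h r w => ?_) s w
  rw [LinearMap.toAddMonoidHom_coe]
  induction w using YSummand.induction with
  | add w w' hw hw' => rw [smul_add, map_add, hw, hw', map_add, smul_add]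
  | tmul z v =>
    rw [single_smul_ytmul, dKY_ytmul, dKY_ytmul, single_smul_ytmul, dK_smul, E.comm_d]

theorem dGY_smul (a b : ℕ) (s : Bos k p q) (w : YSummand E a (b + 1)) :
    dGY E a b (s • w) = s • dGY E a b w := by
  refine map_smul_of_map_single_smul (dGY E a b).toAddMonoidHom (fun h r w => ?_) s w
  rw [LinearMap.toAddMonoidHom_coe]
  induction w using YSummand.induction with
  | add w w' hw hw' => rw [smul_add, map_add, hw, hw', map_add, smul_add]
  | tmul z v => rw [single_smul_ytmul, dGY_ytmul, dGY_ytmul, single_smul_ytmul, dG_regG]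

theorem dY_apply (n : ℕ) (z : Y E (n + 1)) (ab : Pairs n) : dY E n z ab =
    dKY E ab.1.1 ab.1.2 (z ⟨(ab.1.1 + 1, ab.1.2), by have := ab.2; dsimp only; omega⟩) +
      (-1 : k) ^ ab.1.1 •
        dGY E ab.1.1 ab.1.2 (z ⟨(ab.1.1, ab.1.2 + 1), by have := ab.2; dsimp only; omega⟩) := rfl

/-- The differential of `Y` as an `R # kG`-linear map. -/
def dYB (n : ℕ) : Y E (n + 1) →ₗ[Bos k p q] Y E n where
  __ := dY E n
  map_smul' s z := by
    change dY E n (s • z) = s • dY E n z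
    funext ab
    rw [dY_apply, Pi.smul_apply, Pi.smul_apply, Pi.smul_apply, dY_apply, dKY_smul, dGY_smul,
      smul_add, smul_comm s]

theorem Bos_smul_triv (s : Bos k p q) (c : k) :
    s • toTriv k c = toTriv k (augBos k p q s * c) := rfl

theorem augBos_single (h : G q) (r : R k p) : augBos k p q (SkewMonoidAlgebra.single h r) =
    augR k p (Fact.out : p.Prime).ne_zero r :=
  (SkewMonoidAlgebra.liftNC_single ..).trans (mul_one _)

/-- The augmentation on the summand `K_0 ⊗ P_0(kG)`. -/
def augYSummand : YSummand E 0 0 →ₗ[k] k :=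
  LinearMap.mul' k k ∘ₗ TensorProduct.map (augK k p) (augG k q)

theorem augYSummand_ytmul (z : K k p 0) (v : PG k q 0) :
    augYSummand E (ytmul E 0 0 z v) = augK k p z * augG k q v := rfl

theorem augYSummand_single_smul (hE : ∀ h z, augK k p (E.rho 0 h z) = augK k p z) (h : G q)
    (r : R k p) (w : YSummand E 0 0) :
    augYSummand E ((SkewMonoidAlgebra.single h r : Bos k p q) • w) =
      augR k p (Fact.out : p.Prime).ne_zero r * augYSummand E w := by
  induction w using YSummand.induction with
  | add w w' hw hw' => rw [smul_add, map_add, hw, hw', map_add, mul_add]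
  | tmul z v =>
    rw [single_smul_ytmul, augYSummand_ytmul, augYSummand_ytmul, augK_smul, hE, augG_regG,
      mul_assoc]

/-- The augmentation of `Y` as an `R # kG`-linear map. -/
def augYB (hE : ∀ h z, augK k p (E.rho 0 h z) = augK k p z) : Y E 0 →ₗ[Bos k p q] Triv k where
  toFun z := toTriv k (augY E z)
  map_add' a b := by rw [map_add, map_add]
  map_smul' s z := by
    refine map_smul_of_map_single_smul ((toTriv k).toLinearMap ∘ₗ augY E).toAddMonoidHom
      (fun h r z => ?_) s z
    change toTriv k (augYSummand E ((SkewMonoidAlgebra.single h r : Bos k p q) • z ⟨(0, 0), rfl⟩)) =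
      (SkewMonoidAlgebra.single h r : Bos k p q) • toTriv k (augYSummand E (z ⟨(0, 0), rfl⟩))
    rw [Bos_smul_triv, augBos_single, augYSummand_single_smul E hE]

/-- The component in `K_a ⊗ h` of an element of `K_a ⊗ kG`. -/
def coeffAt (a b : ℕ) (h : G q) : YSummand E a b →ₗ[k] K k p a :=
  (TensorProduct.rid k (K k p a)).toLinearMap ∘ₗ ((basisPG k q b).coord h).lTensor (K k p a)

theorem coeffAt_ytmul_basisPG (a b : ℕ) (h h' : G q) (z : K k p a) [Decidable (h' = h)] :
    coeffAt E a b h (ytmul E a b z (basisPG k q b h')) = if h' = h then z else 0 := by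
  change (basisPG k q b).coord h (basisPG k q b h') • z = _
  rw [Module.Basis.coord_apply, Module.Basis.repr_self, Finsupp.single_apply, ite_smul, one_smul,
    zero_smul]

theorem coeffAt_smul (a b : ℕ) (h : G q) (s : Bos k p q) (z : K k p a) :
    coeffAt E a b h (s • ytmul E a b z (genPG k q b)) = s.coeff h • E.rho a h z := by
  classical
  induction s using SkewMonoidAlgebra.induction_on with
  | zero => simp
  | single h' r =>
    rw [single_smul_ytmul, regG_genPG, coeffAt_ytmul_basisPG, SkewMonoidAlgebra.coeff_single,
      Finsupp.single_apply, ite_smul, zero_smul]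
    exact if_ctx_congr Iff.rfl (fun hh => by rw [hh]) fun _ => rfl
  | add s t hs ht =>
    rw [add_smul, map_add, hs, ht, SkewMonoidAlgebra.coeff_add, Finsupp.add_apply, add_smul]

section Basis

variable {ι : Type*} {a : ℕ} (c : Module.Basis ι (R k p) (K k p a)) (b : ℕ)

theorem linearIndependent_ytmul [Finite ι] :
    LinearIndependent (Bos k p q) fun i => ytmul E a b (c i) (genPG k q b) := by
  have := Fintype.ofFinite ι
  rw [Fintype.linearIndependent_iff]
  intro s hs i
  ext h
  have hsum := congrArg (fun w => E.rho a h⁻¹ (coeffAt E a b h w)) hs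
  simp only [map_sum, coeffAt_smul, E.semilinear, map_zero, ← Module.End.mul_apply, ← map_mul,
    inv_mul_cancel, map_one, Module.End.one_apply] at hsum
  have hcoeff := Fintype.linearIndependent_iff.1 c.linearIndependent _ hsum i
  rwa [smul_eq_zero_iff_eq] at hcoeff

theorem span_ytmul :
    ⊤ ≤ Submodule.span (Bos k p q) (Set.range fun i => ytmul E a b (c i) (genPG k q b)) := by
  set N := Submodule.span (Bos k p q) (Set.range fun i => ytmul E a b (c i) (genPG k q b))
  have hgen (z : K k p a) : ytmul E a b z (genPG k q b) ∈ N := by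
    induction c.mem_span z using Submodule.span_induction with
    | zero => rw [map_zero]; exact N.zero_mem
    | mem _ hz => obtain ⟨i, rfl⟩ := hz; exact Submodule.subset_span ⟨i, rfl⟩
    | add _ _ _ _ ha hb => rw [map_add]; exact N.add_mem ha hb
    | smul r _ _ ha => rw [← ofR_smul_ytmul]; exact N.smul_mem _ ha
  rintro w -
  induction w using YSummand.induction with
  | add _ _ ha hb => exact N.add_mem ha hb
  | tmul z v =>
    induction (basisPG k q b).mem_span v using Submodule.span_induction with
    | zero => rw [map_zero]; exact N.zero_mem
    | mem _ hv =>
      obtain ⟨h, rfl⟩ := hv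
      rw [← ofG_smul_ytmul_inv_genPG]
      exact N.smul_mem _ (hgen _)
    | add _ _ _ _ ha hb => rw [map_add]; exact N.add_mem ha hb
    | smul c _ _ ha => rw [map_smul, ← algebraMap_smul (Bos k p q)]; exact N.smul_mem _ ha

end Basis

/-- The basis `φ_{i,j} ⊗ φ_b` of `K_a ⊗ P_b(kG)` over `R # kG`. -/
def basisYSummand (a b : ℕ) : Module.Basis (Pairs a) (Bos k p q) (YSummand E a b) :=
  Module.Basis.mk (linearIndependent_ytmul E (basisK k p a) b) (span_ytmul E (basisK k p a) b)

theorem basisYSummand_apply (a b : ℕ) (ij : Pairs a) :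
    basisYSummand E a b ij = ytmul E a b (phi k p a ij.1.1 ij.1.2) (genPG k q b) := by
  rw [basisYSummand, Module.Basis.mk_apply, basisK_apply]

/-- The bijection `((i + j, l), (i, j)) ↦ (i, j, l)`. -/
def sigmaPairsEquiv (n : ℕ) : (Σ ab : Pairs n, Pairs ab.1.1) ≃ Triples n where
  toFun s := ⟨(s.2.1.1, s.2.1.2, s.1.1.2), by have := s.1.2; have := s.2.2; dsimp only; omega⟩
  invFun t := ⟨⟨(t.1.1 + t.1.2.1, t.1.2.2), t.2⟩, ⟨(t.1.1, t.1.2.1), rfl⟩⟩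
  left_inv := by
    rintro ⟨⟨⟨a, b⟩, h⟩, ⟨⟨i, j⟩, h'⟩⟩
    dsimp only at h'
    subst h'
    rfl
  right_inv _ := rfl

/-- The basis `φ_{i,j,l}` of `Y_n` over `R # kG`. -/
def basisY (n : ℕ) : Module.Basis (Triples n) (Bos k p q) (Y E n) :=
  (Pi.basis fun ab : Pairs n => basisYSummand E ab.1.1 ab.1.2).reindex (sigmaPairsEquiv n)

theorem phi3_apply (n : ℕ) (i j l : ℤ) (ab : Pairs n) : phi3 E n i j l ab =
    if (ab.1.2 : ℤ) = l then ytmul E ab.1.1 ab.1.2 (phi k p ab.1.1 i j) (genPG k q ab.1.2)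
    else 0 := rfl

theorem basisY_apply (n : ℕ) (t : Triples n) :
    basisY E n t = phi3 E n t.1.1 t.1.2.1 t.1.2.2 := by
  classical
  rw [basisY, Module.Basis.reindex_apply, Pi.basis_apply]
  funext ab
  rw [phi3_apply]
  by_cases h : (ab.1.2 : ℤ) = t.1.2.2
  · have hab : ab = ((sigmaPairsEquiv n).symm t).1 := by
      have := ab.2
      have := t.2
      refine Subtype.ext (Prod.ext ?_ ?_) <;> simp only [sigmaPairsEquiv, Equiv.coe_fn_symm_mk] <;>
        omega
    subst hab
    rw [if_pos h, Pi.single_eq_same, basisYSummand_apply]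
    rfl
  · rw [if_neg h, Pi.single_eq_of_ne]
    rintro rfl
    exact h rfl

theorem isFreeResolution_Y [NeZero q] (hE : ∀ h z, augK k p (E.rho 0 h z) = augK k p z) :
    IsFreeResolution (Bos k p q) (Y E) (dYB E) (augYB E hE) where
  free n := .of_basis (basisY E n)
  exact_succ := ((isFreeResolution_tot_PA_PB k p).tot (isFreeResolution_PG q k)).exact_succ
  exact_zero := ((isFreeResolution_tot_PA_PB k p).tot (isFreeResolution_PG q k)).exact_zero
  surjective := ((isFreeResolution_tot_PA_PB k p).tot (isFreeResolution_PG q k)).surjective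

end Smash

section Augmentation

variable {k : Type u} [Field k] {p : ℕ}

theorem augR_x (hp : p ≠ 0) : augR k p hp (x k p) = 0 := lift_x ..

theorem augR_y (hp : p ≠ 0) : augR k p hp (y k p) = 0 := lift_y ..

theorem augR_alpha (hp : p ≠ 0) (hp' : 2 < p) : augR k p hp (alpha k p) = 0 := by
  rw [alpha, map_add, map_neg, map_pow, augR_y, zero_pow (by omega), neg_zero, zero_add, map_sum]
  refine Finset.sum_eq_zero fun i hi => ?_
  have := (Finset.mem_Icc.1 hi).1
  rw [map_smul, map_mul, map_pow, augR_x, zero_pow (by omega), zero_mul, smul_zero]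

theorem augR_coeffX (hp : p ≠ 0) (hp' : 2 < p) (i : ℕ) : augR k p hp (coeffX k p i) = 0 := by
  rw [coeffX]
  split_ifs
  · rw [map_pow, augR_x, zero_pow (by omega)]
  · exact augR_x hp

theorem augR_twist (hp : p ≠ 0) (hp' : 2 < p) (i j : ℤ) :
    augR k p hp (twist k p i j) = if Even i ∧ Odd j then 1 else 0 := by
  simp only [twist, ← Int.not_odd_iff_even]
  split_ifs <;> simp_all [augR_alpha]

variable [CharP k p]

theorem augR_coeffY (hp : p ≠ 0) (hp' : 2 < p) (i j : ℕ) : augR k p hp (coeffY k p i j) = 0 := by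
  have : (if Odd j then 1 else p - 1) ≠ 0 := by split_ifs <;> omega
  rw [coeffY_eq k p hp', map_smul, map_pow, yShift, map_add, map_smul, augR_x, augR_y, smul_zero,
    add_zero, zero_pow this, smul_zero]

variable [Fact p.Prime]

theorem augR_sigma (hp : p ≠ 0) (c : k) (r : R k p) :
    augR k p hp (sigma k p c r) = augR k p hp r := by
  rw [← AlgHom.comp_apply]
  congr 1
  apply hom_ext <;> simp [sigma_x, sigma_y, augR_x, augR_y]

variable {q : ℕ} [Fact (p ∣ q)]

theorem augR_smul (hp : p ≠ 0) (h : G q) (r : R k p) : augR k p hp (h • r) = augR k p hp r :=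
  augR_sigma hp _ r

theorem augBos_ofR (r : R k p) :
    augBos k p q (ofR k p q r) = augR k p (Fact.out : p.Prime).ne_zero r := augBos_single 1 r

theorem augBos_ofG (h : G q) : augBos k p q (ofG k p q h) = 1 := by
  rw [ofG, augBos_single, map_one]

theorem augBos_coeffG (l : ℕ) : augBos k p q (coeffG k p q l) = 0 := by
  rw [coeffG]
  split_ifs
  · rw [map_sub, augBos_ofG, map_one, sub_self]
  · simp only [map_sum, augBos_ofG, Finset.sum_const, Finset.card_range, nsmul_one]
    exact (CharP.cast_eq_zero_iff k p q).2 Fact.out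

variable [NeZero q]

theorem augK_equivariantK (hp : 2 < p) (h : G q) (z : K k p 0) :
    augK k p ((equivariantK k p q hp).rho 0 h z) = augK k p z := by
  let E := equivariantK k p q hp
  have heq : ((toTriv k).toLinearMap ∘ₗ augK k p) ∘ₗ E.rho 0 h =
      (toTriv k).toLinearMap ∘ₗ augK k p := by
    refine eq_of_semilinear_of_basis (basisK k p 0) (σ := id) (fun r z => ?_) (fun r z => ?_)
      fun ij => ?_
    · simp only [LinearMap.comp_apply, LinearEquiv.coe_coe, E.semilinear, augK_smul, augR_smul,
        R_smul_triv, id]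
    · simp only [LinearMap.comp_apply, LinearEquiv.coe_coe, augK_smul, R_smul_triv, id]
    · obtain ⟨s, rfl⟩ := exists_g_pow_eq q h
      have := ij.2
      rw [LinearMap.comp_apply, basisK_apply, equivariantK_phi,
        phi_eq_zero k p 0 (i := ij.1.1 + 1) (by omega), smul_zero, add_zero]
  exact (toTriv k).injective (LinearMap.congr_fun heq z)

end Augmentation

section Differential

variable {k : Type u} [Field k] {p q : ℕ} [Fact p.Prime] [CharP k p] [Fact (p ∣ q)]

variable (k p q) in
/-- The coefficient of `φ_{i+1,j-1,l}` in the expansion of `-φ_{i,j} ⊗ g ^ s` over the basis of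
`Y`. -/
def twistSum (i j : ℤ) (s : ℕ) : Bos k p q :=
  ofR k p q (∑ t ∈ Finset.range s, g q ^ t • twist k p i j) * ofG k p q (g q ^ s)

theorem ofR_one : ofR k p q 1 = 1 := rfl

theorem ofR_zero : ofR k p q 0 = 0 := SkewMonoidAlgebra.single_zero_right 1

theorem ofR_smul (c : k) (r : R k p) : ofR k p q (c • r) = c • ofR k p q r :=
  (SkewMonoidAlgebra.smul_single c 1 r).symm

theorem twistSum_zero (i j : ℤ) : twistSum k p q i j 0 = 0 := by
  rw [twistSum, Finset.sum_range_zero, ofR_zero, zero_mul]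

theorem twistSum_one (i j : ℤ) :
    twistSum k p q i j 1 = ofR k p q (twist k p i j) * ofG k p q (g q) := by
  rw [twistSum, Finset.sum_range_one, pow_zero, one_smul, pow_one]

theorem twistSum_of_odd {i : ℤ} (hi : Odd i) (j : ℤ) (s : ℕ) : twistSum k p q i j s = 0 := by
  simp only [twistSum, twist_of_odd k p hi, smul_zero, Finset.sum_const_zero, ofR_zero, zero_mul]

theorem twistSum_of_even_of_odd {i j : ℤ} (hi : Even i) (hj : Odd j) (s : ℕ) :
    twistSum k p q i j s = (s : k) • ofG k p q (g q ^ s) := by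
  rw [twistSum, twist_of_even_of_odd k p hi hj, sum_range_g_pow_smul_one, ofR_smul, ofR_one,
    smul_mul_assoc, one_mul]

theorem twistSum_of_even_of_even {i j : ℤ} (hi : Even i) (hj : Even j) (s : ℕ) :
    twistSum k p q i j s =
      ofR k p q (∑ t ∈ Finset.range s, g q ^ t • alpha k p) * ofG k p q (g q ^ s) := by
  rw [twistSum, twist_of_even_of_even k p hi hj]

theorem coeffTwist_of_odd (i j : ℕ) {l : ℕ} (hl : Odd l) :
    coeffTwist k p q i j l = twistSum k p q i j 1 := by
  rw [coeffTwist, twistSum_one, twist, if_pos hl]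
  simp only [Int.odd_coe_nat]
  split_ifs
  · rw [ofR_zero, zero_mul]
  · rw [ofR_one, one_mul]
  · rfl

theorem augBos_twistSum (hp : 2 < p) (i j : ℤ) (s : ℕ) :
    augBos k p q (twistSum k p q i j s) = if Even i ∧ Odd j then (s : k) else 0 := by
  rw [twistSum, map_mul, augBos_ofR, augBos_ofG, mul_one, map_sum]
  simp only [augR_smul, augR_twist _ hp, Finset.sum_const, Finset.card_range, nsmul_eq_mul,
    mul_ite, mul_one, mul_zero]

variable [NeZero q]

theorem coeffTwist_of_even (i j : ℕ) {l : ℕ} (hl : Even l) :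
    coeffTwist k p q i j l = ∑ s ∈ Finset.range q, twistSum k p q i j s := by
  rw [coeffTwist, if_neg (Nat.not_odd_iff_even.2 hl)]
  split_ifs with hi hj
  · exact (Finset.sum_eq_zero fun s _ => twistSum_of_odd (mod_cast hi) _ s).symm
  · rw [Nat.not_odd_iff_even] at hi
    exact Finset.sum_congr rfl fun s _ =>
      (twistSum_of_even_of_odd (mod_cast hi) (mod_cast hj) s).symm
  · rw [Nat.not_odd_iff_even] at hi hj
    rw [Finset.range_eq_Ico, Finset.sum_eq_sum_Ico_succ_bot (NeZero.pos q), twistSum_zero,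
      zero_add]
    exact Finset.sum_congr rfl fun s _ =>
      (twistSum_of_even_of_even (mod_cast hi) (mod_cast hj) s).symm

theorem augBos_coeffTwist (hp : 2 < p) (i j l : ℕ) : augBos k p q (coeffTwist k p q i j l) =
    if Even i ∧ Odd j ∧ Odd l then 1 else 0 := by
  rcases Nat.even_or_odd l with hl | hl
  · have hsum := sum_range_natCast_pow_eq_zero (k := k) (q := q) (m := 1) Fact.out
      (show 1 < p - 1 by omega)
    simp only [pow_one] at hsum
    rw [coeffTwist_of_even i j hl, if_neg fun h => Nat.not_odd_iff_even.2 hl h.2.2, map_sum]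
    simp only [augBos_twistSum hp]
    split_ifs
    · exact hsum
    · exact Finset.sum_const_zero
  · simp only [coeffTwist_of_odd i j hl, augBos_twistSum hp, Int.even_coe_nat, Int.odd_coe_nat, hl,
      and_true, Nat.cast_one]

variable (hp : 2 < p)

theorem ytmul_phi_basisPG (a b s : ℕ) (i j : ℤ) :
    ytmul (equivariantK k p q hp) a b (phi k p a i j) (basisPG k q b (g q ^ s)) =
      ofG k p q (g q ^ s) • ytmul (equivariantK k p q hp) a b (phi k p a i j) (genPG k q b) -
        twistSum k p q i j s •
          ytmul (equivariantK k p q hp) a b (phi k p a (i + 1) (j - 1)) (genPG k q b) := by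
  rcases Int.even_or_odd i with hi | hi
  · rw [twistSum, mul_smul, ofG_smul_ytmul, ofG_smul_ytmul, ofR_smul_ytmul, regG_genPG,
      equivariantK_phi, equivariantK_phi_of_odd k p q hp a _ hi.add_one, map_add,
      LinearMap.add_apply, add_sub_cancel_right]
  · rw [twistSum_of_odd hi, zero_smul, sub_zero, ofG_smul_ytmul, regG_genPG,
      equivariantK_phi_of_odd k p q hp a _ hi]

theorem ytmul_phi_dG_genPG (a b i j : ℕ) :
    ytmul (equivariantK k p q hp) a b (phi k p a i j) (dG k q b (genPG k q (b + 1))) =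
      coeffG k p q (b + 1) •
          ytmul (equivariantK k p q hp) a b (phi k p a i j) (genPG k q b) -
        coeffTwist k p q i j (b + 1) •
          ytmul (equivariantK k p q hp) a b (phi k p a (i + 1) (j - 1)) (genPG k q b) := by
  rcases Nat.even_or_odd (b + 1) with hb | hb
  · rw [coeffTwist_of_even i j hb, coeffG, if_neg (Nat.not_odd_iff_even.2 hb), Finset.sum_smul,
      Finset.sum_smul, ← Finset.sum_sub_distrib, dG_genPG_of_even k q hb, map_sum]
    exact Finset.sum_congr rfl fun s _ => ytmul_phi_basisPG hp a b s i j
  · have h := ytmul_phi_basisPG (k := k) (q := q) hp a b 1 i j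
    rw [pow_one] at h
    rw [coeffTwist_of_odd i j hb, coeffG, if_pos hb, sub_smul, one_smul, dG_genPG_of_odd k q hb,
      map_sub, h, sub_right_comm]

theorem dYB_phi3 (n i j l : ℕ) (h : i + j + l = n + 1) :
    dYB (equivariantK k p q hp) n (phi3 (equivariantK k p q hp) (n + 1) i j l) =
      (ofR k p q (coeffX k p i) • phi3 (equivariantK k p q hp) n (i - 1) j l +
        ofR k p q (coeffY k p i j) • phi3 (equivariantK k p q hp) n i (j - 1) l) +
      (-1 : k) ^ (i + j) •
        (coeffG k p q l • phi3 (equivariantK k p q hp) n i j (l - 1) -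
          coeffTwist k p q i j l • phi3 (equivariantK k p q hp) n (i + 1) (j - 1) (l - 1)) := by
  change dY _ n _ = _
  funext ab
  have := ab.2
  simp only [dY_apply, Pi.add_apply, Pi.smul_apply, Pi.sub_apply, phi3_apply]
  congr 1
  · by_cases hl : ab.1.2 = l
    · subst hl
      rw [if_pos rfl, if_pos rfl, if_pos rfl, dKY_ytmul, ofR_smul_ytmul, ofR_smul_ytmul,
        dK_phi k p hp ab.1.1 i j (by omega), map_add, LinearMap.add_apply]
    · rw [if_neg (by omega), if_neg (by omega), if_neg (by omega), map_zero, smul_zero, smul_zero,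
        add_zero]
  · by_cases hl : ab.1.2 + 1 = l
    · subst hl
      rw [if_pos rfl, if_pos (by push_cast; ring), if_pos (by push_cast; ring), dGY_ytmul,
        ytmul_phi_dG_genPG, show ab.1.1 = i + j by omega]
    · rw [if_neg (by push_cast; omega), if_neg (by omega), if_neg (by omega), map_zero, smul_zero,
        smul_zero, smul_zero, sub_zero, smul_zero]

end Differential

/-! ### Cohomology -/

section Dual

variable {k : Type u} [Field k] {p q : ℕ} [Fact p.Prime] [CharP k p] [Fact (p ∣ q)]
  (E : EquivariantAction k (R k p) (G q) (K k p) (dK k p))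

instance (n : ℕ) : Finite (Triples n) := Finite.of_equiv _ (sigmaPairsEquiv n)

/-- The basis `φ^*_{i,j,l}` of `Hom_{R # kG}(Y_n, k)`. -/
def dualY (n : ℕ) : Module.Basis (Triples n) k (Y E n →ₗ[Bos k p q] Triv k) :=
  Module.Basis.ofEquivFun (((basisY E n).constr k).symm.trans
    (LinearEquiv.piCongrRight fun _ => (toTriv k).symm))

theorem dualY_basisY (n : ℕ) (t t' : Triples n) :
    dualY E n t (basisY E n t') = toTriv k (if t = t' then 1 else 0) := by
  classical
  rw [dualY, Module.Basis.coe_ofEquivFun]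
  change (basisY E n).constr k (fun t' => toTriv k ((Pi.single t 1 : Triples n → k) t')) _ = _
  rw [Module.Basis.constr_basis, Pi.single_apply]
  simp only [eq_comm]

theorem phi3_eq_zero (n : ℕ) {i j l : ℤ} (h : i < 0 ∨ j < 0 ∨ l < 0) : phi3 E n i j l = 0 := by
  funext ab
  rw [phi3_apply, Pi.zero_apply]
  split_ifs
  · rw [phi_eq_zero k p _ (by omega), map_zero, LinearMap.zero_apply]
  · rfl

theorem dualY_phi3 (n : ℕ) (t : Triples n) {i j l : ℤ} (h : i + j + l = n) :
    dualY E n t (phi3 E n i j l) =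
      toTriv k (if (t.1.1 : ℤ) = i ∧ (t.1.2.1 : ℤ) = j ∧ (t.1.2.2 : ℤ) = l then 1 else 0) := by
  by_cases hneg : i < 0 ∨ j < 0 ∨ l < 0
  · rw [phi3_eq_zero E n hneg, map_zero, if_neg (by omega), map_zero]
  · lift i to ℕ using by omega
    lift j to ℕ using by omega
    lift l to ℕ using by omega
    have hbasis := basisY_apply E n ⟨(i, j, l), by dsimp only; omega⟩
    dsimp only at hbasis
    rw [← hbasis, dualY_basisY]
    simp only [Nat.cast_inj, Subtype.ext_iff, Prod.ext_iff]

end Dual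

section Shift

variable {n : ℕ}

/-- The shift of indices `(i, j, l) ↦ (i - 1, j + 1, l + 1)` effected by the coboundary. Its value
at `i = 0` is junk. -/
def shiftTriple (t : Triples n) : Triples (n + 1) :=
  if h : 0 < t.1.1 then ⟨(t.1.1 - 1, t.1.2.1 + 1, t.1.2.2 + 1), by
    have := t.2; dsimp only; omega⟩
  else ⟨(n + 1, 0, 0), rfl⟩

theorem shiftTriple_val {t : Triples n} (h : Odd t.1.1) :
    (shiftTriple t).1 = (t.1.1 - 1, t.1.2.1 + 1, t.1.2.2 + 1) := by
  rw [shiftTriple, dif_pos h.pos]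

theorem injOn_shiftTriple :
    Set.InjOn (shiftTriple (n := n)) {t | Odd t.1.1 ∧ Even t.1.2.1 ∧ Even t.1.2.2} := by
  intro t ht t' ht' h
  have hval := congrArg Subtype.val h
  rw [shiftTriple_val ht.1, shiftTriple_val ht'.1] at hval
  simp only [Prod.ext_iff] at hval
  have := ht.1.pos
  have := ht'.1.pos
  refine Subtype.ext (Prod.ext ?_ (Prod.ext ?_ ?_)) <;> omega

theorem shiftTriple_eq_iff {t : Triples n} (ht : Odd t.1.1 ∧ Even t.1.2.1 ∧ Even t.1.2.2)
    (t' : Triples (n + 1)) : shiftTriple t = t' ↔ (Even t'.1.1 ∧ Odd t'.1.2.1 ∧ Odd t'.1.2.2) ∧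
      t.1.1 = t'.1.1 + 1 ∧ t.1.2.1 + 1 = t'.1.2.1 ∧ t.1.2.2 + 1 = t'.1.2.2 := by
  rw [Subtype.ext_iff, shiftTriple_val ht.1, Prod.ext_iff, Prod.ext_iff]
  simp only [Nat.even_iff, Nat.odd_iff] at ht ⊢
  omega

theorem image_shiftTriple :
    shiftTriple (n := n) '' {t | Odd t.1.1 ∧ Even t.1.2.1 ∧ Even t.1.2.2} =
      {t | Even t.1.1 ∧ Odd t.1.2.1 ∧ Odd t.1.2.2} := by
  ext t
  constructor
  · rintro ⟨t, ht, rfl⟩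
    exact ((shiftTriple_eq_iff ht _).1 rfl).1
  · rintro ⟨hi, hj, hl⟩
    have := t.2
    have := hj.pos
    have := hl.pos
    refine ⟨⟨(t.1.1 + 1, t.1.2.1 - 1, t.1.2.2 - 1), by dsimp only; omega⟩,
      ⟨hi.add_one, Nat.Odd.sub_odd hj odd_one, Nat.Odd.sub_odd hl odd_one⟩, ?_⟩
    rw [shiftTriple_eq_iff ⟨hi.add_one, Nat.Odd.sub_odd hj odd_one, Nat.Odd.sub_odd hl odd_one⟩]
    exact ⟨⟨hi, hj, hl⟩, by dsimp only; omega⟩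

end Shift

section Coboundary

variable {k : Type u} [Field k] {p q : ℕ} [Fact p.Prime] [CharP k p] [Fact (p ∣ q)] [NeZero q]
  (hp : 2 < p)

theorem coboundary_dualY_basisY (n : ℕ) (t : Triples n) (t' : Triples (n + 1)) :
    coboundary k (S := Bos k p q) (Triv k) (dYB (equivariantK k p q hp) n)
      (dualY (equivariantK k p q hp) n t) (basisY (equivariantK k p q hp) (n + 1) t') =
      toTriv k (if (Even t'.1.1 ∧ Odd t'.1.2.1 ∧ Odd t'.1.2.2) ∧
        t.1.1 = t'.1.1 + 1 ∧ t.1.2.1 + 1 = t'.1.2.1 ∧ t.1.2.2 + 1 = t'.1.2.2 then 1 else 0) := by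
  obtain ⟨⟨i, j, l⟩, ht'⟩ := t'
  dsimp only at ht'
  change dualY _ n t (dYB _ n _) = _
  rw [basisY_apply, dYB_phi3 hp n i j l ht']
  simp only [map_add, map_smul, map_sub, ← algebraMap_smul (Bos k p q) ((-1 : k) ^ (i + j))]
  rw [dualY_phi3 _ _ _ (by omega), dualY_phi3 _ _ _ (by omega), dualY_phi3 _ _ _ (by omega),
    dualY_phi3 _ _ _ (by omega)]
  simp only [Bos_smul_triv, augBos_ofR, augR_coeffX _ hp, augR_coeffY _ hp, augBos_coeffG,
    augBos_coeffTwist hp, zero_mul, ← map_add, ← map_sub, AlgHom.commutes]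
  congr 1
  by_cases h : Even i ∧ Odd j ∧ Odd l
  · have hshift : ((t.1.1 : ℤ) = i + 1 ∧ (t.1.2.1 : ℤ) = j - 1 ∧ (t.1.2.2 : ℤ) = l - 1) ↔
        (t.1.1 = i + 1 ∧ t.1.2.1 + 1 = j ∧ t.1.2.2 + 1 = l) := by omega
    rw [if_pos h, (h.1.add_odd h.2.1).neg_one_pow, map_neg, map_one]
    simp only [hshift, h, true_and, and_self]
    ring
  · simp only [h, if_false, false_and, zero_mul, sub_zero, mul_zero, add_zero]

theorem coboundary_dualY {n : ℕ} {t : Triples n}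
    (ht : Odd t.1.1 ∧ Even t.1.2.1 ∧ Even t.1.2.2) :
    coboundary k (S := Bos k p q) (Triv k) (dYB (equivariantK k p q hp) n)
      (dualY (equivariantK k p q hp) n t) =
      dualY (equivariantK k p q hp) (n + 1) (shiftTriple t) := by
  refine (basisY (equivariantK k p q hp) (n + 1)).ext fun t' => ?_
  rw [coboundary_dualY_basisY, dualY_basisY]
  simp only [shiftTriple_eq_iff ht]

theorem coboundary_dualY_eq_zero {n : ℕ} {t : Triples n}
    (ht : ¬(Odd t.1.1 ∧ Even t.1.2.1 ∧ Even t.1.2.2)) :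
    coboundary k (S := Bos k p q) (Triv k) (dYB (equivariantK k p q hp) n)
      (dualY (equivariantK k p q hp) n t) = 0 := by
  refine (basisY (equivariantK k p q hp) (n + 1)).ext fun t' => ?_
  rw [coboundary_dualY_basisY, if_neg, map_zero, LinearMap.zero_apply]
  simp only [Nat.even_iff, Nat.odd_iff] at ht ⊢
  omega

theorem ker_coboundary (n : ℕ) : LinearMap.ker (coboundary k (S := Bos k p q) (Triv k)
    (dYB (equivariantK k p q hp) n)) = Submodule.span k (dualY (equivariantK k p q hp) n ''
      {t | ¬(Odd t.1.1 ∧ Even t.1.2.1 ∧ Even t.1.2.2)}) :=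
  ker_eq_span_of_basis_map (dualY _ n) (dualY _ (n + 1)) injOn_shiftTriple
    (fun _ => coboundary_dualY hp) fun _ => coboundary_dualY_eq_zero hp

theorem range_coboundary (n : ℕ) : LinearMap.range (coboundary k (S := Bos k p q) (Triv k)
    (dYB (equivariantK k p q hp) n)) = Submodule.span k (dualY (equivariantK k p q hp) (n + 1) ''
      {t | Even t.1.1 ∧ Odd t.1.2.1 ∧ Odd t.1.2.2}) := by
  rw [← image_shiftTriple]
  exact range_eq_span_of_basis_map (dualY _ n) (dualY _ (n + 1))
    (fun _ => coboundary_dualY hp) fun _ => coboundary_dualY_eq_zero hp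

end Coboundary

section Cohomology

variable {k : Type u} [Field k] {p q : ℕ} [Fact p.Prime] [CharP k p] [Fact (p ∣ q)]

instance : IsScalarTower k (Bos k p q) (Triv k) where
  smul_assoc c s t := by
    change augBos k p q (c • s) • t = c • augBos k p q s • t
    rw [map_smul, smul_assoc]

variable [NeZero q] (hp : 2 < p)

theorem nonempty_cohomology_equiv (n : ℕ) :
    Nonempty (H k p q n ≃ₗ[k] Submodule.span k (dualY (equivariantK k p q hp) n ''
      ({t | ¬(Odd t.1.1 ∧ Even t.1.2.1 ∧ Even t.1.2.2)} \
        {t | Even t.1.1 ∧ Odd t.1.2.1 ∧ Odd t.1.2.2}))) := by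
  have hY := isFreeResolution_Y (equivariantK k p q hp) (augK_equivariantK hp)
  cases n with
  | zero =>
    have hempty : {t : Triples 0 | Even t.1.1 ∧ Odd t.1.2.1 ∧ Odd t.1.2.2} = ∅ := by
      refine Set.eq_empty_of_forall_notMem fun t ht => ?_
      have := t.2
      have := ht.2.1.pos
      omega
    rw [hempty, Set.sdiff_empty, ← ker_coboundary]
    exact hY.nonempty_ext_zero_equiv
  | succ n =>
    obtain ⟨eExt⟩ := hY.nonempty_ext_succ_equiv (k := k) (T := Triv k) n
    rw [ker_coboundary, range_coboundary] at eExt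
    obtain ⟨eSpan⟩ := nonempty_span_quotient_span_equiv (dualY (equivariantK k p q hp) (n + 1))
      (S := {t | ¬(Odd t.1.1 ∧ Even t.1.2.1 ∧ Even t.1.2.2)})
      (T := {t | Even t.1.1 ∧ Odd t.1.2.1 ∧ Odd t.1.2.2})
      fun t ht h => Nat.not_odd_iff_even.2 ht.1 h.1
    exact ⟨eExt ≪≫ₗ eSpan⟩

theorem nonempty_cohomology_equiv_of_even {n : ℕ} (hn : Even n) :
    Nonempty (H k p q n ≃ₗ[k] Submodule.span k (dualY (equivariantK k p q hp) n ''
      {t | ¬(Even t.1.1 ∧ Odd t.1.2.1 ∧ Odd t.1.2.2)})) := by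
  have hset : {t : Triples n | ¬(Even t.1.1 ∧ Odd t.1.2.1 ∧ Odd t.1.2.2)} =
      {t | ¬(Odd t.1.1 ∧ Even t.1.2.1 ∧ Even t.1.2.2)} \
        {t | Even t.1.1 ∧ Odd t.1.2.1 ∧ Odd t.1.2.2} := by
    ext t
    have := t.2
    simp only [Nat.even_iff, Nat.odd_iff, Set.mem_sdiff, Set.mem_ofPred_eq] at hn ⊢
    omega
  rw [hset]
  exact nonempty_cohomology_equiv hp n

theorem nonempty_cohomology_equiv_of_odd {n : ℕ} (hn : Odd n) :
    Nonempty (H k p q n ≃ₗ[k] Submodule.span k (dualY (equivariantK k p q hp) n ''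
      {t | ¬(Odd t.1.1 ∧ Even t.1.2.1 ∧ Even t.1.2.2)})) := by
  have hset : {t : Triples n | ¬(Odd t.1.1 ∧ Even t.1.2.1 ∧ Even t.1.2.2)} =
      {t | ¬(Odd t.1.1 ∧ Even t.1.2.1 ∧ Even t.1.2.2)} \
        {t | Even t.1.1 ∧ Odd t.1.2.1 ∧ Odd t.1.2.2} := by
    ext t
    have := t.2
    simp only [Nat.even_iff, Nat.odd_iff, Set.mem_sdiff, Set.mem_ofPred_eq] at hn ⊢
    omega
  rw [hset]
  exact nonempty_cohomology_equiv hp n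

end Cohomology

end JordanBosonization

end

theorem mainTheorem4 {k : Type u} [Field k] (p q : ℕ) [Fact p.Prime] [CharP k p] (hp : 2 < p)
    [NeZero q] [Fact (p ∣ q)] :
    -- `R` is the twisted tensor product of `k[x]/(x^p)` and `k[y]/(y^p)`, and how `G` acts on it
    (∃ b : Module.Basis (Fin p × Fin p) k (R k p),
      ∀ ij, b ij = x k p ^ (ij.1 : ℕ) * y k p ^ (ij.2 : ℕ)) ∧
    (∀ r l : ℕ, y k p ^ r * x k p ^ l = ∑ t ∈ Finset.range (r + 1),
      ((r.choose t : k) * (2⁻¹ : k) ^ t * (l.ascFactorial t : k)) •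
        (x k p ^ (l + t) * y k p ^ (r - t))) ∧
    g q • x k p = x k p ∧ g q • y k p = x k p + y k p ∧
    -- the `R`-module structure of `P_i(A) ⊗ P_j(B)` is the one given by the twisting map `τ_i`
    (∀ i j l r m s : ℕ,
      (x k p ^ l * y k p ^ r) • (xPow k p i m ⊗ₜ[k] yPow k p j s) =
        ∑ t ∈ Finset.range (r + 1),
          ((r.choose t : k) * (2⁻¹ : k) ^ t * ((m + i % 2).ascFactorial t : k)) •
            (xPow k p i (l + (m + t)) ⊗ₜ[k] yPow k p j (r - t + s))) ∧
    -- `K` is a free resolution of `k` over `R` with the stated bases and differentials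
    (∃ (d : ∀ n, K k p (n + 1) →ₗ[R k p] K k p n) (ε : K k p 0 →ₗ[R k p] Triv k),
      (∀ n z, d n z = dK k p n z) ∧ (∀ z, ε z = toTriv k (augK k p z)) ∧
      IsFreeResolution (R k p) (K k p) d ε) ∧
    (∀ n, ∃ b : Module.Basis (Pairs n) (R k p) (K k p n),
      ∀ ij, b ij = phi k p n ij.1.1 ij.1.2) ∧
    (∀ n i j : ℕ, i + j = n + 1 →
      dK k p n (phi k p (n + 1) i j) =
        coeffX k p i • phi k p n (i - 1) j + coeffY k p i j • phi k p n i (j - 1)) ∧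
    -- `K` is `G`-equivariant
    ∃ E : EquivariantAction k (R k p) (G q) (K k p) (dK k p),
      (∀ n i j s : ℕ, i + j = n → Odd i →
        E.rho n (g q ^ s) (phi k p n i j) = phi k p n i j ∧
        E.rho n (g q ^ s)⁻¹ (phi k p n i j) = phi k p n i j) ∧
      (∀ n i j s : ℕ, i + j = n → Even i → Odd j →
        E.rho n (g q ^ s) (phi k p n i j) =
          phi k p n i j + (s : k) • phi k p n (i + 1) (j - 1) ∧
        E.rho n (g q ^ s)⁻¹ (phi k p n i j) =
          phi k p n i j - (s : k) • phi k p n (i + 1) (j - 1)) ∧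
      (∀ n i j s : ℕ, i + j = n → Even i → Even j →
        E.rho n (g q ^ s) (phi k p n i j) =
          phi k p n i j +
            (∑ t ∈ Finset.range s, g q ^ t • alpha k p) • phi k p n (i + 1) (j - 1) ∧
        E.rho n (g q ^ s)⁻¹ (phi k p n i j) =
          phi k p n i j -
            (∑ t ∈ Finset.Icc 1 s, (g q ^ t)⁻¹ • alpha k p) • phi k p n (i + 1) (j - 1)) ∧
      -- `Y` is a free resolution of `k` over `R # kG` with the stated bases and differentials
      ∃ (d : ∀ n, Y E (n + 1) →ₗ[Bos k p q] Y E n) (ε : Y E 0 →ₗ[Bos k p q] Triv k),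
        (∀ n z, d n z = dY E n z) ∧ (∀ z, ε z = toTriv k (augY E z)) ∧
        IsFreeResolution (Bos k p q) (Y E) d ε ∧
        (∀ n, ∃ b : Module.Basis (Triples n) (Bos k p q) (Y E n),
          ∀ t, b t = phi3 E n t.1.1 t.1.2.1 t.1.2.2) ∧
        (∀ n i j l : ℕ, i + j + l = n + 1 →
          d n (phi3 E (n + 1) i j l) =
            (ofR k p q (coeffX k p i) • phi3 E n (i - 1) j l +
              ofR k p q (coeffY k p i j) • phi3 E n i (j - 1) l) +
            (-1 : k) ^ (i + j) •
              (coeffG k p q l • phi3 E n i j (l - 1) -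
                coeffTwist k p q i j l • phi3 E n (i + 1) (j - 1) (l - 1))) ∧
        -- the dual bases, the cochain complex and the cohomology
        ∃ φ : ∀ n, Module.Basis (Triples n) k (Y E n →ₗ[Bos k p q] Triv k),
          (∀ n (t t' : Triples n),
            φ n t (phi3 E n t'.1.1 t'.1.2.1 t'.1.2.2) = toTriv k (if t = t' then 1 else 0)) ∧
          (∀ n (t : Triples n), Odd t.1.1 → Even t.1.2.1 → Even t.1.2.2 →
            ∃ t' : Triples (n + 1), t'.1 = (t.1.1 - 1, t.1.2.1 + 1, t.1.2.2 + 1) ∧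
              coboundary k (S := Bos k p q) (Triv k) (d n) (φ n t) = φ (n + 1) t') ∧
          (∀ n (t : Triples n), ¬(Odd t.1.1 ∧ Even t.1.2.1 ∧ Even t.1.2.2) →
            coboundary k (S := Bos k p q) (Triv k) (d n) (φ n t) = 0) ∧
          (∀ n, LinearMap.ker (coboundary k (S := Bos k p q) (Triv k) (d n)) =
            Submodule.span k (φ n '' {t | ¬(Odd t.1.1 ∧ Even t.1.2.1 ∧ Even t.1.2.2)})) ∧
          (∀ n, LinearMap.range (coboundary k (S := Bos k p q) (Triv k) (d n)) =
            Submodule.span k (φ (n + 1) '' {t | Even t.1.1 ∧ Odd t.1.2.1 ∧ Odd t.1.2.2})) ∧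
          (∀ n, Even n → Nonempty (H k p q n ≃ₗ[k]
            Submodule.span k (φ n '' {t | ¬(Even t.1.1 ∧ Odd t.1.2.1 ∧ Odd t.1.2.2)}))) ∧
          (∀ n, Odd n → Nonempty (H k p q n ≃ₗ[k]
            Submodule.span k (φ n '' {t | ¬(Odd t.1.1 ∧ Even t.1.2.1 ∧ Even t.1.2.2)}))) := by
  refine ⟨⟨monomialBasis k p, monomialBasis_apply k p⟩, (jordanRel_x_y k p).pow_mul_pow,
    by rw [g_smul, sigma_x], by rw [g_smul, sigma_y, one_smul, add_comm],
    x_pow_mul_y_pow_smul k p,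
    ⟨dKR k p, augKR k p, fun _ _ => rfl, fun _ => rfl, isFreeResolution_K k p⟩,
    fun n => ⟨basisK k p n, basisK_apply k p n⟩, dK_phi k p hp, equivariantK k p q hp,
    fun n i j s _ hi => ?_, fun n i j s _ hi hj => ?_, fun n i j s _ hi hj => ?_,
    dYB _, augYB _ (augK_equivariantK hp), fun _ _ => rfl, fun _ => rfl,
    isFreeResolution_Y _ (augK_equivariantK hp),
    fun n => ⟨basisY _ n, basisY_apply _ n⟩, dYB_phi3 hp,
    dualY _, fun n t t' => by rw [← basisY_apply, dualY_basisY],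
    fun n t hi hj hl => ⟨shiftTriple t, shiftTriple_val hi, coboundary_dualY hp ⟨hi, hj, hl⟩⟩,
    fun _ _ => coboundary_dualY_eq_zero hp, ker_coboundary hp, range_coboundary hp,
    fun _ => nonempty_cohomology_equiv_of_even hp, fun _ => nonempty_cohomology_equiv_of_odd hp⟩
  · exact ⟨equivariantK_phi_of_odd k p q hp n _ (mod_cast hi) _,
      equivariantK_phi_of_odd k p q hp n _ (mod_cast hi) _⟩
  · exact ⟨equivariantK_phi_of_even_of_odd k p q hp n s (mod_cast hi) (mod_cast hj),
      equivariantK_inv_phi_of_even_of_odd k p q hp n s (mod_cast hi) (mod_cast hj)⟩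
  · exact ⟨equivariantK_phi_of_even_of_even k p q hp n s (mod_cast hi) (mod_cast hj),
      equivariantK_inv_phi_of_even_of_even k p q hp n s (mod_cast hi) (mod_cast hj)⟩
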